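/- **Setting.** There are $N\ge1$ agents, a horizon $H\ge 1$, a context set $\mathcal C$ and local state and action sets $\mathcal S_i,\mathcal A_i$ ($i\in[N]$). These sets are arbitrary, possibly infinite; all distributions on them are given by probability mass functions, and $\Delta_{\mathcal X}$ denotes the probability mass functions on $\mathcal X$. In each episode a public context $c\sim\rho$ is drawn and stays fixed; agent $i$ starts in a fixed local state $s_{i,1}$ and moves by its own kernel, $s_{i,h+1}\sim P^\star_{i,h}(\cdot\mid c,s_{i,h},a_{i,h})$, independently of the other agents. At step $h$ agent $i$ receives a reward from a distribution $R^\star_{i,h}(c,\boldsymbol s,\boldsymbol a)$ on $[0,1]$ that depends on the joint state and joint action, with mean $r^\star_{i,h}(c,\boldsymbol s,\boldsymbol a)$. A local policy of agent $i$ is $\mu_i=\{\mu_{i,h}:\mathcal C\times\mathcal S_i\to\Delta_{\mathcal A_i}\}_{h\in[H]}$, a product policy is $\pi=\prod_i\pi_i$ with local policies $\pi_i$, and $d_h^{\mu_i}(\cdot\mid c)$ is the law of $s_{i,h}$ under $\mu_i$. $V^{\pi}_{i,1}$ is the expected return of agent $i$. For a mixture of product policies (one of them is drawn at the start of the episode),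 expected returns are averaged, and a deviation of agent $i$ replaces its component in every product policy of the mixture. For such a $\pi$, $$\mathsf{Gap}_i(\pi)=\sup_{\mu_i}\mathbb E_{c\sim\rho}\big[V^{\mu_i\times\pi_{-i}}_{i,1}(c,\boldsymbol s_1)\big]-\mathbb E_{c\sim\rho}\big[V^{\pi}_{i,1}(c,\boldsymbol s_1)\big],$$ and $\pi$ is an $\epsilon$-approximate coarse correlated equilibrium (CCE) if $\mathsf{Gap}_i(\pi)\le\epsilon$ for all $i$. For $p,q,\nu\in\Delta_{\mathcal X}$ let $D_\nu(p,q)=\sum_a (p(a)-q(a))^2/\nu(a)\in[0,\infty]$ (with $0/0=0$ and $x/0=\infty$ for $x>0$) and $\chi^2(p,\nu)=D_\nu(p,\nu)$. **Data.** For each $h\in[H]$ the dataset $\mathcal D_h$ consists of $M\ge1$ i.i.d. samples $(c,\{s_i,a_i,s_i'\}_i,\{r_i\}_i)$ with $c\sim\rho$, and, independently over $i$ given $c$, $s_i\sim\sigma_{i,h}(\cdot\mid c)$, $a_i\sim\nu_{i,h}(\cdot\mid c,s_i)$, $s'_i\sim P^\star_{i,h}(\cdot\mid c,s_i,a_i)$;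 and $r_i\sim R^\star_{i,h}(c,\boldsymbol s,\boldsymbol a)$. **Algorithm DR-AC.** Inputs: the data, finite classes $\mathcal R_i$ of functions $r(c,\boldsymbol s,\boldsymbol a)\in[0,1]$ and $\mathcal P_i$ of maps $\mathcal C\times\mathcal S_i\times\mathcal A_i\to\Delta_{\mathcal S_i}$, and $\lambda,\eta,T$. Let $\widehat r_{i,h}\in\arg\min_{r\in\mathcal R_i}\sum_{\mathcal D_h}(r(c,\boldsymbol s,\boldsymbol a)-r_i)^2$, $\widehat P_{i,h}\in\arg\max_{P\in\mathcal P_i}\sum_{\mathcal D_h}\log P(s_i'\mid c,s_i,a_i)$ and $\pi^1=\nu$. For $t=1,\dots,T$ and all $i,h,c,s$ let $$\pi^{t+1}_{i,h}(c,s)=\arg\min_{p\in\Delta_{\mathcal A_i}}\Big\{-\langle\widehat Q^t_{i,h}(c,s,\cdot),p\rangle+\lambda\chi^2(p,\nu_{i,h}(c,s))+\tfrac1\eta D_{\nu_{i,h}(c,s)}(p,\pi^t_{i,h}(c,s))\Big\},$$ where $\widehat Q^t_{i,h}(c,s_i,a_i)$ is the joint Q-function of $\pi^t$ under the model $(\widehat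 P,\widehat r_i)$, averaged over $(s_j,a_j)$, $j\ne i$, drawn independently from the local state-action visitation measures of $\pi^t_j$ at step $h$ under $\widehat P_j$ given $c$. The output $\widehat\pi$ is the uniform mixture of $\pi^1,\dots,\pi^T$. **Assumptions.** (i) $r^\star_{i,h}\in\mathcal R_i$ and $P^\star_{i,h}\in\mathcal P_i$ for all $i,h$. (ii) For an integer $K\ge1$, every $r\in\mathcal R_i$ has interaction rank at most $K$: writing $z_j=(s_j,a_j)$, $r(c,\boldsymbol s,\boldsymbol a)=\sum_{k=0}^{K-1}\sum_{j_1<\dots<j_k,\ j_l\ne i}g_{j_1,\dots,j_k}(c,z_i,z_{j_1},\dots,z_{j_k})$ for some functions $g$. (iii) $d^{\mu_i}_h(s\mid c)/\sigma_{i,h}(s\mid c)\le C_{\mathsf S}<\infty$ for all $i,h,c,s$ and all local policies $\mu_i$. **Theorem.** There are a universal constant $\kappa>0$ and constants $\kappa'_K>0$ depending only on $K$ with the following property. In the setting above let $\delta\in(0,1]$, $|\mathcal R|=\max_i|\mathcal R_i|$, $|\mathcal P|=\max_i|\mathcal P_i|$, $\epsilon_{\mathsf{RP}}=\log(NH|\mathcal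 R||\mathcal P|/\delta)/M$, and $$\lambda=C_{\mathsf S}^{\frac{K}{3K+2}}H^{\frac{3K}{3K+2}}(2N^2)^{\frac{K-1}{3K+2}}\epsilon_{\mathsf{RP}}^{\frac1{3K+2}},\qquad \eta=\frac{\lambda}{H^2},\qquad T=\Big\lceil\frac{H^2}{\lambda^2}\Big\rceil .$$ (If $\epsilon_{\mathsf{RP}}=0$, which forces $\delta=1$, nothing is claimed.) Then with probability at least $1-\delta$ over the data every output $\widehat\pi$ of DR-AC (for any choice among the minimizers and maximizers) satisfies $$\max_i\mathsf{Gap}_i(\widehat\pi)\le\kappa\,\max_{i\in[N]}\inf_{C\ge1}\Big\{C\,C_{\mathsf S}^{\frac{K}{3K+2}}H^{\frac{6K+2}{3K+2}}(2N^2)^{\frac{K-1}{3K+2}}\epsilon_{\mathsf{RP}}^{\frac1{3K+2}}+\mathsf{subopt}_i(C,\widehat\pi)\Big\},$$ where $\mathsf{subopt}_i(C,\widehat\pi)=\sup_{\mu_i}\mathbb E_{c\sim\rho}[V^{\mu_i\times\widehat\pi_{-i}}_{i,1}(c,\boldsymbol s_1)]-\sup_{\mu_i\in\Pi_i(C)}\mathbb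 E_{c\sim\rho}[V^{\mu_i\times\widehat\pi_{-i}}_{i,1}(c,\boldsymbol s_1)]$ and $\Pi_i(C)=\{\mu_i:\mathbb E_{c\sim\rho,\,s\sim d^{\mu_i}_h(\cdot\mid c)}[\chi^2(\mu_{i,h}(c,s),\nu_{i,h}(c,s))]\le C\ \ \forall h\in[H]\}$. Moreover, on the same event, if $\mu_{i,h}(a\mid c,s)/\nu_{i,h}(a\mid c,s)\le C_{\mathsf{sin}}<\infty$ for all $i,h,c,s,a$ and all local policies $\mu_i$, and if, for some $\epsilon>0$, $$M\ \ge\ \kappa'_K\,\frac{C_{\mathsf{sin}}^{3K+2}C_{\mathsf S}^{K}H^{6K+2}(2N^2)^{K-1}\log(NH|\mathcal R||\mathcal P|/\delta)}{\epsilon^{3K+2}},$$ then $\widehat\pi$ is an $\epsilon$-approximate CCE; for fixed $K$ this sample size is polynomial in $N$. -/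

import Mathlib

open MeasureTheory ProbabilityTheory
open scoped ENNReal

/-! ### Discrete probability -/

theorem tsum_pi_prod {ι : Type*} [Fintype ι] {α : ι → Type*} (g : ∀ i, α i → ℝ≥0∞) :
    ∑' f : ∀ i, α i, ∏ i, g i (f i) = ∏ i, ∑' a, g i a := by
  have key : ∀ (κ : Type _) [Fintype κ] (β : κ → Type _) (u : ∀ i, β i → ℝ≥0∞),
      ∑' f : ∀ i, β i, ∏ i, u i (f i) = ∏ i, ∑' a, u i a := by
    intro κ _
    refine Fintype.induction_empty_option
      (P := fun κ _ => ∀ (β : κ → Type _) (u : ∀ i, β i → ℝ≥0∞),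
        ∑' f : ∀ i, β i, ∏ i, u i (f i) = ∏ i, ∑' a, u i a) ?_ ?_ ?_ κ
    · intro κ₁ κ₂ _ e ih β u
      let _ : Fintype κ₁ := Fintype.ofEquiv κ₂ e.symm
      have h := ih (fun i => β (e i)) (fun i => u (e i))
      rw [← (Equiv.piCongrLeft β e).tsum_eq, ← Equiv.prod_comp e (fun i => ∑' a, u i a)]
      rw [← h]
      refine tsum_congr fun f => ?_
      rw [← Equiv.prod_comp e]
      refine Finset.prod_congr rfl fun i _ => ?_
      rw [Equiv.piCongrLeft_apply_apply]
    · intro β u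
      rw [tsum_eq_single (fun i => i.elim) fun f hf => (hf (funext fun i => i.elim)).elim]
      simp
    · intro κ _ ih β u
      rw [← (Equiv.piOptionEquivProd (β := β)).symm.tsum_eq, ENNReal.tsum_prod',
        Fintype.prod_option, ← ih, ← ENNReal.tsum_mul_right]
      refine tsum_congr fun a => ?_
      rw [← ENNReal.tsum_mul_left]
      refine tsum_congr fun f => ?_
      rw [Fintype.prod_option]
      rfl
  exact key ι α g

/-- The product of finitely many probability mass functions: independent coordinates. -/
noncomputable def PMF.indep {ι : Type*} [Fintype ι] {α : ι → Type*} (p : ∀ i, PMF (α i)) :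
    PMF (∀ i, α i) :=
  ⟨fun f => ∏ i, p i (f i), by
    have h : ∑' f : ∀ i, α i, ∏ i, p i (f i) = 1 := by
      rw [tsum_pi_prod (fun i a => p i a)]
      simp [PMF.tsum_coe]
    exact h ▸ ENNReal.summable.hasSum⟩

/-- Expectation of a (bounded) real function under a probability mass function. -/
noncomputable def PMF.expect {α : Type*} (p : PMF α) (f : α → ℝ) : ℝ :=
  ∑' x, (p x).toReal * f x

/-- `bregman ν p q = ∑ a, (p a - q a)² / ν a`, with values in `[0, ∞]`, where `0 / 0 = 0` and
`x / 0 = ∞` for `x > 0`.  It is the Bregman divergence of `p ↦ χ²(p, ν)`. -/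
noncomputable def bregman {α : Type*} (ν p q : PMF α) : ℝ≥0∞ :=
  ∑' a, ENNReal.ofReal (((p a).toReal - (q a).toReal) ^ 2) / ν a

/-- The `χ²`-divergence `χ²(p, ν) = ∑ a, (p a - ν a)² / ν a`; it is `∞` unless `p ≪ ν`. -/
noncomputable def chiSq {α : Type*} (p ν : PMF α) : ℝ≥0∞ := bregman ν p ν

/-! ### Interaction rank -/

/-- `f(x, y)` is a sum of sub-functions, each of which depends on `x` and on fewer than `K` of the
coordinates of `y`. -/
def HasInteractionRank {ι X : Type*} [Fintype ι] {Y : ι → Type*} (K : ℕ)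
    (f : X → (∀ j, Y j) → ℝ) : Prop :=
  ∃ g : (J : Finset ι) → X → (∀ j : J, Y j) → ℝ, ∀ x y,
    f x y = ∑ J : Finset ι with J.card < K, g J x (fun j => y j)

/-! ### Markov games with decoupled transitions

Steps are numbered `0, 1, …, H - 1`; components of step-indexed families at steps `≥ H` are never
used. -/

/-- A local policy: step, public context, local state to a distribution over local actions. -/
abbrev LocalPolicy (𝒞 Si Ai : Type*) := ℕ → 𝒞 → Si → PMF Ai

/-- A local transition model. -/
abbrev LocalKernel (𝒞 Si Ai : Type*) := ℕ → 𝒞 → Si → Ai → PMF Si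

/-- A reward function (at one step, of one agent) of the context, joint state and joint action. -/
abbrev RewardFn {N : ℕ} (𝒞 : Type*) (S A : Fin N → Type*) :=
  𝒞 → (∀ j, S j) → (∀ j, A j) → ℝ

/-- A general-sum contextual Markov game with decoupled local transitions. -/
structure DecoupledGame (N : ℕ) (𝒞 : Type*) (S A : Fin N → Type*) where
  /-- distribution of the public context -/
  ρ : PMF 𝒞
  /-- fixed initial local states -/
  init : ∀ i, S i
  /-- local transition kernels -/
  P : ∀ i, LocalKernel 𝒞 (S i) (A i)
  /-- reward distributions -/
  R : Fin N → ℕ → 𝒞 → (∀ j, S j) → (∀ j, A j) → ProbabilityMeasure ℝ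
  /-- rewards lie in `[0, 1]` -/
  R_mem : ∀ i h c s a, ∀ᵐ x ∂(R i h c s a : Measure ℝ), x ∈ Set.Icc (0 : ℝ) 1

section Game

variable {N : ℕ} {𝒞 : Type*} {S A : Fin N → Type*}

/-- The mean reward `r⋆`. -/
noncomputable def DecoupledGame.meanReward (G : DecoupledGame N 𝒞 S A) (i : Fin N) (h : ℕ) :
    RewardFn 𝒞 S A :=
  fun c s a => ∫ x, x ∂(G.R i h c s a : Measure ℝ)

/-- The law of the trajectory `(s_h, a_h), (s_{h+1}, a_{h+1}), …` over `n` steps that starts at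
step `h` in the joint state `s`, when the product policy `π` is executed under the decoupled
transition model `P` and the context `c`. -/
noncomputable def rollout (P : ∀ i, LocalKernel 𝒞 (S i) (A i))
    (π : ∀ i, LocalPolicy 𝒞 (S i) (A i)) (c : 𝒞) :
    ℕ → ℕ → (∀ j, S j) → PMF (List ((∀ j, S j) × (∀ j, A j)))
  | 0, _, _ => PMF.pure []
  | n + 1, h, s =>
    (PMF.indep fun i => π i h c (s i)).bind fun a =>
      (PMF.indep fun i => P i h c (s i) (a i)).bind fun s' =>
        (rollout P π c n (h + 1) s').map fun τ => (s, a) :: τ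

/-- The same law given that the joint action `a` is played first; `n` further steps follow. -/
noncomputable def rolloutFrom (P : ∀ i, LocalKernel 𝒞 (S i) (A i))
    (π : ∀ i, LocalPolicy 𝒞 (S i) (A i)) (c : 𝒞) (n h : ℕ) (s : ∀ j, S j) (a : ∀ j, A j) :
    PMF (List ((∀ j, S j) × (∀ j, A j))) :=
  (PMF.indep fun i => P i h c (s i) (a i)).bind fun s' =>
    (rollout P π c n (h + 1) s').map fun τ => (s, a) :: τ

/-- The cumulative reward of a trajectory that starts at step `h`. -/
def cumReward (r : ℕ → RewardFn 𝒞 S A) (c : 𝒞) :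
    ℕ → List ((∀ j, S j) × (∀ j, A j)) → ℝ
  | _, [] => 0
  | h, (s, a) :: τ => r h c s a + cumReward r c (h + 1) τ

/-- The value function at step `h < H`. -/
noncomputable def valueFn (H : ℕ) (P : ∀ i, LocalKernel 𝒞 (S i) (A i))
    (π : ∀ i, LocalPolicy 𝒞 (S i) (A i)) (r : ℕ → RewardFn 𝒞 S A) (h : ℕ) (c : 𝒞)
    (s : ∀ j, S j) : ℝ :=
  (rollout P π c (H - h) h s).expect (cumReward r c h)

/-- The joint Q-function at step `h < H`. -/
noncomputable def qFn (H : ℕ) (P : ∀ i, LocalKernel 𝒞 (S i) (A i))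
    (π : ∀ i, LocalPolicy 𝒞 (S i) (A i)) (r : ℕ → RewardFn 𝒞 S A) (h : ℕ) (c : 𝒞)
    (s : ∀ j, S j) (a : ∀ j, A j) : ℝ :=
  (rolloutFrom P π c (H - h - 1) h s a).expect (cumReward r c h)

/-- The local state visitation measure `d_h(· | c)` of a local policy, under the local transition
model `P`, from the initial local state `s₁`. -/
noncomputable def visit {𝒞 Si Ai : Type*} (P : LocalKernel 𝒞 Si Ai) (s₁ : Si)
    (π : LocalPolicy 𝒞 Si Ai) (c : 𝒞) : ℕ → PMF Si
  | 0 => PMF.pure s₁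
  | h + 1 => (visit P s₁ π c h).bind fun s => (π h c s).bind fun a => P h c s a

/-- The local state-action visitation measure. -/
noncomputable def visitAct {𝒞 Si Ai : Type*} (P : LocalKernel 𝒞 Si Ai) (s₁ : Si)
    (π : LocalPolicy 𝒞 Si Ai) (c : 𝒞) (h : ℕ) : PMF (Si × Ai) :=
  (visit P s₁ π c h).bind fun s => (π h c s).map fun a => (s, a)

/-- Expected return of agent `i` when the product policy `π` is played in the game. -/
noncomputable def DecoupledGame.payoff (G : DecoupledGame N 𝒞 S A) (H : ℕ) (i : Fin N)
    (π : ∀ j, LocalPolicy 𝒞 (S j) (A j)) : ℝ :=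
  G.ρ.expect fun c => valueFn H G.P π (G.meanReward i) 0 c G.init

/-- Expected return of agent `i` under the uniform mixture of the product policies
`π 0, …, π (T - 1)` (one of them is drawn at the start of the episode). -/
noncomputable def DecoupledGame.mixPayoff (G : DecoupledGame N 𝒞 S A) (H : ℕ) (i : Fin N) (T : ℕ)
    (π : ℕ → ∀ j, LocalPolicy 𝒞 (S j) (A j)) : ℝ :=
  (∑ t ∈ Finset.range T, G.payoff H i (π t)) / T

/-- Expected return of agent `i` when it deviates from that mixture to the local policy `μ`. -/
noncomputable def DecoupledGame.devPayoff (G : DecoupledGame N 𝒞 S A) (H : ℕ) (i : Fin N) (T : ℕ)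
    (π : ℕ → ∀ j, LocalPolicy 𝒞 (S j) (A j)) (μ : LocalPolicy 𝒞 (S i) (A i)) : ℝ :=
  G.mixPayoff H i T fun t => Function.update (π t) i μ

/-- The gap of agent `i` at the uniform mixture of `π 0, …, π (T - 1)`. -/
noncomputable def DecoupledGame.gap (G : DecoupledGame N 𝒞 S A) (H : ℕ) (i : Fin N) (T : ℕ)
    (π : ℕ → ∀ j, LocalPolicy 𝒞 (S j) (A j)) : ℝ :=
  (⨆ μ : LocalPolicy 𝒞 (S i) (A i), G.devPayoff H i T π μ) - G.mixPayoff H i T π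

/-- The uniform mixture of `π 0, …, π (T - 1)` is an `ε`-approximate coarse correlated
equilibrium. -/
def DecoupledGame.IsApproxCCE (G : DecoupledGame N 𝒞 S A) (H T : ℕ)
    (π : ℕ → ∀ j, LocalPolicy 𝒞 (S j) (A j)) (ε : ℝ) : Prop :=
  ∀ i, G.gap H i T π ≤ ε

/-- The covered policy class `Π_i(C)` relative to the behavior policy `ν` of agent `i`. -/
def DecoupledGame.covered (G : DecoupledGame N 𝒞 S A) (H : ℕ) (i : Fin N)
    (ν : LocalPolicy 𝒞 (S i) (A i)) (C : ℝ) : Set (LocalPolicy 𝒞 (S i) (A i)) :=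
  {μ | ∀ h < H, ∑' c, G.ρ c * ∑' s, visit (G.P i) (G.init i) μ c h s * chiSq (μ h c s) (ν h c s)
    ≤ ENNReal.ofReal C}

/-- The off-support bias `subopt_i(C, π̂)`. -/
noncomputable def DecoupledGame.subopt (G : DecoupledGame N 𝒞 S A) (H : ℕ) (i : Fin N)
    (ν : LocalPolicy 𝒞 (S i) (A i)) (C : ℝ) (T : ℕ)
    (π : ℕ → ∀ j, LocalPolicy 𝒞 (S j) (A j)) : ℝ :=
  (⨆ μ : LocalPolicy 𝒞 (S i) (A i), G.devPayoff H i T π μ) -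
    ⨆ μ : G.covered H i ν C, G.devPayoff H i T π μ

/-- The reward function `r` of agent `i` has interaction rank at most `K`, with
`x = (c, s_i, a_i)` and `y_j = (s_j, a_j)` for `j ≠ i`. -/
def RewardHasIR (K : ℕ) (i : Fin N) (r : RewardFn 𝒞 S A) : Prop :=
  HasInteractionRank (ι := {j // j ≠ i}) (X := 𝒞 × S i × A i) (Y := fun j => S j × A j) K
    fun x y => r x.1 ((Equiv.piSplitAt i S).symm (x.2.1, fun j => (y j).1))
      ((Equiv.piSplitAt i A).symm (x.2.2, fun j => (y j).2))

end Game

/-! ### The offline dataset -/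

/-- The part `(c, s, a, s')` of a sample. -/
structure Obs {N : ℕ} (𝒞 : Type*) (S A : Fin N → Type*) where
  ctx : 𝒞
  state : ∀ i, S i
  act : ∀ i, A i
  next : ∀ i, S i

/-- Contexts, states and actions are discrete: every set is measurable. -/
instance {N : ℕ} (𝒞 : Type*) (S A : Fin N → Type*) : MeasurableSpace (Obs 𝒞 S A) := ⊤

/-- A sample: `(c, s, a, s')` and the rewards of all agents. -/
abbrev Sample {N : ℕ} (𝒞 : Type*) (S A : Fin N → Type*) := Obs 𝒞 S A × (Fin N → ℝ)

section Data

variable {N : ℕ} {𝒞 : Type*} {S A : Fin N → Type*}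

/-- The law of `(c, s, a, s')` at step `h`: `c ∼ ρ`, `s_i ∼ σ_{i,h}(·|c)`, `a_i ∼ ν_{i,h}(·|c,s_i)`,
`s'_i ∼ P⋆_{i,h}(·|c,s_i,a_i)`. -/
noncomputable def DecoupledGame.obsLaw (G : DecoupledGame N 𝒞 S A) (σ : ∀ i, ℕ → 𝒞 → PMF (S i))
    (ν : ∀ i, LocalPolicy 𝒞 (S i) (A i)) (h : ℕ) : PMF (Obs 𝒞 S A) :=
  G.ρ.bind fun c =>
    (PMF.indep fun i => σ i h c).bind fun s =>
      (PMF.indep fun i => ν i h c (s i)).bind fun a =>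
        (PMF.indep fun i => G.P i h c (s i) (a i)).map fun s' => ⟨c, s, a, s'⟩

/-- The conditional law of the reward of agent `i` given `(c, s, a, s')`. -/
noncomputable def DecoupledGame.rewardKernel (G : DecoupledGame N 𝒞 S A) (i : Fin N) (h : ℕ) :
    Kernel (Obs 𝒞 S A) ℝ :=
  ⟨fun z => (G.R i h z.ctx z.state z.act : Measure ℝ), measurable_from_top⟩

instance (G : DecoupledGame N 𝒞 S A) (i : Fin N) (h : ℕ) : IsMarkovKernel (G.rewardKernel i h) :=
  ⟨fun z => (G.R i h z.ctx z.state z.act).2⟩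

/-- `D h` consists, for each step `h < H`, of `M` independent samples with `(c, s, a, s')`
distributed as `obsLaw` and `r_i ∼ R⋆_{i,h}(c, s, a)`.  Nothing is required of the dependence
between different steps, or between the rewards of different agents in one sample. -/
structure DecoupledGame.IsDataset (G : DecoupledGame N 𝒞 S A) (H M : ℕ)
    (σ : ∀ i, ℕ → 𝒞 → PMF (S i)) (ν : ∀ i, LocalPolicy 𝒞 (S i) (A i))
    {Ω : Type*} [MeasurableSpace Ω] (μ : Measure Ω) (D : ℕ → Fin M → Ω → Sample 𝒞 S A) :
    Prop where
  measurable : ∀ h < H, ∀ m, Measurable (D h m)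
  indep : ∀ h < H, iIndepFun (D h) μ
  law : ∀ h < H, ∀ m i, μ.map (fun ω => ((D h m ω).1, (D h m ω).2 i)) =
    (G.obsLaw σ ν h).toMeasure ⊗ₘ G.rewardKernel i h

/-! ### The algorithm -/

/-- Squared loss of the reward function `r` for agent `i` on a dataset. -/
noncomputable def sqLoss {M : ℕ} (data : Fin M → Sample 𝒞 S A) (i : Fin N)
    (r : RewardFn 𝒞 S A) : ℝ :=
  ∑ m, (r (data m).1.ctx (data m).1.state (data m).1.act - (data m).2 i) ^ 2

/-- Log-likelihood, with `log 0 = -∞`, of the transition model `P` for agent `i` on a dataset. -/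
noncomputable def logLik {M : ℕ} (data : Fin M → Sample 𝒞 S A) (i : Fin N)
    (P : 𝒞 → S i → A i → PMF (S i)) : EReal :=
  ∑ m, ENNReal.log (P (data m).1.ctx ((data m).1.state i) ((data m).1.act i) ((data m).1.next i))

/-- The single-agent Q-function of agent `i`: the joint Q-function of `π` under the model `(P, r)`,
averaged over `(s_j, a_j) ∼ d_h^{π_j}(· | c)` for `j ≠ i`, visitations being taken under `P`. -/
noncomputable def singleQ (H : ℕ) (s₁ : ∀ i, S i) (P : ∀ i, LocalKernel 𝒞 (S i) (A i))
    (π : ∀ i, LocalPolicy 𝒞 (S i) (A i)) (i : Fin N) (r : ℕ → RewardFn 𝒞 S A) (h : ℕ)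
    (c : 𝒞) (si : S i) (ai : A i) : ℝ :=
  (PMF.indep fun j : {j // j ≠ i} => visitAct (P j) (s₁ j) (π j) c h).expect fun y =>
    qFn H P π r h c ((Equiv.piSplitAt i S).symm (si, fun j => (y j).1))
      ((Equiv.piSplitAt i A).symm (ai, fun j => (y j).2))

/-- The objective `-⟨q, p⟩ + λ χ²(p, ν) + η⁻¹ D(p, p₀)` of the actor update. -/
noncomputable def actorObjective {α : Type*} (lam eta : ℝ) (q : α → ℝ) (ν p₀ p : PMF α) : EReal :=
  ((-(p.expect q) : ℝ) : EReal) +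
    ((ENNReal.ofReal lam * chiSq p ν + ENNReal.ofReal (1 / eta) * bregman ν p p₀ : ℝ≥0∞) : EReal)

/-- `π` is a sequence of iterates of the decentralized regularized actor-critic algorithm with
parameters `lam`, `eta` and `T`, run on the dataset `data` with the model classes `Rc` and `Pc`.
The iteration `t = 1, 2, …` of the algorithm is numbered `t - 1` here, and the algorithm returns
the uniform mixture of `π 0, …, π (T - 1)`. -/
def DecoupledGame.IsDRAC (G : DecoupledGame N 𝒞 S A) (H : ℕ) {M : ℕ}
    (ν : ∀ i, LocalPolicy 𝒞 (S i) (A i)) (Rc : Fin N → Finset (RewardFn 𝒞 S A))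
    (Pc : ∀ i, Finset (𝒞 → S i → A i → PMF (S i))) (data : ℕ → Fin M → Sample 𝒞 S A)
    (lam eta : ℝ) (T : ℕ) (π : ℕ → ∀ i, LocalPolicy 𝒞 (S i) (A i)) : Prop :=
  ∃ (rhat : Fin N → ℕ → RewardFn 𝒞 S A) (Phat : ∀ i, LocalKernel 𝒞 (S i) (A i)),
    (∀ i, ∀ h < H, rhat i h ∈ Rc i ∧ ∀ r ∈ Rc i, sqLoss (data h) i (rhat i h) ≤ sqLoss (data h) i r)
    ∧ (∀ i, ∀ h < H, Phat i h ∈ Pc i ∧ ∀ P ∈ Pc i, logLik (data h) i P ≤ logLik (data h) i (Phat i h))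
    ∧ π 0 = ν
    ∧ ∀ t < T, ∀ i, ∀ h < H, ∀ c s, ∀ p : PMF (A i),
        actorObjective lam eta (singleQ H G.init Phat (π t) i (rhat i) h c s) (ν i h c s)
            (π t i h c s) (π (t + 1) i h c s)
          ≤ actorObjective lam eta (singleQ H G.init Phat (π t) i (rhat i) h c s) (ν i h c s)
            (π t i h c s) p

end Data

/-! Given the context, the agents move independently. Averaging out the other agents therefore turns
the problem of agent `i` into a single-agent one: `singleQ` satisfies a Bellman equation whose
reward is `rewardBar`. A performance-difference identity along the true chain
(`valueFn_update_sub_le`) bounds the gain from a deviation `μ` at one iterate by an advantage in the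
estimated game plus reward and transition errors, the latter averaged under the visitations of `μ`
and of the iterate.

The advantages are averaged over the visitation of `μ` under the true dynamics, which does not
change with the iteration, so their sum over iterations is controlled state by state by the
mirror-descent regret `PMF.actor_regret`. With the prescribed step size and number of iterations it
is of order `C λ` per step and iteration for a policy in `Π_i(C)`.

The regularizer also controls the model errors. It keeps every iterate below `(1 + H / (2λ)) ν`
(`PMF.actor_density_le`), so for `λ ≤ 1/2` the iterates' visitations have density at most `B = C_S H
/ λ` with respect to the data. A change of measure over all other agents would naively cost `B ^ (N
- 1)`. For functions of interaction rank at most `K`, expanding the product density into centered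
factors leaves only the terms with fewer than `K` factors, and the cost is `N ^ (2(K - 1)) B ^ (K -
1)` (`PMF.expect_indep_sq_le_of_rankLT`). Agent `i` itself costs one more factor, by a density bound
or by the `χ²` coverage of `Π_i(C)` (`ShiftBound.of_coverage`).

On the statistical side, exponential moments of the excess squared loss and of the root likelihood
ratio, with a union bound over the finite classes, give squared errors of order `ε` under the data
law (`DecoupledGame.IsDataset.exists_event`). The choice of `λ` makes both `N ^ (2(K - 1)) B ^ K ε`
and, up to constants, the squared transition errors at most `λ²`. Summing over `H` steps, a covered
deviation gains at most `29 C H λ` (`DecoupledGame.devPayoff_sub_le`). For `λ ≥ 1/2` this is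
trivial, because returns lie in `[0, H]`. -/

namespace PMF

/-! ### Expectations of bounded functions under probability mass functions. -/

variable {α β : Type*}

theorem toReal_le_one (p : PMF α) (a : α) : (p a).toReal ≤ 1 :=
  ENNReal.toReal_le_of_le_ofReal zero_le_one (by simpa using p.coe_le_one a)

theorem summable_toReal (p : PMF α) : Summable fun a => (p a).toReal :=
  ENNReal.summable_toReal p.tsum_coe_ne_top

theorem tsum_toReal (p : PMF α) : ∑' a, (p a).toReal = 1 := by
  rw [← ENNReal.tsum_toReal_eq p.apply_ne_top, p.tsum_coe]; rfl

theorem summable_mul_of_bdd (p : PMF α) {f : α → ℝ} {B : ℝ} (hf : ∀ a, p a ≠ 0 → |f a| ≤ B) :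
    Summable fun a => (p a).toReal * f a := by
  refine Summable.of_norm_bounded (p.summable_toReal.mul_right B) fun a => ?_
  rw [norm_mul, Real.norm_eq_abs, Real.norm_eq_abs, abs_of_nonneg ENNReal.toReal_nonneg]
  by_cases h : p a = 0
  · simp [h]
  · exact mul_le_mul_of_nonneg_left (hf a h) ENNReal.toReal_nonneg

theorem expect_congr (p : PMF α) {f g : α → ℝ} (h : ∀ a, p a ≠ 0 → f a = g a) :
    p.expect f = p.expect g := by
  refine tsum_congr fun a => ?_
  by_cases ha : p a = 0
  · simp [ha]
  · rw [h a ha]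

@[simp] theorem expect_const (p : PMF α) (c : ℝ) : (p.expect fun _ => c) = c := by
  rw [expect, tsum_mul_right, p.tsum_toReal, one_mul]

theorem expect_const_mul (p : PMF α) (c : ℝ) (f : α → ℝ) :
    (p.expect fun a => c * f a) = c * p.expect f := by
  rw [expect, expect, ← tsum_mul_left]
  exact tsum_congr fun a => by ring

theorem expect_neg (p : PMF α) (f : α → ℝ) : (p.expect fun a => -f a) = -p.expect f := by
  simpa using p.expect_const_mul (-1) f

theorem expect_mul_const (p : PMF α) (c : ℝ) (f : α → ℝ) :
    (p.expect fun a => f a * c) = p.expect f * c := by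
  simp only [mul_comm _ c, expect_const_mul]

theorem expect_add (p : PMF α) {f g : α → ℝ} {B C : ℝ} (hf : ∀ a, p a ≠ 0 → |f a| ≤ B)
    (hg : ∀ a, p a ≠ 0 → |g a| ≤ C) : (p.expect fun a => f a + g a) = p.expect f + p.expect g := by
  rw [expect, expect, expect, ← (p.summable_mul_of_bdd hf).tsum_add (p.summable_mul_of_bdd hg)]
  exact tsum_congr fun a => by ring

theorem expect_sub (p : PMF α) {f g : α → ℝ} {B C : ℝ} (hf : ∀ a, p a ≠ 0 → |f a| ≤ B)
    (hg : ∀ a, p a ≠ 0 → |g a| ≤ C) : (p.expect fun a => f a - g a) = p.expect f - p.expect g := by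
  rw [expect, expect, expect, ← (p.summable_mul_of_bdd hf).tsum_sub (p.summable_mul_of_bdd hg)]
  exact tsum_congr fun a => by ring

theorem expect_sum (p : PMF α) {ι : Type*} (s : Finset ι) {f : ι → α → ℝ} {B : ι → ℝ}
    (hf : ∀ i ∈ s, ∀ a, p a ≠ 0 → |f i a| ≤ B i) :
    (p.expect fun a => ∑ i ∈ s, f i a) = ∑ i ∈ s, p.expect (f i) := by
  simp only [expect]
  rw [← Summable.tsum_finsetSum fun i hi => p.summable_mul_of_bdd (hf i hi)]
  exact tsum_congr fun a => Finset.mul_sum _ _ _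

theorem expect_mono (p : PMF α) {f g : α → ℝ} {B C : ℝ} (hf : ∀ a, p a ≠ 0 → |f a| ≤ B)
    (hg : ∀ a, p a ≠ 0 → |g a| ≤ C) (h : ∀ a, p a ≠ 0 → f a ≤ g a) :
    p.expect f ≤ p.expect g := by
  refine Summable.tsum_le_tsum (fun a => ?_) (p.summable_mul_of_bdd hf) (p.summable_mul_of_bdd hg)
  by_cases ha : p a = 0
  · simp [ha]
  · exact mul_le_mul_of_nonneg_left (h a ha) ENNReal.toReal_nonneg

theorem expect_nonneg (p : PMF α) {f : α → ℝ} (h : ∀ a, p a ≠ 0 → 0 ≤ f a) : 0 ≤ p.expect f := by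
  refine tsum_nonneg fun a => ?_
  by_cases ha : p a = 0
  · simp [ha]
  · exact mul_nonneg ENNReal.toReal_nonneg (h a ha)

theorem abs_expect_le (p : PMF α) {f : α → ℝ} {B : ℝ} (hf : ∀ a, p a ≠ 0 → |f a| ≤ B) :
    |p.expect f| ≤ B := by
  have hB : ∀ a, p a ≠ 0 → |(fun _ : α => B) a| ≤ |B| := fun _ _ => le_rfl
  have hB' : ∀ a, p a ≠ 0 → |(fun _ : α => -B) a| ≤ |B| := fun _ _ => by simp
  rw [abs_le]
  constructor
  · simpa using p.expect_mono hB' hf fun a ha => (abs_le.1 (hf a ha)).1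
  · simpa using p.expect_mono hf hB fun a ha => (abs_le.1 (hf a ha)).2

theorem abs_expect_le_expect_abs (p : PMF α) {f : α → ℝ} {B : ℝ}
    (hf : ∀ a, p a ≠ 0 → |f a| ≤ B) : |p.expect f| ≤ p.expect fun a => |f a| := by
  have hf' : ∀ a, p a ≠ 0 → |(fun a => |f a|) a| ≤ B := by simpa using hf
  have hf'' : ∀ a, p a ≠ 0 → |(fun a => -|f a|) a| ≤ B := by simpa using hf
  rw [abs_le, ← expect_neg]
  exact ⟨p.expect_mono hf'' hf fun a _ => neg_abs_le _, p.expect_mono hf hf' fun a _ => le_abs_self _⟩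

theorem expect_mem_Icc (p : PMF α) {f : α → ℝ} {u v : ℝ}
    (hf : ∀ a, p a ≠ 0 → f a ∈ Set.Icc u v) : p.expect f ∈ Set.Icc u v := by
  have hb : ∀ a, p a ≠ 0 → |f a| ≤ max |u| |v| := fun a ha => abs_le_max_abs_abs (hf a ha).1 (hf a ha).2
  have hu : ∀ a, p a ≠ 0 → |(fun _ : α => u) a| ≤ |u| := fun _ _ => le_rfl
  have hv : ∀ a, p a ≠ 0 → |(fun _ : α => v) a| ≤ |v| := fun _ _ => le_rfl
  constructor
  · simpa using p.expect_mono hu hb fun a ha => (hf a ha).1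
  · simpa using p.expect_mono hb hv fun a ha => (hf a ha).2

theorem ofReal_expect (p : PMF α) {f : α → ℝ} {B : ℝ} (h0 : ∀ a, 0 ≤ f a)
    (hf : ∀ a, p a ≠ 0 → |f a| ≤ B) :
    ENNReal.ofReal (p.expect f) = ∑' a, p a * ENNReal.ofReal (f a) := by
  rw [expect, ENNReal.ofReal_tsum_of_nonneg (fun a => mul_nonneg ENNReal.toReal_nonneg (h0 a))
    (p.summable_mul_of_bdd hf)]
  refine tsum_congr fun a => ?_
  rw [ENNReal.ofReal_mul ENNReal.toReal_nonneg, ENNReal.ofReal_toReal (p.apply_ne_top a)]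

theorem tsum_bind_mul (p : PMF α) (q : α → PMF β) (F : β → ℝ≥0∞) :
    ∑' b, (p.bind q) b * F b = ∑' a, p a * ∑' b, q a b * F b := by
  simp only [bind_apply, ← ENNReal.tsum_mul_right, ← ENNReal.tsum_mul_left]
  rw [ENNReal.tsum_comm]
  simp only [mul_assoc]

theorem tsum_pure_mul (a : α) (F : α → ℝ≥0∞) : ∑' b, (pure a : PMF α) b * F b = F a := by
  rw [tsum_eq_single a fun b hb => by simp [pure_apply, hb]]
  simp

theorem tsum_map_mul (p : PMF α) (g : α → β) (F : β → ℝ≥0∞) :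
    ∑' b, (p.map g) b * F b = ∑' a, p a * F (g a) := by
  rw [map, tsum_bind_mul]
  simp only [Function.comp_apply, tsum_pure_mul]

@[simp] theorem expect_pure (a : α) (f : α → ℝ) : (pure a : PMF α).expect f = f a := by
  rw [expect, tsum_eq_single a fun b hb => by simp [pure_apply, hb]]
  simp

theorem bind_apply_ne_zero {p : PMF α} {q : α → PMF β} {a : α} {b : β} (ha : p a ≠ 0)
    (hb : q a b ≠ 0) : (p.bind q) b ≠ 0 := by
  have : b ∈ (p.bind q).support := (mem_support_bind_iff p q b).2 ⟨a, ha, hb⟩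
  exact this

/-- Tonelli in `ℝ≥0∞` settles the nonnegative case; the general case follows by setting `f` to zero
off the support and adding `|B|`. Boundedness is asked only on the support because cumulative
rewards are bounded only along trajectories of the right length. -/
theorem expect_bind (p : PMF α) (q : α → PMF β) {f : β → ℝ} {B : ℝ}
    (hf : ∀ b, (p.bind q) b ≠ 0 → |f b| ≤ B) :
    (p.bind q).expect f = p.expect fun a => (q a).expect f := by
  have nonneg : ∀ g : β → ℝ, (∀ b, 0 ≤ g b) → (∀ b, |g b| ≤ 2 * |B|) →
      (p.bind q).expect g = p.expect fun a => (q a).expect g := by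
    intro g g0 hg
    have h1 : ∀ a, |(q a).expect g| ≤ 2 * |B| := fun a => (q a).abs_expect_le fun b _ => hg b
    have h2 : ∀ a, 0 ≤ (q a).expect g := fun a => (q a).expect_nonneg fun b _ => g0 b
    rw [← ENNReal.ofReal_eq_ofReal_iff ((p.bind q).expect_nonneg fun b _ => g0 b)
      (p.expect_nonneg fun a _ => h2 a), ofReal_expect _ g0 fun b _ => hg b,
      ofReal_expect _ h2 fun a _ => h1 a, tsum_bind_mul]
    refine tsum_congr fun a => ?_
    rw [ofReal_expect _ g0 fun b _ => hg b]
  classical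
  let g : β → ℝ := fun b => if (p.bind q) b ≠ 0 then f b else 0
  have gB : ∀ b, |g b| ≤ |B| := fun b => by
    by_cases h : (p.bind q) b ≠ 0
    · simp only [g, if_pos h]; exact (hf b h).trans (le_abs_self B)
    · simp only [g, if_neg h, abs_zero]; exact abs_nonneg B
  have e1 : (p.bind q).expect f = (p.bind q).expect g :=
    expect_congr _ fun b hb => by simp only [g, if_pos hb]
  have e2 : (p.expect fun a => (q a).expect f) = p.expect fun a => (q a).expect g :=
    expect_congr _ fun a ha => expect_congr _ fun b hb => by
      simp only [g, if_pos (bind_apply_ne_zero ha hb)]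
  have hc : ∀ b : β, |(fun _ : β => |B|) b| ≤ |B| := fun _ => by simp
  have hc' : ∀ a : α, |(fun _ : α => |B|) a| ≤ |B| := fun _ => by simp
  have e3 := nonneg (fun b => g b + |B|) (fun b => by linarith [neg_le_of_abs_le (gB b)])
    (fun b => (abs_add_le _ _).trans (by rw [abs_abs]; linarith [gB b]))
  rw [expect_add _ (fun b _ => gB b) (fun b _ => hc b), expect_const] at e3
  have e4 : (p.expect fun a => (q a).expect fun b => g b + |B|)
      = (p.expect fun a => (q a).expect g) + |B| := by
    rw [← p.expect_const |B|, ← expect_add _ (fun a _ => (q a).abs_expect_le fun b _ => gB b)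
      (fun a _ => hc' a)]
    simp only [expect_const]
    refine expect_congr _ fun a _ => ?_
    rw [expect_add _ (fun b _ => gB b) (fun b _ => hc b), expect_const]
  rw [e1, e2]
  linarith

theorem expect_map (p : PMF α) (g : α → β) {f : β → ℝ} {B : ℝ}
    (hf : ∀ a, p a ≠ 0 → |f (g a)| ≤ B) : (p.map g).expect f = p.expect fun a => f (g a) := by
  have h : ∀ b, (p.bind (pure ∘ g)) b ≠ 0 → |f b| ≤ B := by
    intro b hb
    obtain ⟨a, ha, hab⟩ := (mem_support_bind_iff p (pure ∘ g) b).1 hb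
    have : b = g a := by simpa using hab
    exact this ▸ hf a ha
  rw [map, expect_bind p _ h]
  simp

/-- Cauchy–Schwarz for bounded functions. -/
theorem expect_mul_sq_le (p : PMF α) {f g : α → ℝ} {B C : ℝ} (hf : ∀ a, p a ≠ 0 → |f a| ≤ B)
    (hg : ∀ a, p a ≠ 0 → |g a| ≤ C) :
    (p.expect fun a => f a * g a) ^ 2 ≤ (p.expect fun a => f a ^ 2) * p.expect fun a => g a ^ 2 := by
  have h2 : ∀ a, p a ≠ 0 → |f a ^ 2| ≤ B ^ 2 := fun a ha => by
    rw [abs_pow]; exact pow_le_pow_left₀ (abs_nonneg _) (hf a ha) 2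
  have h3 : ∀ a, p a ≠ 0 → |g a ^ 2| ≤ C ^ 2 := fun a ha => by
    rw [abs_pow]; exact pow_le_pow_left₀ (abs_nonneg _) (hg a ha) 2
  have h4 : ∀ a, p a ≠ 0 → |f a * g a| ≤ B * C := fun a ha => by
    rw [abs_mul]
    exact mul_le_mul (hf a ha) (hg a ha) (abs_nonneg _) ((abs_nonneg _).trans (hf a ha))
  set X := p.expect fun a => f a ^ 2
  set Y := p.expect fun a => g a ^ 2
  set Z := p.expect fun a => f a * g a
  -- The mean of `(x f + g)²` is a nonnegative quadratic in `x`; its discriminant is at most zero.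
  have key : ∀ x : ℝ, 0 ≤ X * (x * x) + 2 * Z * x + Y := by
    intro x
    have : 0 ≤ p.expect fun a => ((x * x) * f a ^ 2 + (2 * x) * (f a * g a)) + g a ^ 2 :=
      p.expect_nonneg fun a _ => by nlinarith [sq_nonneg (x * f a + g a)]
    have h5 : ∀ a, p a ≠ 0 → |(x * x) * f a ^ 2| ≤ |x * x| * B ^ 2 := fun a ha => by
      rw [abs_mul]; exact mul_le_mul_of_nonneg_left (h2 a ha) (abs_nonneg _)
    have h6 : ∀ a, p a ≠ 0 → |(2 * x) * (f a * g a)| ≤ |2 * x| * (B * C) := fun a ha => by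
      rw [abs_mul]; exact mul_le_mul_of_nonneg_left (h4 a ha) (abs_nonneg _)
    rw [p.expect_add (fun a ha => (abs_add_le _ _).trans (add_le_add (h5 a ha) (h6 a ha))) h3,
      p.expect_add h5 h6, expect_const_mul, expect_const_mul] at this
    change 0 ≤ (x * x) * X + (2 * x) * Z + Y at this
    linarith
  have := discrim_le_zero key
  rw [discrim] at this
  nlinarith

/-- Change of measure under a pointwise density bound. -/
theorem expect_le_of_le_mul (p q : PMF α) {B C : ℝ} (hB : 0 ≤ B)
    (h : ∀ a, p a ≤ ENNReal.ofReal B * q a) {f : α → ℝ} (f0 : ∀ a, 0 ≤ f a)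
    (hf : ∀ a, |f a| ≤ C) : p.expect f ≤ B * q.expect f := by
  rw [expect, expect, ← tsum_mul_left]
  refine Summable.tsum_le_tsum (fun a => ?_) (p.summable_mul_of_bdd fun a _ => hf a)
    ((q.summable_mul_of_bdd fun a _ => hf a).mul_left B)
  rw [← mul_assoc]
  refine mul_le_mul_of_nonneg_right ?_ (f0 a)
  have := ENNReal.toReal_mono (ENNReal.mul_ne_top ENNReal.ofReal_ne_top (q.apply_ne_top a)) (h a)
  rwa [ENNReal.toReal_mul, ENNReal.toReal_ofReal hB] at this

/-- The `ℓ¹`-distance of two probability mass functions. -/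
noncomputable def l1 (p q : PMF α) : ℝ := ∑' a, |(p a).toReal - (q a).toReal|

theorem summable_l1 (p q : PMF α) : Summable fun a => |(p a).toReal - (q a).toReal| :=
  (p.summable_toReal.sub q.summable_toReal).abs

theorem l1_nonneg (p q : PMF α) : 0 ≤ l1 p q := tsum_nonneg fun _ => abs_nonneg _

theorem l1_le_two (p q : PMF α) : l1 p q ≤ 2 := by
  calc l1 p q ≤ ∑' a, ((p a).toReal + (q a).toReal) :=
        (summable_l1 p q).tsum_le_tsum (fun a => (abs_sub _ _).trans (by
          rw [abs_of_nonneg ENNReal.toReal_nonneg, abs_of_nonneg ENNReal.toReal_nonneg]))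
          (p.summable_toReal.add q.summable_toReal)
    _ = 2 := by
      rw [p.summable_toReal.tsum_add q.summable_toReal, tsum_toReal, tsum_toReal]; norm_num

theorem abs_l1_le_two (p q : PMF α) : |l1 p q| ≤ 2 := by
  rw [abs_of_nonneg (l1_nonneg p q)]; exact l1_le_two p q

theorem abs_expect_sub_expect_le (p q : PMF α) {f : α → ℝ} {B : ℝ} (hf : ∀ a, |f a| ≤ B) :
    |p.expect f - q.expect f| ≤ B * l1 p q := by
  rw [expect, expect, ← (p.summable_mul_of_bdd fun a _ => hf a).tsum_sub
    (q.summable_mul_of_bdd fun a _ => hf a), l1, ← tsum_mul_left]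
  have h : ∀ a, ‖(p a).toReal * f a - (q a).toReal * f a‖ ≤ B * |(p a).toReal - (q a).toReal| := by
    intro a
    rw [← sub_mul, norm_mul, mul_comm]
    exact mul_le_mul_of_nonneg_right (hf a) (norm_nonneg _)
  exact tsum_of_norm_bounded ((summable_l1 p q).mul_left B).hasSum h

/-! ### Products -/

section Glue

variable {ι : Type*} {X Y : ι → Type*} [DecidableEq ι]

/-- Insert the coordinate `a` at `i` into a vector `y` of the other coordinates. -/
def glue (i : ι) (a : X i) (y : ∀ j : {j // j ≠ i}, X j) : ∀ j, X j :=
  (Equiv.piSplitAt i X).symm (a, y)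

@[simp] theorem glue_self (i : ι) (a : X i) (y : ∀ j : {j // j ≠ i}, X j) : glue i a y i = a := by
  simp [glue, Equiv.piSplitAt]

@[simp] theorem glue_ne (i : ι) (a : X i) (y : ∀ j : {j // j ≠ i}, X j) (j : {j // j ≠ i}) :
    glue i a y j = y j := by
  simp [glue, Equiv.piSplitAt, j.2]

theorem glue_of_ne (i : ι) (a : X i) (y : ∀ j : {j // j ≠ i}, X j) {j : ι} (h : j ≠ i) :
    glue i a y j = y ⟨j, h⟩ := glue_ne i a y ⟨j, h⟩

theorem glue_restrict (i : ι) (x : ∀ j, X j) : glue i (x i) (fun j => x j) = x := by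
  funext j
  by_cases h : j = i
  · subst h; simp
  · rw [glue_of_ne i _ _ h]

theorem update_glue (i : ι) (a b : X i) (y : ∀ j : {j // j ≠ i}, X j) :
    Function.update (glue i a y) i b = glue i b y := by
  funext j
  by_cases h : j = i
  · subst h; simp
  · rw [Function.update_of_ne h, glue_of_ne i _ _ h, glue_of_ne i _ _ h]

theorem comp_glue (i : ι) (g : ∀ j, X j → Y j) (a : X i) (y : ∀ j : {j // j ≠ i}, X j) :
    (fun j => g j (glue i a y j)) = glue i (g i a) fun j => g j (y j) := by
  funext j
  by_cases h : j = i
  · subst h; simp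
  · rw [glue_of_ne i _ _ h, glue_of_ne i _ _ h]

end Glue

section Indep

variable {ι : Type*} [Fintype ι] {X Y : ι → Type*}

theorem indep_apply (p : ∀ i, PMF (X i)) (x : ∀ i, X i) : indep p x = ∏ i, p i (x i) := rfl

theorem indep_bind_indep (p : ∀ i, PMF (X i)) (q : ∀ i, X i → PMF (Y i)) :
    ((indep p).bind fun x => indep fun i => q i (x i)) = indep fun i => (p i).bind (q i) := by
  ext y
  simp only [bind_apply, indep_apply, ← Finset.prod_mul_distrib]
  exact tsum_pi_prod fun i a => p i a * q i a (y i)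

theorem indep_pure (x : ∀ i, X i) : (indep fun i => pure (x i)) = pure x := by
  classical
  ext y
  simp only [indep_apply, pure_apply]
  by_cases h : y = x
  · simp [h]
  · obtain ⟨i, hi⟩ := Function.ne_iff.1 h
    rw [if_neg h, Finset.prod_eq_zero (Finset.mem_univ i) (if_neg hi)]

theorem indep_map (p : ∀ i, PMF (X i)) (g : ∀ i, X i → Y i) :
    ((indep p).map fun x i => g i (x i)) = indep fun i => (p i).map (g i) := by
  have := indep_bind_indep p fun i a => pure (g i a)
  simp only [indep_pure] at this
  exact this

theorem expect_indep_prod (p : ∀ i, PMF (X i)) {f : ∀ i, X i → ℝ} {B : ℝ}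
    (f0 : ∀ i a, 0 ≤ f i a) (hf : ∀ i a, |f i a| ≤ B) :
    ((indep p).expect fun x => ∏ i, f i (x i)) = ∏ i, (p i).expect (f i) := by
  have h1 : ∀ x : ∀ i, X i, |∏ i, f i (x i)| ≤ B ^ Fintype.card ι := fun x => by
    rw [Finset.abs_prod]
    exact (Finset.prod_le_prod (fun i _ => abs_nonneg _) fun i _ => hf i (x i)).trans (by simp)
  have h2 : ∀ i, 0 ≤ (p i).expect (f i) := fun i => (p i).expect_nonneg fun a _ => f0 i a
  have h3 : ∀ x : ∀ i, X i, 0 ≤ ∏ i, f i (x i) := fun x => Finset.prod_nonneg fun i _ => f0 i _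
  rw [← ENNReal.ofReal_eq_ofReal_iff ((indep p).expect_nonneg fun x _ => h3 x)
    (Finset.prod_nonneg fun i _ => h2 i), ofReal_expect _ h3 fun x _ => h1 x,
    ENNReal.ofReal_prod_of_nonneg fun i _ => h2 i]
  have : ∀ i, ENNReal.ofReal ((p i).expect (f i)) = ∑' a, p i a * ENNReal.ofReal (f i a) :=
    fun i => ofReal_expect _ (f0 i) fun a _ => hf i a
  simp only [this, ← tsum_pi_prod]
  refine tsum_congr fun x => ?_
  rw [ENNReal.ofReal_prod_of_nonneg fun i _ => f0 i _, indep_apply, Finset.prod_mul_distrib]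

variable [DecidableEq ι]

/-- This isolates the coordinate of one agent from those of the others; all averages over `j ≠ i`
rest on it. -/
theorem indep_eq_bind_glue (p : ∀ i, PMF (X i)) (i : ι) :
    indep p = (p i).bind fun a => (indep fun j : {j // j ≠ i} => p j).map (glue i a) := by
  ext x
  rw [bind_apply, tsum_eq_single (x i)]
  · rw [map_apply, tsum_eq_single fun j : {j // j ≠ i} => x j]
    · rw [if_pos (glue_restrict i x).symm, indep_apply, indep_apply,
        ← Finset.mul_prod_erase _ _ (Finset.mem_univ i)]
      congr 1
      exact Finset.prod_subtype _ (by simp) fun j => p j (x j)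
    · intro y hy
      rw [if_neg]
      rintro h
      refine hy (funext fun j => ?_)
      rw [h, glue_ne]
  · intro a ha
    rw [map_apply, ENNReal.tsum_eq_zero.2, mul_zero]
    intro y
    rw [if_neg]
    rintro h
    refine ha ?_
    rw [h, glue_self]

theorem expect_indep_eq (p : ∀ i, PMF (X i)) (i : ι) {f : (∀ i, X i) → ℝ} {B : ℝ}
    (hf : ∀ x, |f x| ≤ B) :
    (indep p).expect f =
      (p i).expect fun a => (indep fun j : {j // j ≠ i} => p j).expect fun y => f (glue i a y) := by
  rw [indep_eq_bind_glue p i, expect_bind _ _ fun x _ => hf x]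
  exact expect_congr _ fun a _ => expect_map _ _ fun y _ => hf _

theorem indep_map_eval (p : ∀ i, PMF (X i)) (i : ι) : ((indep p).map fun x => x i) = p i := by
  rw [indep_eq_bind_glue p i, map_bind]
  have : ∀ a : X i, (map (fun x : ∀ i, X i => x i) (map (glue i a)
      (indep fun j : {j // j ≠ i} => p j))) = pure a := by
    intro a
    rw [map_comp]
    have : ((fun x : ∀ i, X i => x i) ∘ glue i a) = Function.const _ a := by
      funext y; simp
    rw [this, map_const]
  simp only [this, bind_pure]

/-- Averaging over one coordinate first. -/
theorem expect_indep_resample (p : ∀ i, PMF (X i)) (i : ι) {f : (∀ i, X i) → ℝ} {B : ℝ}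
    (hf : ∀ x, |f x| ≤ B) :
    (indep p).expect f =
      (indep p).expect fun x => (p i).expect fun a => f (Function.update x i a) := by
  have hg : ∀ x : ∀ i, X i, |(p i).expect fun a => f (Function.update x i a)| ≤ B :=
    fun x => (p i).abs_expect_le fun a _ => hf _
  have hh : ∀ y : ∀ j : {j // j ≠ i}, X j, |(p i).expect fun a => f (glue i a y)| ≤ B :=
    fun y => (p i).abs_expect_le fun a _ => hf _
  rw [expect_indep_eq p i hg]
  simp only [update_glue, expect_const]
  conv_lhs => rw [expect_indep_eq p i hf]
  have e1 := expect_bind (p i) (fun a => (indep fun j : {j // j ≠ i} => p j).map (glue i a))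
    (f := f) (B := B) fun x _ => hf x
  have e2 := expect_bind (indep fun j : {j // j ≠ i} => p j)
    (fun y => (p i).map fun a => glue i a y) (f := f) (B := B) fun x _ => hf x
  have e3 : ((p i).bind fun a => (indep fun j : {j // j ≠ i} => p j).map (glue i a)) =
      (indep fun j : {j // j ≠ i} => p j).bind fun y => (p i).map fun a => glue i a y :=
    bind_comm _ _ _
  rw [e3, e2] at e1
  calc _ = (p i).expect fun a => (map (glue i a) (indep fun j : {j // j ≠ i} => p j)).expect f :=
        expect_congr _ fun a _ => (expect_map _ _ fun y _ => hf _).symm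
    _ = _ := e1.symm
    _ = _ := expect_congr _ fun y _ => expect_map _ _ fun a _ => hf _

/-- Replacing the coordinates of a product one at a time. -/
theorem abs_expect_indep_sub_le (p q : ∀ i, PMF (X i)) (δ : ι → ℝ)
    (h : ∀ i, ∀ f : X i → ℝ, (∀ a, |f a| ≤ 1) → |(p i).expect f - (q i).expect f| ≤ δ i)
    {F : (∀ i, X i) → ℝ} (hF : ∀ x, |F x| ≤ 1) :
    |(indep p).expect F - (indep q).expect F| ≤ ∑ i, δ i := by
  -- Hybrid argument: the coordinates in `s` have already been switched from `p` to `q`.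
  have key : ∀ s : Finset ι, |(indep p).expect F -
      (indep fun i => if i ∈ s then q i else p i).expect F| ≤ ∑ i ∈ s, δ i := by
    intro s
    induction s using Finset.induction_on with
    | empty => simp
    | insert k s hk ih =>
      rw [Finset.sum_insert hk]
      set r : ∀ i, PMF (X i) := fun i => if i ∈ s then q i else p i
      set r' : ∀ i, PMF (X i) := fun i => if i ∈ insert k s then q i else p i
      have e : (fun j : {j // j ≠ k} => r' j) = fun j : {j // j ≠ k} => r j := by
        funext j; simp [r, r', j.2]
      have h1 : |(indep r).expect F - (indep r').expect F| ≤ δ k := by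
        rw [expect_indep_eq r k hF, expect_indep_eq r' k hF, e]
        have e1 : r k = p k := by simp [r, hk]
        have e2 : r' k = q k := by simp [r']
        rw [e1, e2]
        exact h k _ fun a => abs_expect_le _ fun y _ => hF _
      have := abs_add_le ((indep p).expect F - (indep r).expect F)
        ((indep r).expect F - (indep r').expect F)
      rw [sub_add_sub_cancel] at this
      linarith
  simpa using key Finset.univ

end Indep

/-- The joint law of `(a, b)` with `a ∼ p` and `b ∼ q a`. -/
noncomputable def joint (p : PMF α) (q : α → PMF β) : PMF (α × β) :=
  p.bind fun a => (q a).map fun b => (a, b)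

theorem joint_apply (p : PMF α) (q : α → PMF β) (a : α) (b : β) :
    joint p q (a, b) = p a * q a b := by
  rw [joint, bind_apply, tsum_eq_single a]
  · rw [map_apply, tsum_eq_single b]
    · simp
    · intro b' hb; simp [Ne.symm hb]
  · intro a' ha
    simp [Ne.symm ha]

theorem expect_joint (p : PMF α) (q : α → PMF β) {f : α × β → ℝ} {B : ℝ}
    (hf : ∀ x, |f x| ≤ B) : (joint p q).expect f = p.expect fun a => (q a).expect fun b => f (a, b) := by
  rw [joint, expect_bind _ _ fun x _ => hf x]
  exact expect_congr _ fun a _ => expect_map _ _ fun b _ => hf _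

theorem joint_bind {γ : Type*} (p : PMF α) (q : α → PMF β) (r : α × β → PMF γ) :
    (joint p q).bind r = p.bind fun a => (q a).bind fun b => r (a, b) := by
  simp only [joint, bind_bind, bind_map]
  rfl

theorem tsum_joint_mul (p : PMF α) (q : α → PMF β) (F : α × β → ℝ≥0∞) :
    ∑' x, joint p q x * F x = ∑' a, p a * ∑' b, q a b * F (a, b) := by
  rw [joint, tsum_bind_mul]
  simp only [tsum_map_mul]

theorem indep_joint {ι : Type*} [Fintype ι] {X Y : ι → Type*} (p : ∀ i, PMF (X i))
    (q : ∀ i, X i → PMF (Y i)) :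
    ((indep p).bind fun x => (indep fun i => q i (x i)).map fun y i => (x i, y i)) =
      indep fun i => joint (p i) (q i) := by
  simp only [joint, ← indep_bind_indep, ← indep_map]

end PMF

theorem PMF.expect_comm {α β : Type*} (p : PMF α) (q : PMF β) {f : α → β → ℝ} {B : ℝ}
    (hf : ∀ a b, |f a b| ≤ B) :
    (p.expect fun a => q.expect fun b => f a b) = q.expect fun b => p.expect fun a => f a b := by
  have h := congrArg (fun r : PMF (α × β) => r.expect fun x => f x.1 x.2)
    (PMF.bind_comm p q fun a b => PMF.pure (a, b))
  rw [PMF.expect_bind _ _ (B := B) fun x _ => hf x.1 x.2,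
    PMF.expect_bind _ _ (B := B) fun x _ => hf x.1 x.2] at h
  calc _ = _ := PMF.expect_congr _ fun a _ => ?_
    _ = _ := h
    _ = _ := PMF.expect_congr _ fun b _ => ?_
  · rw [PMF.expect_bind _ _ (B := B) fun x _ => hf x.1 x.2]; simp
  · rw [PMF.expect_bind _ _ (B := B) fun x _ => hf x.1 x.2]; simp

theorem abs_le_of_mem_Icc_zero {x b : ℝ} (h : x ∈ Set.Icc 0 b) : |x| ≤ b := by
  rw [abs_of_nonneg h.1]; exact h.2

/-! ### Visitation measures of one agent. -/

section Local

variable {𝒞 Si Ai : Type*}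

/-- One step of a local state-action chain. -/
noncomputable def stepAct (P : LocalKernel 𝒞 Si Ai) (π : LocalPolicy 𝒞 Si Ai) (c : 𝒞) (h : ℕ)
    (z : Si × Ai) : PMF (Si × Ai) :=
  PMF.joint (P h c z.1 z.2) (π (h + 1) c)

theorem visitAct_eq_joint (P : LocalKernel 𝒞 Si Ai) (s₁ : Si) (π : LocalPolicy 𝒞 Si Ai) (c : 𝒞)
    (h : ℕ) : visitAct P s₁ π c h = PMF.joint (visit P s₁ π c h) (π h c) := rfl

theorem visit_succ (P : LocalKernel 𝒞 Si Ai) (s₁ : Si) (π : LocalPolicy 𝒞 Si Ai) (c : 𝒞)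
    (h : ℕ) : visit P s₁ π c (h + 1) = (visitAct P s₁ π c h).bind fun z => P h c z.1 z.2 := by
  rw [visitAct_eq_joint, PMF.joint_bind]; rfl

theorem visitAct_succ (P : LocalKernel 𝒞 Si Ai) (s₁ : Si) (π : LocalPolicy 𝒞 Si Ai) (c : 𝒞)
    (h : ℕ) : visitAct P s₁ π c (h + 1) = (visitAct P s₁ π c h).bind (stepAct P π c h) := by
  rw [visitAct_eq_joint, visit_succ, PMF.joint, PMF.bind_bind]; rfl

theorem expect_visit_succ (P : LocalKernel 𝒞 Si Ai) (s₁ : Si) (π : LocalPolicy 𝒞 Si Ai) (c : 𝒞)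
    (h : ℕ) {f : Si → ℝ} {B : ℝ} (hf : ∀ s, |f s| ≤ B) :
    (visit P s₁ π c (h + 1)).expect f =
      (visitAct P s₁ π c h).expect fun z => (P h c z.1 z.2).expect f := by
  rw [visit_succ, PMF.expect_bind _ _ fun s _ => hf s]

theorem expect_visitAct (P : LocalKernel 𝒞 Si Ai) (s₁ : Si) (π : LocalPolicy 𝒞 Si Ai) (c : 𝒞)
    (h : ℕ) {f : Si × Ai → ℝ} {B : ℝ} (hf : ∀ z, |f z| ≤ B) :
    (visitAct P s₁ π c h).expect f =
      (visit P s₁ π c h).expect fun s => (π h c s).expect fun a => f (s, a) := by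
  rw [visitAct_eq_joint, PMF.expect_joint _ _ hf]

/-- The drift of the visitation measures when the transition model changes. -/
theorem abs_expect_visit_sub_le (P P' : LocalKernel 𝒞 Si Ai) (s₁ : Si) (π : LocalPolicy 𝒞 Si Ai)
    (c : 𝒞) (h : ℕ) {f : Si → ℝ} (hf : ∀ s, |f s| ≤ 1) :
    |(visit P s₁ π c h).expect f - (visit P' s₁ π c h).expect f| ≤
      ∑ k ∈ Finset.range h, (visitAct P s₁ π c k).expect fun z =>
        PMF.l1 (P k c z.1 z.2) (P' k c z.1 z.2) := by
  induction h generalizing f with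
  | zero => simp [visit]
  | succ h ih =>
    have b1 : ∀ z : Si × Ai, |(P h c z.1 z.2).expect f| ≤ 1 := fun z =>
      PMF.abs_expect_le _ fun s _ => hf s
    have b2 : ∀ z : Si × Ai, |(P' h c z.1 z.2).expect f| ≤ 1 := fun z =>
      PMF.abs_expect_le _ fun s _ => hf s
    rw [expect_visit_succ P s₁ π c h hf, expect_visit_succ P' s₁ π c h hf, Finset.sum_range_succ]
    -- The induction hypothesis is applied to the one-step look-ahead of `f` under `P'`. What
    -- remains is one transition taken with `P` instead of `P'`, averaged along the chain of `P`;
    -- hence all errors are measured under the visitation of `P`.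
    have h1 := ih (f := fun s => (π h c s).expect fun a => (P' h c s a).expect f)
      fun s => PMF.abs_expect_le _ fun a _ => b2 (s, a)
    rw [← expect_visitAct P s₁ π c h (f := fun z => (P' h c z.1 z.2).expect f) b2,
      ← expect_visitAct P' s₁ π c h (f := fun z => (P' h c z.1 z.2).expect f) b2] at h1
    have h2 : |((visitAct P s₁ π c h).expect fun z => (P h c z.1 z.2).expect f) -
        (visitAct P s₁ π c h).expect fun z => (P' h c z.1 z.2).expect f| ≤
        (visitAct P s₁ π c h).expect fun z => PMF.l1 (P h c z.1 z.2) (P' h c z.1 z.2) := by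
      rw [← PMF.expect_sub _ (fun z _ => b1 z) (fun z _ => b2 z)]
      have b3 : ∀ z : Si × Ai, |(P h c z.1 z.2).expect f - (P' h c z.1 z.2).expect f| ≤
          PMF.l1 (P h c z.1 z.2) (P' h c z.1 z.2) := fun z =>
        (PMF.abs_expect_sub_expect_le _ _ hf).trans (one_mul _).le
      have b4 : ∀ z : Si × Ai, |(P h c z.1 z.2).expect f - (P' h c z.1 z.2).expect f| ≤ 2 :=
        fun z => (b3 z).trans (PMF.l1_le_two _ _)
      refine (PMF.abs_expect_le_expect_abs _ fun z _ => b4 z).trans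
        (PMF.expect_mono _ (B := 2) (fun z _ => by rw [abs_abs]; exact b4 z)
          (fun z _ => PMF.abs_l1_le_two _ _) fun z _ => b3 z)
    have h3 := abs_add_le _ _ |>.trans (add_le_add h2 h1)
    rw [sub_add_sub_cancel] at h3
    linarith

theorem abs_expect_visitAct_sub_le (P P' : LocalKernel 𝒞 Si Ai) (s₁ : Si)
    (π : LocalPolicy 𝒞 Si Ai) (c : 𝒞) (h : ℕ) {f : Si × Ai → ℝ} (hf : ∀ z, |f z| ≤ 1) :
    |(visitAct P s₁ π c h).expect f - (visitAct P' s₁ π c h).expect f| ≤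
      ∑ k ∈ Finset.range h, (visitAct P s₁ π c k).expect fun z =>
        PMF.l1 (P k c z.1 z.2) (P' k c z.1 z.2) := by
  rw [expect_visitAct P s₁ π c h hf, expect_visitAct P' s₁ π c h hf]
  exact abs_expect_visit_sub_le P P' s₁ π c h fun s => PMF.abs_expect_le _ fun a _ => hf _

end Local

/-! ### From the joint game to a single-agent problem. -/

section Joint

variable {N : ℕ} {𝒞 : Type*} {S A : Fin N → Type*}

/-- The reward function in terms of the local state-action pairs. -/
def rewardAt (r : ℕ → RewardFn 𝒞 S A) (h : ℕ) (c : 𝒞) (z : ∀ j, S j × A j) : ℝ :=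
  r h c (fun j => (z j).1) (fun j => (z j).2)

/-- The joint Q-function with `n + 1` steps to go, by recursion. -/
noncomputable def qRec (P : ∀ i, LocalKernel 𝒞 (S i) (A i))
    (π : ∀ i, LocalPolicy 𝒞 (S i) (A i)) (r : ℕ → RewardFn 𝒞 S A) (c : 𝒞) :
    ℕ → ℕ → (∀ j, S j × A j) → ℝ
  | 0, h, z => rewardAt r h c z
  | n + 1, h, z => rewardAt r h c z +
    (PMF.indep fun j => stepAct (P j) (π j) c h (z j)).expect (qRec P π r c n (h + 1))

variable {H : ℕ} {P : ∀ i, LocalKernel 𝒞 (S i) (A i)} {π : ∀ i, LocalPolicy 𝒞 (S i) (A i)}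
  {r : ℕ → RewardFn 𝒞 S A} {c : 𝒞}

theorem qRec_mem_Icc (hr : ∀ h < H, ∀ s a, r h c s a ∈ Set.Icc (0 : ℝ) 1) (n h : ℕ)
    (hn : h + n < H) (z : ∀ j, S j × A j) : qRec P π r c n h z ∈ Set.Icc (0 : ℝ) (n + 1) := by
  induction n generalizing h z with
  | zero =>
    have : rewardAt r h c z ∈ Set.Icc (0 : ℝ) 1 := hr h (by omega) _ _
    simpa [qRec] using this
  | succ n ih =>
    have h1 := PMF.expect_mem_Icc (PMF.indep fun j => stepAct (P j) (π j) c h (z j))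
      fun z' _ => ih (h + 1) (by omega) z'
    have h2 : rewardAt r h c z ∈ Set.Icc (0 : ℝ) 1 := hr h (by omega) _ _
    rw [qRec]
    push_cast
    exact ⟨add_nonneg h2.1 h1.1, by linarith [h2.2, h1.2]⟩

theorem qRec_mem_Icc' (hr : ∀ h < H, ∀ s a, r h c s a ∈ Set.Icc (0 : ℝ) 1) (n h : ℕ)
    (hn : h + n < H) (z : ∀ j, S j × A j) : qRec P π r c n h z ∈ Set.Icc (0 : ℝ) H := by
  have h1 := qRec_mem_Icc (P := P) (π := π) hr n h hn z
  have h2 : ((n + 1 : ℕ) : ℝ) ≤ H := by exact_mod_cast (by omega : n + 1 ≤ H)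
  push_cast at h2
  exact ⟨h1.1, h1.2.trans h2⟩

theorem rolloutFrom_succ (n h : ℕ) (s : ∀ j, S j) (a : ∀ j, A j) :
    rolloutFrom P π c (n + 1) h s a = (PMF.indep fun i => P i h c (s i) (a i)).bind fun s' =>
      ((PMF.indep fun i => π i (h + 1) c (s' i)).bind fun a' =>
        rolloutFrom P π c n (h + 1) s' a').map fun τ => (s, a) :: τ := rfl

theorem cumReward_mem_Icc (hr : ∀ h < H, ∀ s a, r h c s a ∈ Set.Icc (0 : ℝ) 1) (n h : ℕ)
    (hn : h + n < H) (s : ∀ j, S j) (a : ∀ j, A j) (τ : List ((∀ j, S j) × (∀ j, A j)))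
    (hτ : τ ∈ (rolloutFrom P π c n h s a).support) :
    cumReward r c h τ ∈ Set.Icc (0 : ℝ) (n + 1) := by
  induction n generalizing h s a τ with
  | zero =>
    simp only [rolloutFrom, rollout, PMF.mem_support_bind_iff, PMF.mem_support_map_iff,
      PMF.mem_support_pure_iff] at hτ
    obtain ⟨_, _, _, rfl, rfl⟩ := hτ
    simpa [cumReward] using hr h (by omega) s a
  | succ n ih =>
    rw [rolloutFrom_succ] at hτ
    simp only [PMF.mem_support_bind_iff, PMF.mem_support_map_iff] at hτ
    obtain ⟨s', _, τ', ⟨a', _, hτ'⟩, rfl⟩ := hτ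
    have h1 := ih (h + 1) (by omega) s' a' τ' hτ'
    have h2 := hr h (by omega) s a
    rw [cumReward]
    push_cast
    exact ⟨add_nonneg h2.1 h1.1, by linarith [h2.2, h1.2]⟩

theorem expect_indep_joint_eq {ι : Type*} [Fintype ι] {X Y : ι → Type*} (p : ∀ i, PMF (X i))
    (q : ∀ i, X i → PMF (Y i)) {f : (∀ i, X i × Y i) → ℝ} {B : ℝ} (hf : ∀ z, |f z| ≤ B) :
    (PMF.indep fun i => PMF.joint (p i) (q i)).expect f =
      (PMF.indep p).expect fun x => (PMF.indep fun i => q i (x i)).expect fun y =>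
        f fun i => (x i, y i) := by
  rw [← PMF.indep_joint, PMF.expect_bind _ _ fun z _ => hf z]
  exact PMF.expect_congr _ fun x _ => PMF.expect_map _ _ fun y _ => hf _

/-- The rollout alternates joint states and joint actions. Regrouped by agent, it is a product of
independent chains on local state-action pairs, the form in which the other agents can be integrated
out. -/
theorem expect_rolloutFrom (hr : ∀ h < H, ∀ s a, r h c s a ∈ Set.Icc (0 : ℝ) 1) (n h : ℕ)
    (hn : h + n < H) (s : ∀ j, S j) (a : ∀ j, A j) :
    (rolloutFrom P π c n h s a).expect (cumReward r c h) =
      qRec P π r c n h fun j => (s j, a j) := by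
  induction n generalizing h s a with
  | zero =>
    have : rolloutFrom P π c 0 h s a = PMF.pure [(s, a)] := by
      simp only [rolloutFrom, rollout, PMF.pure_map, PMF.bind_const]
    rw [this, PMF.expect_pure]
    simp [cumReward, qRec, rewardAt]
  | succ n ih =>
    have hB := fun τ (hτ : (rolloutFrom P π c (n + 1) h s a) τ ≠ 0) =>
      abs_le_of_mem_Icc_zero (cumReward_mem_Icc hr (n + 1) h hn s a τ hτ)
    have hB' := fun s' a' τ (hτ : (rolloutFrom P π c n (h + 1) s' a') τ ≠ 0) =>
      abs_le_of_mem_Icc_zero (cumReward_mem_Icc hr n (h + 1) (by omega) s' a' τ hτ)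
    rw [rolloutFrom_succ] at hB ⊢
    have hq := fun z => abs_le_of_mem_Icc_zero
      (qRec_mem_Icc (P := P) (π := π) hr n (h + 1) (by omega) z)
    rw [PMF.expect_bind _ _ hB, qRec]
    have e : (PMF.indep fun j => stepAct (P j) (π j) c h (s j, a j)) =
      PMF.indep fun j => PMF.joint (P j h c (s j) (a j)) (π j (h + 1) c) := rfl
    rw [e, expect_indep_joint_eq _ _ hq]
    have h0 : rewardAt r h c (fun j => (s j, a j)) = r h c s a := rfl
    rw [h0, ← (PMF.indep fun i => P i h c (s i) (a i)).expect_const (r h c s a),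
      ← PMF.expect_add _ (fun _ _ => le_rfl) (fun x _ => PMF.abs_expect_le _ fun y _ => hq _)]
    refine PMF.expect_congr _ fun s' _ => ?_
    have hsup : ∀ τ, ((PMF.indep fun i => π i (h + 1) c (s' i)).bind fun a' =>
        rolloutFrom P π c n (h + 1) s' a') τ ≠ 0 → |cumReward r c (h + 1) τ| ≤ n + 1 := by
      intro τ hτ
      obtain ⟨a', _, ha'⟩ := (PMF.mem_support_bind_iff _ _ τ).1 hτ
      exact hB' s' a' τ ha'
    rw [PMF.expect_map _ _ (B := |r h c s a| + (n + 1))]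
    · simp only [cumReward]
      rw [PMF.expect_add _ (fun _ _ => le_rfl) hsup, PMF.expect_const, PMF.expect_bind _ _ hsup]
      congr 1
      exact PMF.expect_congr _ fun a' _ => ih (h + 1) (by omega) s' a'
    · intro τ hτ
      exact (abs_add_le _ _).trans (add_le_add le_rfl (hsup τ hτ))

theorem qFn_eq (hr : ∀ h < H, ∀ s a, r h c s a ∈ Set.Icc (0 : ℝ) 1) {h : ℕ}
    (hh : h < H) (s : ∀ j, S j) (a : ∀ j, A j) :
    qFn H P π r h c s a = qRec P π r c (H - h - 1) h fun j => (s j, a j) :=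
  expect_rolloutFrom hr _ h (by omega) s a

variable (s₁ : ∀ i, S i) (i : Fin N)

/-- The reward of agent `i`, averaged over the other agents. -/
noncomputable def rewardBar (s₁ : ∀ i, S i) (P : ∀ i, LocalKernel 𝒞 (S i) (A i))
    (π : ∀ i, LocalPolicy 𝒞 (S i) (A i)) (i : Fin N) (r : ℕ → RewardFn 𝒞 S A) (c : 𝒞) (h : ℕ)
    (z : S i × A i) : ℝ :=
  (PMF.indep fun j : {j // j ≠ i} => visitAct (P j) (s₁ j) (π j) c h).expect fun y =>
    rewardAt r h c (PMF.glue i z y)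

/-- The joint Q-function with `n + 1` steps to go, averaged over the other agents. -/
noncomputable def qBar (s₁ : ∀ i, S i) (P : ∀ i, LocalKernel 𝒞 (S i) (A i))
    (π : ∀ i, LocalPolicy 𝒞 (S i) (A i)) (i : Fin N) (r : ℕ → RewardFn 𝒞 S A) (c : 𝒞) (n h : ℕ)
    (z : S i × A i) : ℝ :=
  (PMF.indep fun j : {j // j ≠ i} => visitAct (P j) (s₁ j) (π j) c h).expect fun y =>
    qRec P π r c n h (PMF.glue i z y)

theorem qBar_mem_Icc (hr : ∀ h < H, ∀ s a, r h c s a ∈ Set.Icc (0 : ℝ) 1) {n h : ℕ}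
    (hn : h + n < H) (z : S i × A i) : qBar s₁ P π i r c n h z ∈ Set.Icc (0 : ℝ) H :=
  PMF.expect_mem_Icc _ fun _ _ => qRec_mem_Icc' hr n h hn _

theorem rewardBar_mem_Icc (hr : ∀ h < H, ∀ s a, r h c s a ∈ Set.Icc (0 : ℝ) 1) {h : ℕ}
    (hn : h < H) (z : S i × A i) : rewardBar s₁ P π i r c h z ∈ Set.Icc (0 : ℝ) 1 :=
  PMF.expect_mem_Icc _ fun _ _ => hr h hn _ _

theorem glue_prod (si : S i) (ai : A i) (y : ∀ j : {j // j ≠ i}, S j × A j) :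
    (fun j => ((Equiv.piSplitAt i S).symm (si, fun j => (y j).1) j,
      (Equiv.piSplitAt i A).symm (ai, fun j => (y j).2) j)) =
      PMF.glue (X := fun j => S j × A j) i (si, ai) y := by
  funext j
  change (PMF.glue i si (fun j => (y j).1) j, PMF.glue i ai (fun j => (y j).2) j) = _
  by_cases h : j = i
  · subst h; simp
  · rw [PMF.glue_of_ne i _ _ h, PMF.glue_of_ne i _ _ h, PMF.glue_of_ne i _ _ h]

theorem singleQ_eq (hr : ∀ h < H, ∀ s a, r h c s a ∈ Set.Icc (0 : ℝ) 1) {h : ℕ} (hh : h < H)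
    (si : S i) (ai : A i) :
    singleQ H s₁ P π i r h c si ai = qBar s₁ P π i r c (H - h - 1) h (si, ai) := by
  refine PMF.expect_congr _ fun y _ => ?_
  rw [qFn_eq hr hh, glue_prod]

theorem qBar_zero (h : ℕ) (z : S i × A i) :
    qBar s₁ P π i r c 0 h z = rewardBar s₁ P π i r c h z := rfl

/-- One step carries the product of the other agents' visitations at `h` to the product of their
visitations at `h + 1`, independently of agent `i`. The average over the others thus commutes with
the transition of agent `i`. -/
theorem qBar_succ (hr : ∀ h < H, ∀ s a, r h c s a ∈ Set.Icc (0 : ℝ) 1) {n h : ℕ}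
    (hn : h + (n + 1) < H) (z : S i × A i) :
    qBar s₁ P π i r c (n + 1) h z = rewardBar s₁ P π i r c h z +
      (stepAct (P i) (π i) c h z).expect (qBar s₁ P π i r c n (h + 1)) := by
  have hq := fun z => abs_le_of_mem_Icc_zero
    (qRec_mem_Icc (P := P) (π := π) hr n (h + 1) (by omega) z)
  rw [qBar]
  simp only [qRec]
  have hr0 : ∀ z, |rewardAt r h c z| ≤ 1 := fun z =>
    abs_le_of_mem_Icc_zero (hr h (by omega) _ _)
  rw [PMF.expect_add _ (fun y _ => hr0 _)
    (fun y _ => PMF.abs_expect_le _ fun z' _ => hq z')]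
  congr 1
  have e1 : ∀ y : ∀ j : {j // j ≠ i}, S j × A j,
      (PMF.indep fun j => stepAct (P j) (π j) c h
        (PMF.glue (X := fun j => S j × A j) i z y j)).expect (qRec P π r c n (h + 1)) =
      (stepAct (P i) (π i) c h z).expect fun z' =>
        (PMF.indep fun j : {j // j ≠ i} => stepAct (P j) (π j) c h (y j)).expect fun y' =>
          qRec P π r c n (h + 1) (PMF.glue i z' y') := by
    intro y
    rw [PMF.expect_indep_eq _ i hq]
    simp only [PMF.glue_self, PMF.glue_ne]
  simp only [e1]
  rw [PMF.expect_comm _ _ fun y z' => PMF.abs_expect_le _ fun y' _ => hq _]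
  refine PMF.expect_congr _ fun z' _ => ?_
  rw [qBar]
  simp only [visitAct_succ]
  rw [← PMF.indep_bind_indep, PMF.expect_bind _ _ fun y' _ => hq _]

theorem expect_visitAct_qBar (hr : ∀ h < H, ∀ s a, r h c s a ∈ Set.Icc (0 : ℝ) 1) (n h : ℕ)
    (hn : h + n < H) :
    (visitAct (P i) (s₁ i) (π i) c h).expect (qBar s₁ P π i r c n h) =
      ∑ k ∈ Finset.range (n + 1), (visitAct (P i) (s₁ i) (π i) c (h + k)).expect
        (rewardBar s₁ P π i r c (h + k)) := by
  induction n generalizing h with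
  | zero => simp [show qBar s₁ P π i r c 0 h = rewardBar s₁ P π i r c h from rfl]
  | succ n ih =>
    have hq : ∀ z, |qBar s₁ P π i r c n (h + 1) z| ≤ H := fun z =>
      abs_le_of_mem_Icc_zero (qBar_mem_Icc s₁ i hr (by omega) z)
    rw [Finset.sum_range_succ', show qBar s₁ P π i r c (n + 1) h = fun z => _ from
      funext fun z => qBar_succ s₁ i hr hn z, PMF.expect_add _ (fun z _ => abs_le_of_mem_Icc_zero
        (rewardBar_mem_Icc s₁ i hr (by omega) z)) (fun z _ => PMF.abs_expect_le _ fun z' _ => hq z'),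
      ← PMF.expect_bind _ _ fun z _ => hq z, ← visitAct_succ, ih (h + 1) (by omega), add_comm]
    simp only [add_zero, add_assoc, add_comm 1]

/-- In this form a deviation of agent `i` affects only its own visitation measure, since `rewardBar`
involves only the other agents' policies. -/
theorem valueFn_eq (hr : ∀ h < H, ∀ s a, r h c s a ∈ Set.Icc (0 : ℝ) 1) (hH : 1 ≤ H) :
    valueFn H P π r 0 c s₁ = ∑ h ∈ Finset.range H, (visitAct (P i) (s₁ i) (π i) c h).expect
      (rewardBar s₁ P π i r c h) := by
  obtain ⟨n, rfl⟩ : ∃ n, H = n + 1 := ⟨H - 1, by omega⟩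
  have hq := fun z => abs_le_of_mem_Icc_zero
    (qRec_mem_Icc (P := P) (π := π) hr n 0 (by omega) z)
  have h1 := expect_visitAct_qBar (P := P) (π := π) s₁ i hr n 0 (by omega)
  simp only [zero_add] at h1
  rw [← h1]
  have e : valueFn (n + 1) P π r 0 c s₁ = ((PMF.indep fun i => π i 0 c (s₁ i)).bind fun a =>
      rolloutFrom P π c n 0 s₁ a).expect (cumReward r c 0) := rfl
  rw [e, PMF.expect_bind _ _ (B := n + 1)]
  · have e2 : (PMF.indep fun j => visitAct (P j) (s₁ j) (π j) c 0).expect (qRec P π r c n 0) =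
        (PMF.indep fun i => π i 0 c (s₁ i)).expect fun a => qRec P π r c n 0 fun j => (s₁ j, a j) := by
      simp only [visitAct_eq_joint]
      rw [expect_indep_joint_eq _ _ hq]
      simp only [visit, PMF.indep_pure, PMF.expect_pure]
    rw [show qBar s₁ P π i r c n 0 = fun z => _ from rfl]
    unfold qBar
    rw [← PMF.expect_indep_eq (fun j => visitAct (P j) (s₁ j) (π j) c 0) i hq, e2]
    exact PMF.expect_congr _ fun a _ => expect_rolloutFrom hr n 0 (by omega) s₁ a
  · intro τ hτ
    obtain ⟨a, _, ha⟩ := (PMF.mem_support_bind_iff _ _ τ).1 hτ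
    exact abs_le_of_mem_Icc_zero (cumReward_mem_Icc hr n 0 (by omega) s₁ a τ ha)

theorem valueFn_mem_Icc (hr : ∀ h < H, ∀ s a, r h c s a ∈ Set.Icc (0 : ℝ) 1) (hH : 1 ≤ H)
    (i : Fin N) : valueFn H P π r 0 c s₁ ∈ Set.Icc (0 : ℝ) H := by
  have h1 : ∀ h ∈ Finset.range H, (visitAct (P i) (s₁ i) (π i) c h).expect
      (rewardBar s₁ P π i r c h) ∈ Set.Icc (0 : ℝ) 1 := fun h hh =>
    PMF.expect_mem_Icc _ fun z _ => rewardBar_mem_Icc s₁ i hr (Finset.mem_range.1 hh) z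
  rw [valueFn_eq s₁ i hr hH]
  refine ⟨Finset.sum_nonneg fun h hh => (h1 h hh).1, ?_⟩
  calc _ ≤ ∑ h ∈ Finset.range H, (1 : ℝ) := Finset.sum_le_sum fun h hh => (h1 h hh).2
    _ = H := by simp

/-- The single-agent value function; it vanishes after the horizon. -/
noncomputable def vBar (H : ℕ) (s₁ : ∀ i, S i) (P : ∀ i, LocalKernel 𝒞 (S i) (A i))
    (π : ∀ i, LocalPolicy 𝒞 (S i) (A i)) (i : Fin N) (r : ℕ → RewardFn 𝒞 S A) (c : 𝒞) (h : ℕ)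
    (s : S i) : ℝ :=
  if h < H then (π i h c s).expect (singleQ H s₁ P π i r h c s) else 0

theorem singleQ_mem_Icc (hr : ∀ h < H, ∀ s a, r h c s a ∈ Set.Icc (0 : ℝ) 1) {h : ℕ}
    (hh : h < H) (s : S i) (a : A i) : singleQ H s₁ P π i r h c s a ∈ Set.Icc (0 : ℝ) H := by
  rw [singleQ_eq s₁ i hr hh]
  exact qBar_mem_Icc s₁ i hr (by omega) _

theorem vBar_mem_Icc (hr : ∀ h < H, ∀ s a, r h c s a ∈ Set.Icc (0 : ℝ) 1) (h : ℕ) (s : S i) :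
    vBar H s₁ P π i r c h s ∈ Set.Icc (0 : ℝ) H := by
  rw [vBar]
  split_ifs with hh
  · exact PMF.expect_mem_Icc _ fun a _ => singleQ_mem_Icc s₁ i hr hh s a
  · simp

/-- The recursion `qBar_succ` in step-indexed form; the convention that `vBar` vanishes from step
`H` on covers the last step. -/
theorem singleQ_bellman (hr : ∀ h < H, ∀ s a, r h c s a ∈ Set.Icc (0 : ℝ) 1) {h : ℕ}
    (hh : h < H) (z : S i × A i) :
    singleQ H s₁ P π i r h c z.1 z.2 = rewardBar s₁ P π i r c h z +
      (P i h c z.1 z.2).expect (vBar H s₁ P π i r c (h + 1)) := by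
  rw [singleQ_eq s₁ i hr hh]
  by_cases h1 : h + 1 < H
  · have e : H - h - 1 = (H - (h + 1) - 1) + 1 := by omega
    rw [e, qBar_succ s₁ i hr (by omega), stepAct,
      PMF.expect_joint _ _ fun z => abs_le_of_mem_Icc_zero (qBar_mem_Icc s₁ i hr (by omega) z)]
    congr 1
    refine PMF.expect_congr _ fun s' _ => ?_
    rw [vBar, if_pos h1]
    exact PMF.expect_congr _ fun a' _ => (singleQ_eq s₁ i hr h1 s' a').symm
  · have e : H - h - 1 = 0 := by omega
    rw [e, qBar_zero]
    have : vBar H s₁ P π i r c (h + 1) = fun _ => 0 := by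
      funext s; rw [vBar, if_neg h1]
    rw [this, PMF.expect_const, add_zero]

/-- Performance difference, along the chain of a transition kernel `P₀` that may differ from the
model. -/
theorem performance_difference (hr : ∀ h < H, ∀ s a, r h c s a ∈ Set.Icc (0 : ℝ) 1)
    (P₀ : LocalKernel 𝒞 (S i) (A i)) (ξ : LocalPolicy 𝒞 (S i) (A i)) :
    ∑ h ∈ Finset.range H, ((visit P₀ (s₁ i) ξ c h).expect fun s =>
      (ξ h c s).expect (singleQ H s₁ P π i r h c s) -
        (π i h c s).expect (singleQ H s₁ P π i r h c s)) =
    (∑ h ∈ Finset.range H, (visitAct P₀ (s₁ i) ξ c h).expect fun z =>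
      rewardBar s₁ P π i r c h z + ((P i h c z.1 z.2).expect (vBar H s₁ P π i r c (h + 1)) -
        (P₀ h c z.1 z.2).expect (vBar H s₁ P π i r c (h + 1)))) - vBar H s₁ P π i r c 0 (s₁ i) := by
  have hV := fun h s => abs_le_of_mem_Icc_zero (vBar_mem_Icc (P := P) (π := π) s₁ i hr h s)
  have hPV := fun (Q : PMF (S i)) h => Q.abs_expect_le fun s _ => hV h s
  -- The mean model value along the true chain telescopes from the initial value to zero. The
  -- Bellman equation uses the model kernel while `d` advances with `P₀`, which produces the kernel
  -- difference on the right.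
  set d : ℕ → ℝ := fun h => (visit P₀ (s₁ i) ξ c h).expect (vBar H s₁ P π i r c h)
  have hd0 : d 0 = vBar H s₁ P π i r c 0 (s₁ i) := by simp [d, visit]
  have hdH : d H = 0 := by
    have : vBar H s₁ P π i r c H = fun _ => 0 := by
      funext s; rw [vBar, if_neg (lt_irrefl H)]
    simp [d, this]
  have htel := Finset.sum_range_sub' d H
  rw [hd0, hdH, sub_zero] at htel
  rw [← htel, ← Finset.sum_sub_distrib]
  refine Finset.sum_congr rfl fun h hh => ?_
  have hh' : h < H := Finset.mem_range.1 hh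
  have hQ := fun z : S i × A i =>
    abs_le_of_mem_Icc_zero (singleQ_mem_Icc (P := P) (π := π) s₁ i hr hh' z.1 z.2)
  have e1 : ((visit P₀ (s₁ i) ξ c h).expect fun s =>
      (ξ h c s).expect (singleQ H s₁ P π i r h c s) -
        (π i h c s).expect (singleQ H s₁ P π i r h c s)) =
      ((visitAct P₀ (s₁ i) ξ c h).expect fun z => singleQ H s₁ P π i r h c z.1 z.2) - d h := by
    rw [PMF.expect_sub _ (fun s _ => PMF.abs_expect_le _ fun a _ => hQ (s, a))
      (fun s _ => PMF.abs_expect_le _ fun a _ => hQ (s, a)), expect_visitAct _ _ _ _ _ hQ]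
    congr 1
    refine PMF.expect_congr _ fun s _ => ?_
    rw [vBar, if_pos hh']
  have e2 : d (h + 1) = (visitAct P₀ (s₁ i) ξ c h).expect fun z =>
      (P₀ h c z.1 z.2).expect (vBar H s₁ P π i r c (h + 1)) :=
    expect_visit_succ _ _ _ _ _ (hV _)
  have e3 : ((visitAct P₀ (s₁ i) ξ c h).expect fun z =>
      rewardBar s₁ P π i r c h z + ((P i h c z.1 z.2).expect (vBar H s₁ P π i r c (h + 1)) -
        (P₀ h c z.1 z.2).expect (vBar H s₁ P π i r c (h + 1)))) =
      ((visitAct P₀ (s₁ i) ξ c h).expect fun z => singleQ H s₁ P π i r h c z.1 z.2) -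
        d (h + 1) := by
    rw [e2, ← PMF.expect_sub _ (fun z _ => hQ z) (fun z _ => hPV _ _)]
    refine PMF.expect_congr _ fun z _ => ?_
    rw [singleQ_bellman s₁ i hr hh']
    ring
  rw [e1, e3]
  ring

/-- The gain from a unilateral deviation is bounded by the regret in the model plus model errors. -/
theorem valueFn_update_sub_le (hH : 1 ≤ H) {r' : ℕ → RewardFn 𝒞 S A}
    {P' : ∀ i, LocalKernel 𝒞 (S i) (A i)}
    (hr : ∀ h < H, ∀ s a, r h c s a ∈ Set.Icc (0 : ℝ) 1)
    (hr' : ∀ h < H, ∀ s a, r' h c s a ∈ Set.Icc (0 : ℝ) 1) (μ : LocalPolicy 𝒞 (S i) (A i)) :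
    valueFn H P (Function.update π i μ) r 0 c s₁ - valueFn H P π r 0 c s₁ ≤
    ∑ h ∈ Finset.range H, (((visit (P i) (s₁ i) μ c h).expect fun s =>
      (μ h c s).expect (singleQ H s₁ P' π i r' h c s) -
        (π i h c s).expect (singleQ H s₁ P' π i r' h c s)) +
      ((visitAct (P i) (s₁ i) μ c h).expect (fun z =>
        |rewardBar s₁ P π i r c h z - rewardBar s₁ P' π i r' c h z| +
          H * PMF.l1 (P i h c z.1 z.2) (P' i h c z.1 z.2)) +
      (visitAct (P i) (s₁ i) (π i) c h).expect (fun z =>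
        |rewardBar s₁ P π i r c h z - rewardBar s₁ P' π i r' c h z| +
          H * PMF.l1 (P i h c z.1 z.2) (P' i h c z.1 z.2)))) := by
  have hV := fun h s => abs_le_of_mem_Icc_zero (vBar_mem_Icc (P := P') (π := π) s₁ i hr' h s)
  have e0 : rewardBar s₁ P (Function.update π i μ) i r c = rewardBar s₁ P π i r c := by
    funext h z
    simp only [rewardBar]
    congr 2
    funext j
    rw [Function.update_of_ne j.2]
  have e1 := valueFn_eq (P := P) (π := Function.update π i μ) s₁ i hr hH
  rw [Function.update_self, e0] at e1
  rw [e1, valueFn_eq s₁ i hr hH]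
  have p1 := performance_difference (P := P') (π := π) s₁ i hr' (P i) μ
  -- With `ξ = π i` the advantages vanish, so this expresses the initial model value through true
  -- visitations. Subtracting it from `p1` removes that value.
  have p2 := performance_difference (P := P') (π := π) s₁ i hr' (P i) (π i)
  simp only [sub_self, PMF.expect_const, Finset.sum_const_zero] at p2
  rw [Finset.sum_add_distrib, p1, Finset.sum_add_distrib]
  have key : ∀ ξ : LocalPolicy 𝒞 (S i) (A i), |∑ h ∈ Finset.range H,
      (visitAct (P i) (s₁ i) ξ c h).expect (rewardBar s₁ P π i r c h) -
      ∑ h ∈ Finset.range H, (visitAct (P i) (s₁ i) ξ c h).expect fun z =>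
        rewardBar s₁ P' π i r' c h z + ((P' i h c z.1 z.2).expect (vBar H s₁ P' π i r' c (h + 1)) -
        (P i h c z.1 z.2).expect (vBar H s₁ P' π i r' c (h + 1)))| ≤
      ∑ h ∈ Finset.range H, (visitAct (P i) (s₁ i) ξ c h).expect fun z =>
        |rewardBar s₁ P π i r c h z - rewardBar s₁ P' π i r' c h z| +
          H * PMF.l1 (P i h c z.1 z.2) (P' i h c z.1 z.2) := by
    intro ξ
    rw [← Finset.sum_sub_distrib]
    refine (Finset.abs_sum_le_sum_abs _ _).trans (Finset.sum_le_sum fun h hh => ?_)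
    have hh' : h < H := Finset.mem_range.1 hh
    have b1 := fun z => abs_le_of_mem_Icc_zero (rewardBar_mem_Icc (P := P) (π := π) s₁ i hr hh' z)
    have b2 := fun z =>
      abs_le_of_mem_Icc_zero (rewardBar_mem_Icc (P := P') (π := π) s₁ i hr' hh' z)
    have b3 : ∀ z : S i × A i, |(P i h c z.1 z.2).expect (vBar H s₁ P' π i r' c (h + 1)) -
        (P' i h c z.1 z.2).expect (vBar H s₁ P' π i r' c (h + 1))| ≤
          H * PMF.l1 (P i h c z.1 z.2) (P' i h c z.1 z.2) := fun z =>
      PMF.abs_expect_sub_expect_le _ _ (hV _)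
    have b4 : ∀ z : S i × A i, |H * PMF.l1 (P i h c z.1 z.2) (P' i h c z.1 z.2)| ≤ H * 2 :=
      fun z => by
        rw [abs_mul, Nat.abs_cast]
        exact mul_le_mul_of_nonneg_left (PMF.abs_l1_le_two _ _) (Nat.cast_nonneg _)
    have b5 : ∀ z, |rewardBar s₁ P π i r c h z - rewardBar s₁ P' π i r' c h z| ≤ 1 + 1 := fun z =>
      (abs_sub _ _).trans (add_le_add (b1 z) (b2 z))
    have b6 : ∀ z : S i × A i, |(P' i h c z.1 z.2).expect (vBar H s₁ P' π i r' c (h + 1)) -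
        (P i h c z.1 z.2).expect (vBar H s₁ P' π i r' c (h + 1))| ≤ H * 2 := fun z => by
      rw [abs_sub_comm]; exact (b3 z).trans ((le_abs_self _).trans (b4 z))
    have b7 : ∀ z : S i × A i, |rewardBar s₁ P π i r c h z - (rewardBar s₁ P' π i r' c h z +
        ((P' i h c z.1 z.2).expect (vBar H s₁ P' π i r' c (h + 1)) -
        (P i h c z.1 z.2).expect (vBar H s₁ P' π i r' c (h + 1))))| ≤
        |rewardBar s₁ P π i r c h z - rewardBar s₁ P' π i r' c h z| +
          H * PMF.l1 (P i h c z.1 z.2) (P' i h c z.1 z.2) := fun z => by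
      rw [← sub_sub]
      refine (abs_sub _ _).trans (add_le_add le_rfl ?_)
      rw [abs_sub_comm]; exact b3 z
    have b8 : ∀ z : S i × A i, |rewardBar s₁ P π i r c h z - rewardBar s₁ P' π i r' c h z| +
          H * PMF.l1 (P i h c z.1 z.2) (P' i h c z.1 z.2) ≤ 1 + 1 + H * 2 := fun z =>
      add_le_add (b5 z) ((le_abs_self _).trans (b4 z))
    rw [← PMF.expect_sub _ (fun z _ => b1 z) (fun z _ => (abs_add_le _ _).trans
      (add_le_add (b2 z) (b6 z)))]
    refine (PMF.abs_expect_le_expect_abs _ fun z _ => (b7 z).trans (b8 z)).trans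
      (PMF.expect_mono _ (B := 1 + 1 + H * 2) (C := 1 + 1 + H * 2) (fun z _ => ?_) (fun z _ => ?_)
        fun z _ => b7 z)
    · rw [abs_abs]; exact (b7 z).trans (b8 z)
    · rw [abs_of_nonneg (add_nonneg (abs_nonneg _)
        (mul_nonneg (Nat.cast_nonneg _) (PMF.l1_nonneg _ _)))]
      exact b8 z
  have k1 := abs_le.1 (key μ)
  have k2 := abs_le.1 (key (π i))
  linarith [k1.2, k2.1]

end Joint

/-! ### The regularized actor update: stability and regret. -/

namespace PMF

variable {α : Type*}

/-- `x ≪ ν` with square-integrable density. -/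
def SqInt (ν x : PMF α) : Prop :=
  (∀ a, ν a = 0 → x a = 0) ∧ Summable fun a => (x a).toReal ^ 2 / (ν a).toReal

/-- The real-valued version of `bregman`. -/
noncomputable def sqDist (ν x y : PMF α) : ℝ :=
  ∑' a, ((x a).toReal - (y a).toReal) ^ 2 / (ν a).toReal

theorem sqDist_nonneg (ν x y : PMF α) : 0 ≤ sqDist ν x y :=
  tsum_nonneg fun _ => div_nonneg (sq_nonneg _) ENNReal.toReal_nonneg

theorem SqInt.of_le_mul {ν x : PMF α} {W : ℝ} (h : ∀ a, (x a).toReal ≤ W * (ν a).toReal) :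
    SqInt ν x := by
  refine ⟨fun a ha => ?_, ?_⟩
  · have := h a
    rw [ha, ENNReal.toReal_zero, mul_zero] at this
    exact ((ENNReal.toReal_eq_zero_iff _).1 (le_antisymm this ENNReal.toReal_nonneg)).resolve_right
      (x.apply_ne_top a)
  · refine Summable.of_nonneg_of_le (fun a => div_nonneg (sq_nonneg _) ENNReal.toReal_nonneg)
      (fun a => ?_) (x.summable_toReal.mul_left W)
    rcases (ENNReal.toReal_nonneg (a := ν a)).eq_or_lt with h0 | h0
    · have := h a
      rw [← h0, mul_zero] at this
      rw [le_antisymm this ENNReal.toReal_nonneg]; simp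
    · rw [div_le_iff₀ h0, sq, mul_right_comm]
      exact mul_le_mul_of_nonneg_right (h a) ENNReal.toReal_nonneg

theorem SqInt.self (ν : PMF α) : SqInt ν ν := SqInt.of_le_mul (W := 1) fun a => by rw [one_mul]

theorem SqInt.summable {ν x y : PMF α} (hx : SqInt ν x) (hy : SqInt ν y) :
    Summable fun a => ((x a).toReal - (y a).toReal) ^ 2 / (ν a).toReal := by
  refine Summable.of_nonneg_of_le (fun a => div_nonneg (sq_nonneg _) ENNReal.toReal_nonneg)
    (fun a => ?_) ((hx.2.mul_left 2).add (hy.2.mul_left 2))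
  rw [← mul_div_assoc, ← mul_div_assoc, ← add_div]
  refine div_le_div_of_nonneg_right ?_ ENNReal.toReal_nonneg
  nlinarith [sq_nonneg ((x a).toReal + (y a).toReal)]

theorem SqInt.bregman_eq {ν x y : PMF α} (hx : SqInt ν x) (hy : SqInt ν y) :
    bregman ν x y = ENNReal.ofReal (sqDist ν x y) := by
  rw [sqDist, ENNReal.ofReal_tsum_of_nonneg
    (fun a => div_nonneg (sq_nonneg _) ENNReal.toReal_nonneg) (hx.summable hy), bregman]
  refine tsum_congr fun a => ?_
  by_cases h : ν a = 0
  · simp [hx.1 a h, hy.1 a h]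
  · rw [ENNReal.ofReal_div_of_pos (ENNReal.toReal_pos h (ν.apply_ne_top a)),
      ENNReal.ofReal_toReal (ν.apply_ne_top a)]

/-- Mass of `x` off the support of `ν` would give a term `x / 0 = ∞`; square integrability follows
from `x² ≤ 2 (x - ν)² + 2 ν²`. -/
theorem SqInt.of_chiSq_ne_top {ν x : PMF α} (h : chiSq x ν ≠ ⊤) : SqInt ν x := by
  rw [chiSq, bregman] at h
  have h1 : ∀ a, ν a = 0 → x a = 0 := by
    intro a ha
    have := ENNReal.ne_top_of_tsum_ne_top h a
    by_contra hx
    apply this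
    rw [ha, ENNReal.toReal_zero, sub_zero]
    exact ENNReal.div_zero (by
      rw [Ne, ENNReal.ofReal_eq_zero, not_le]
      exact pow_pos (ENNReal.toReal_pos hx (x.apply_ne_top a)) 2)
  refine ⟨h1, ?_⟩
  have h2 := ENNReal.summable_toReal h
  refine Summable.of_nonneg_of_le (fun a => div_nonneg (sq_nonneg _) ENNReal.toReal_nonneg)
    (fun a => ?_) ((h2.mul_left 2).add (ν.summable_toReal.mul_left 2))
  rw [ENNReal.toReal_div, ENNReal.toReal_ofReal (sq_nonneg _)]
  rcases (ENNReal.toReal_nonneg (a := ν a)).eq_or_lt with h0 | h0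
  · simp [← h0]
  · rw [div_le_iff₀ h0, add_mul, mul_assoc, div_mul_cancel₀ _ h0.ne']
    nlinarith [sq_nonneg ((x a).toReal - 2 * (ν a).toReal)]

theorem SqInt.chiSq_toReal {ν x : PMF α} (hx : SqInt ν x) : (chiSq x ν).toReal = sqDist ν x ν := by
  rw [chiSq, hx.bregman_eq (SqInt.self ν), ENNReal.toReal_ofReal (sqDist_nonneg _ _ _)]

/-- The real-valued version of `actorObjective`. -/
noncomputable def actorReal (lam eta : ℝ) (f : α → ℝ) (ν p₀ p : PMF α) : ℝ :=
  -p.expect f + (lam * sqDist ν p ν + 1 / eta * sqDist ν p p₀)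

theorem SqInt.actorObjective_eq {lam eta : ℝ} (hl : 0 < lam) (he : 0 < eta) {f : α → ℝ}
    {ν p₀ p : PMF α} (h0 : SqInt ν p₀) (hp : SqInt ν p) :
    actorObjective lam eta f ν p₀ p = (actorReal lam eta f ν p₀ p : EReal) := by
  have h1 : 0 ≤ lam * sqDist ν p ν := mul_nonneg hl.le (sqDist_nonneg _ _ _)
  have h2 : 0 ≤ 1 / eta * sqDist ν p p₀ := mul_nonneg (by positivity) (sqDist_nonneg _ _ _)
  rw [actorObjective, actorReal, chiSq, hp.bregman_eq (SqInt.self ν), hp.bregman_eq h0,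
    ← ENNReal.ofReal_mul hl.le, ← ENNReal.ofReal_mul (by positivity),
    ← ENNReal.ofReal_add h1 h2, EReal.coe_ennreal_ofReal, max_eq_left (add_nonneg h1 h2),
    EReal.coe_add, EReal.coe_add, EReal.coe_add]

/-- The objective is finite at `ν`, so a minimizer has finite `χ²`-divergence and the real-valued
calculus applies to it. -/
theorem SqInt.of_isMinimizer {lam eta : ℝ} (hl : 0 < lam) (he : 0 < eta) {f : α → ℝ}
    {ν p₀ p : PMF α} (h0 : SqInt ν p₀)
    (hp : actorObjective lam eta f ν p₀ p ≤ actorObjective lam eta f ν p₀ ν) : SqInt ν p := by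
  refine SqInt.of_chiSq_ne_top fun h => ?_
  rw [SqInt.actorObjective_eq hl he h0 (SqInt.self ν), actorObjective, h,
    ENNReal.mul_top (by simpa using hl), top_add, EReal.coe_ennreal_top, EReal.coe_add_top] at hp
  exact EReal.coe_ne_top _ (top_le_iff.1 hp)

/-- The mixture `(1 - θ) p + θ q`. -/
noncomputable def mix (θ : ℝ) (h0 : 0 ≤ θ) (h1 : θ ≤ 1) (p q : PMF α) : PMF α :=
  ⟨fun a => ENNReal.ofReal (1 - θ) * p a + ENNReal.ofReal θ * q a, by
    have : ∑' a, (ENNReal.ofReal (1 - θ) * p a + ENNReal.ofReal θ * q a) = 1 := by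
      rw [ENNReal.tsum_add, ENNReal.tsum_mul_left, ENNReal.tsum_mul_left, p.tsum_coe, q.tsum_coe,
        mul_one, mul_one, ← ENNReal.ofReal_add (by linarith) h0]
      simp
    exact this ▸ ENNReal.summable.hasSum⟩

theorem mix_toReal {θ : ℝ} (h0 : 0 ≤ θ) (h1 : θ ≤ 1) (p q : PMF α) (a : α) :
    (mix θ h0 h1 p q a).toReal = (1 - θ) * (p a).toReal + θ * (q a).toReal := by
  change (ENNReal.ofReal (1 - θ) * p a + ENNReal.ofReal θ * q a).toReal = _
  rw [ENNReal.toReal_add (ENNReal.mul_ne_top ENNReal.ofReal_ne_top (p.apply_ne_top a))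
    (ENNReal.mul_ne_top ENNReal.ofReal_ne_top (q.apply_ne_top a)), ENNReal.toReal_mul,
    ENNReal.toReal_mul, ENNReal.toReal_ofReal (by linarith), ENNReal.toReal_ofReal h0]

theorem SqInt.mix {ν p q : PMF α} (hp : SqInt ν p) (hq : SqInt ν q) {θ : ℝ} (h0 : 0 ≤ θ)
    (h1 : θ ≤ 1) : SqInt ν (mix θ h0 h1 p q) := by
  refine ⟨fun a ha => ?_, ?_⟩
  · change ENNReal.ofReal (1 - θ) * p a + ENNReal.ofReal θ * q a = 0
    rw [hp.1 a ha, hq.1 a ha]; simp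
  · refine Summable.of_nonneg_of_le (fun a => div_nonneg (sq_nonneg _) ENNReal.toReal_nonneg)
      (fun a => ?_) (hp.2.add hq.2)
    rw [← add_div]
    refine div_le_div_of_nonneg_right ?_ ENNReal.toReal_nonneg
    rw [mix_toReal]
    set u := (p a).toReal
    set v := (q a).toReal
    nlinarith [mul_nonneg (mul_nonneg h0 (sub_nonneg.2 h1)) (sq_nonneg (u - v)),
      mul_nonneg h0 (sq_nonneg u), mul_nonneg (sub_nonneg.2 h1) (sq_nonneg v)]

/-- The exact convexity defect of a quadratic form, and hence the source of the strong convexity of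
the actor objective. -/
theorem sqDist_mix {ν p q z : PMF α} (hp : SqInt ν p) (hq : SqInt ν q) (hz : SqInt ν z) {θ : ℝ}
    (h0 : 0 ≤ θ) (h1 : θ ≤ 1) :
    sqDist ν (mix θ h0 h1 p q) z =
      (1 - θ) * sqDist ν p z + θ * sqDist ν q z - θ * (1 - θ) * sqDist ν q p := by
  have := ((((hp.summable hz).hasSum.mul_left (1 - θ)).add
    ((hq.summable hz).hasSum.mul_left θ)).sub ((hq.summable hp).hasSum.mul_left (θ * (1 - θ)))).tsum_eq
  rw [sqDist, sqDist, sqDist, sqDist, ← this]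
  refine tsum_congr fun a => ?_
  rw [mix_toReal]
  ring

theorem expect_mix (p q : PMF α) {f : α → ℝ} {B : ℝ} (hf : ∀ a, |f a| ≤ B) {θ : ℝ}
    (h0 : 0 ≤ θ) (h1 : θ ≤ 1) :
    (mix θ h0 h1 p q).expect f = (1 - θ) * p.expect f + θ * q.expect f := by
  have := (((p.summable_mul_of_bdd fun a _ => hf a).hasSum.mul_left (1 - θ)).add
    ((q.summable_mul_of_bdd fun a _ => hf a).hasSum.mul_left θ)).tsum_eq
  rw [expect, expect, expect, ← this]
  refine tsum_congr fun a => ?_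
  rw [mix_toReal]
  ring

/-- The three-point inequality for a minimizer of the actor objective. -/
theorem actorReal_three_point {lam eta : ℝ} (hl : 0 < lam) (he : 0 < eta) {f : α → ℝ} {B : ℝ}
    (hf : ∀ a, |f a| ≤ B) {ν p₀ p q : PMF α} (h0 : SqInt ν p₀) (hp : SqInt ν p) (hq : SqInt ν q)
    (hmin : ∀ x, actorObjective lam eta f ν p₀ p ≤ actorObjective lam eta f ν p₀ x) :
    actorReal lam eta f ν p₀ p + (lam + 1 / eta) * sqDist ν q p ≤ actorReal lam eta f ν p₀ q := by
  -- The minimizer is compared with `(1 - θ) p + θ q`, and the result is divided by `θ`.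
  have key : ∀ θ : ℝ, 0 < θ → θ < 1 → (1 - θ) * ((lam + 1 / eta) * sqDist ν q p) ≤
      actorReal lam eta f ν p₀ q - actorReal lam eta f ν p₀ p := by
    intro θ t0 t1
    have h := hmin (PMF.mix θ t0.le t1.le p q)
    rw [SqInt.actorObjective_eq hl he h0 hp,
      SqInt.actorObjective_eq hl he h0 (hp.mix hq t0.le t1.le), EReal.coe_le_coe_iff] at h
    have e : actorReal lam eta f ν p₀ (PMF.mix θ t0.le t1.le p q) =
        (1 - θ) * actorReal lam eta f ν p₀ p + θ * actorReal lam eta f ν p₀ q -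
          θ * ((1 - θ) * ((lam + 1 / eta) * sqDist ν q p)) := by
      simp only [actorReal, sqDist_mix hp hq (SqInt.self ν), sqDist_mix hp hq h0,
        expect_mix p q hf]
      ring
    rw [e] at h
    have : θ * ((1 - θ) * ((lam + 1 / eta) * sqDist ν q p)) ≤
        θ * (actorReal lam eta f ν p₀ q - actorReal lam eta f ν p₀ p) := by linarith
    exact le_of_mul_le_mul_left this t0
  set X := actorReal lam eta f ν p₀ q - actorReal lam eta f ν p₀ p
  set Y := (lam + 1 / eta) * sqDist ν q p
  have hY : 0 ≤ Y := mul_nonneg (by positivity) (sqDist_nonneg _ _ _)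
  suffices Y ≤ X by simp only [X] at this; linarith
  by_contra! hlt
  have hX : 0 ≤ X := by have := key (1 / 2) (by norm_num) (by norm_num); linarith
  have hYpos : 0 < Y := lt_of_le_of_lt hX hlt
  -- In place of the limit `θ → 0`: for this `θ`, `(1 - θ) Y = (X + Y) / 2`, which exceeds `X` when
  -- `X < Y`.
  have h2 : (Y - X) / (2 * Y) < 1 := by rw [div_lt_one (by positivity)]; linarith
  have := key ((Y - X) / (2 * Y)) (div_pos (by linarith) (by positivity)) h2
  have e : (1 - (Y - X) / (2 * Y)) * Y = (X + Y) / 2 := by field_simp; ring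
  linarith

/-- Move the mass of `p` at `a₀` to `ν`. -/
noncomputable def redistribute [DecidableEq α] (p ν : PMF α) (a₀ : α) : PMF α :=
  p.bind fun a => if a = a₀ then ν else pure a

theorem redistribute_toReal [DecidableEq α] (p ν : PMF α) (a₀ a : α) :
    (redistribute p ν a₀ a).toReal =
      (p a).toReal + (p a₀).toReal * ((ν a).toReal - if a = a₀ then 1 else 0) := by
  have h : redistribute p ν a₀ a = p a₀ * ν a + if a = a₀ then 0 else p a := by
    rw [redistribute, bind_apply, ENNReal.tsum_eq_add_tsum_ite a₀, if_pos rfl]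
    congr 1
    rw [tsum_eq_single a]
    · by_cases ha : a = a₀
      · simp [ha]
      · simp [ha, pure_apply]
    · intro b hb
      by_cases hb' : b = a₀
      · simp [hb']
      · simp [hb', pure_apply, hb.symm]
  rw [h, ENNReal.toReal_add (ENNReal.mul_ne_top (p.apply_ne_top _) (ν.apply_ne_top _))
    (by split_ifs; exacts [ENNReal.zero_ne_top, p.apply_ne_top a]), ENNReal.toReal_mul]
  split_ifs with ha
  · subst ha; simp; ring
  · ring

theorem SqInt.redistribute [DecidableEq α] {ν p : PMF α} (hp : SqInt ν p) (a₀ : α) :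
    SqInt ν (redistribute p ν a₀) := by
  have hle : ∀ a, (PMF.redistribute p ν a₀ a).toReal ≤ (p a).toReal + (ν a).toReal := by
    intro a
    rw [redistribute_toReal, mul_sub]
    have h1 : (p a₀).toReal * (ν a).toReal ≤ 1 * (ν a).toReal :=
      mul_le_mul_of_nonneg_right (toReal_le_one _ _) ENNReal.toReal_nonneg
    have h2 : 0 ≤ (p a₀).toReal * if a = a₀ then (1 : ℝ) else 0 :=
      mul_nonneg ENNReal.toReal_nonneg (by split_ifs <;> norm_num)
    linarith
  refine ⟨fun a ha => ?_, ?_⟩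
  · have := hle a
    rw [ha, hp.1 a ha, ENNReal.toReal_zero, add_zero] at this
    exact ((ENNReal.toReal_eq_zero_iff _).1 (le_antisymm this ENNReal.toReal_nonneg)).resolve_right
      (PMF.apply_ne_top _ a)
  · refine Summable.of_nonneg_of_le (fun a => div_nonneg (sq_nonneg _) ENNReal.toReal_nonneg)
      (fun a => ?_) ((hp.2.mul_left 2).add ((SqInt.self ν).2.mul_left 2))
    rw [← mul_div_assoc, ← mul_div_assoc, ← add_div]
    refine div_le_div_of_nonneg_right ?_ ENNReal.toReal_nonneg
    have := pow_le_pow_left₀ ENNReal.toReal_nonneg (hle a) 2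
    nlinarith [sq_nonneg ((p a).toReal - (ν a).toReal)]

/-- The displacement is `p a₀` times `ν` minus the point mass at `a₀`. Paired with `(p - z) / ν`,
its `ν` part gives the total mass of `p - z`, which is zero, so the cross term sees only `a₀`. -/
theorem sqDist_redistribute [DecidableEq α] {ν p z : PMF α} (hp : SqInt ν p) (hz : SqInt ν z)
    (a₀ : α) :
    sqDist ν (redistribute p ν a₀) z = sqDist ν p z + sqDist ν (redistribute p ν a₀) p -
      2 * (p a₀).toReal * (((p a₀).toReal - (z a₀).toReal) / (ν a₀).toReal) := by
  have h1 : HasSum (fun a => (p a).toReal - (z a).toReal) 0 := by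
    have := p.summable_toReal.hasSum.sub z.summable_toReal.hasSum
    rwa [tsum_toReal, tsum_toReal, sub_self] at this
  have h2 : HasSum (fun a => if a = a₀ then ((p a₀).toReal - (z a₀).toReal) / (ν a₀).toReal else 0)
      (((p a₀).toReal - (z a₀).toReal) / (ν a₀).toReal) := hasSum_ite_eq _ _
  have h3 := (((hp.summable hz).hasSum.add ((hp.redistribute a₀).summable hp).hasSum).add
    ((h1.sub h2).mul_left (2 * (p a₀).toReal))).tsum_eq
  rw [zero_sub, mul_neg, ← sub_eq_add_neg] at h3
  rw [sqDist, sqDist, sqDist, ← h3]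
  refine tsum_congr fun a => ?_
  rw [redistribute_toReal]
  by_cases h0 : (ν a).toReal = 0
  · have h0' : ν a = 0 := ((ENNReal.toReal_eq_zero_iff _).1 h0).resolve_right (ν.apply_ne_top a)
    have hpa : (p a).toReal = 0 := by rw [hp.1 a h0', ENNReal.toReal_zero]
    have hza : (z a).toReal = 0 := by rw [hz.1 a h0', ENNReal.toReal_zero]
    rw [h0, hpa, hza]
    split_ifs with ha
    · subst ha; simp [h0, hpa, hza]
    · simp
  · split_ifs with ha
    · subst ha; field_simp; ring
    · field_simp; ring

theorem expect_redistribute [DecidableEq α] (p ν : PMF α) (a₀ : α) {f : α → ℝ} {B : ℝ}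
    (hf : ∀ a, |f a| ≤ B) :
    (redistribute p ν a₀).expect f = p.expect f + (p a₀).toReal * (ν.expect f - f a₀) := by
  have h2 : HasSum (fun a => if a = a₀ then f a₀ else 0) (f a₀) := hasSum_ite_eq _ _
  have := ((p.summable_mul_of_bdd fun a _ => hf a).hasSum.add
    (((ν.summable_mul_of_bdd fun a _ => hf a).hasSum.sub h2).mul_left (p a₀).toReal)).tsum_eq
  rw [expect, expect, expect, ← this]
  refine tsum_congr fun a => ?_
  rw [redistribute_toReal]
  split_ifs with ha
  · subst ha; ring
  · ring

/-- A density bound that is stable under the actor update. -/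
theorem actor_density_le {lam eta : ℝ} (hl : 0 < lam) (he : 0 < eta) {f : α → ℝ} {B : ℝ}
    (f0 : ∀ a, 0 ≤ f a) (hf : ∀ a, f a ≤ B) {ν p₀ p : PMF α}
    (h0 : ∀ a, (p₀ a).toReal ≤ (1 + B / (2 * lam)) * (ν a).toReal)
    (hmin : ∀ x, actorObjective lam eta f ν p₀ p ≤ actorObjective lam eta f ν p₀ x) (a : α) :
    (p a).toReal ≤ (1 + B / (2 * lam)) * (ν a).toReal := by
  classical
  have hf' : ∀ a, |f a| ≤ B := fun a => by rw [abs_of_nonneg (f0 a)]; exact hf a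
  have hB : 0 ≤ B := (f0 a).trans (hf a)
  have h0' : SqInt ν p₀ := SqInt.of_le_mul h0
  have hp : SqInt ν p := SqInt.of_isMinimizer hl he h0' (hmin ν)
  by_cases hpa : p a = 0
  · rw [hpa, ENNReal.toReal_zero]; positivity
  have hνa : ν a ≠ 0 := fun h => hpa (hp.1 a h)
  have hν : 0 < (ν a).toReal := ENNReal.toReal_pos hνa (ν.apply_ne_top a)
  have hpp : 0 < (p a).toReal := ENNReal.toReal_pos hpa (p.apply_ne_top a)
  -- The quadratic terms of the three-point inequality cancel exactly against those of
  -- `sqDist_redistribute`. What is left is the first-order condition at `a`, with the mean under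
  -- `ν` in the role of the multiplier.
  have h := actorReal_three_point hl he hf' h0' hp (hp.redistribute a) hmin
  rw [actorReal, actorReal, expect_redistribute p ν a hf', sqDist_redistribute hp (SqInt.self ν),
    sqDist_redistribute hp h0'] at h
  set u := (p a).toReal
  set v := (ν a).toReal
  set w := (p₀ a).toReal
  have hE : 0 ≤ ν.expect f := ν.expect_nonneg fun a _ => f0 a
  have h1 : 0 ≤ u * (f a - ν.expect f - 2 * lam * ((u - v) / v) - 2 * (1 / eta) * ((u - w) / v)) := by
    linarith
  have h2 := nonneg_of_mul_nonneg_right h1 hpp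
  have h3 : 2 * lam * ((u - v) / v) + 2 * (1 / eta) * ((u - w) / v) ≤ B := by
    linarith [hf a]
  have h4 : w / v ≤ 1 + B / (2 * lam) := by rw [div_le_iff₀ hν]; exact h0 a
  rw [← div_le_iff₀ hν]
  rw [sub_div, sub_div, div_self hν.ne'] at h3
  set W := 1 + B / (2 * lam) with hW
  -- The bound `W` is the fixed point of the first-order condition: if the new density exceeded `W`
  -- while the old one does not, the proximal term would be nonnegative and the `χ²` term alone
  -- would exceed `B`.
  have h5 : 2 * lam * W = 2 * lam + B := by rw [hW]; field_simp
  have he' : 0 < 1 / eta := by positivity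
  by_contra! hlt
  have h6 : 2 * lam * W < 2 * lam * (u / v) := mul_lt_mul_of_pos_left hlt (by positivity)
  have h7 : 0 ≤ 2 * (1 / eta) * (u / v - w / v) := mul_nonneg (by positivity) (by linarith)
  linarith

/-- One step of the regret analysis. -/
theorem actor_regret_step {lam eta : ℝ} (hl : 0 < lam) (he : 0 < eta) {f : α → ℝ} {B : ℝ}
    (hf : ∀ a, |f a| ≤ B) {ν p₀ p q : PMF α} (h0 : SqInt ν p₀) (hq : SqInt ν q)
    (hmin : ∀ x, actorObjective lam eta f ν p₀ p ≤ actorObjective lam eta f ν p₀ x) :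
    q.expect f - p₀.expect f ≤ lam * sqDist ν q ν + eta * B ^ 2 / 4 +
      1 / eta * (sqDist ν q p₀ - sqDist ν q p) := by
  have hp : SqInt ν p := SqInt.of_isMinimizer hl he h0 (hmin ν)
  have h := actorReal_three_point hl he hf h0 hp hq hmin
  have h1 : p.expect f - p₀.expect f ≤ eta * B ^ 2 / 4 + 1 / eta * sqDist ν p p₀ := by
    rw [expect, expect, ← (p.summable_mul_of_bdd fun a _ => hf a).tsum_sub
      (p₀.summable_mul_of_bdd fun a _ => hf a)]
    have hs := (ν.summable_toReal.hasSum.mul_left (eta * B ^ 2 / 4)).add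
      ((hp.summable h0).hasSum.mul_left (1 / eta))
    rw [tsum_toReal, mul_one] at hs
    change _ ≤ eta * B ^ 2 / 4 + 1 / eta * ∑' a, _
    rw [← hs.tsum_eq]
    refine Summable.tsum_le_tsum (fun a => ?_) ((p.summable_mul_of_bdd fun a _ => hf a).sub
      (p₀.summable_mul_of_bdd fun a _ => hf a)) hs.summable
    rcases (ENNReal.toReal_nonneg (a := ν a)).eq_or_lt with hz | hz
    · have hz' : ν a = 0 :=
        ((ENNReal.toReal_eq_zero_iff _).1 hz.symm).resolve_right (ν.apply_ne_top a)
      rw [hp.1 a hz', h0.1 a hz', hz']; simp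
    · set v := (ν a).toReal
      set d := (p a).toReal - (p₀ a).toReal with hd
      have hfa : f a ^ 2 ≤ B ^ 2 := by
        rw [← sq_abs]; exact pow_le_pow_left₀ (abs_nonneg _) (hf a) 2
      have e1 : (p a).toReal * f a - (p₀ a).toReal * f a = d * f a := by rw [hd]; ring
      -- Young's inequality weighted by `ν a`, arranged so that the second term is the proximal term
      -- of the objective.
      have e2 : d * f a ≤ eta * f a ^ 2 / 4 * v + 1 / eta * (d ^ 2 / v) := by
        have : eta * f a ^ 2 / 4 * v + 1 / eta * (d ^ 2 / v) - d * f a =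
            (eta * f a * v - 2 * d) ^ 2 / (4 * eta * v) := by field_simp; ring
        have h4 : 0 ≤ (eta * f a * v - 2 * d) ^ 2 / (4 * eta * v) := by positivity
        linarith
      have e3 : eta * f a ^ 2 / 4 * v ≤ eta * B ^ 2 / 4 * v := by gcongr
      linarith
  rw [actorReal, actorReal] at h
  have h2 : 0 ≤ lam * sqDist ν p ν := mul_nonneg hl.le (sqDist_nonneg _ _ _)
  have h3 : 0 ≤ lam * sqDist ν q p := mul_nonneg hl.le (sqDist_nonneg _ _ _)
  linarith

/-- The regret of the regularized actor updates. -/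
theorem actor_regret {lam eta : ℝ} (hl : 0 < lam) (he : 0 < eta) {B : ℝ} (hB : 0 ≤ B) {T : ℕ}
    {f : ℕ → α → ℝ} (hf : ∀ t < T, ∀ a, f t a ∈ Set.Icc 0 B) {ν q : PMF α} {p : ℕ → PMF α}
    (hp0 : p 0 = ν) (hq : SqInt ν q)
    (hmin : ∀ t < T, ∀ x, actorObjective lam eta (f t) ν (p t) (p (t + 1)) ≤
      actorObjective lam eta (f t) ν (p t) x) :
    (∀ t ≤ T, ∀ a, (p t a).toReal ≤ (1 + B / (2 * lam)) * (ν a).toReal) ∧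
    ∑ t ∈ Finset.range T, (q.expect (f t) - (p t).expect (f t)) ≤
      T * (lam * sqDist ν q ν + eta * B ^ 2 / 4) + 1 / eta * sqDist ν q ν := by
  have hd : ∀ t ≤ T, ∀ a, (p t a).toReal ≤ (1 + B / (2 * lam)) * (ν a).toReal := by
    intro t
    induction t with
    | zero =>
      intro _ a
      rw [hp0]
      have : 0 ≤ B / (2 * lam) := by positivity
      nlinarith [ENNReal.toReal_nonneg (a := ν a)]
    | succ t ih =>
      intro ht
      exact actor_density_le hl he (fun a => (hf t ht a).1) (fun a => (hf t ht a).2)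
        (ih (Nat.le_of_succ_le ht)) (hmin t ht)
  refine ⟨hd, ?_⟩
  -- The distances to the comparator telescope, starting from its `χ²`-divergence since the first
  -- iterate is `ν`. The density bound supplies the square integrability needed at each step.
  have key : ∀ n ≤ T, ∑ t ∈ Finset.range n, (q.expect (f t) - (p t).expect (f t)) ≤
      n * (lam * sqDist ν q ν + eta * B ^ 2 / 4) +
        1 / eta * (sqDist ν q ν - sqDist ν q (p n)) := by
    intro n
    induction n with
    | zero => simp [hp0]
    | succ n ih =>
      intro hn
      rw [Finset.sum_range_succ]
      have h1 := ih (Nat.le_of_succ_le hn)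
      have h2 := actor_regret_step hl he (fun a => by
        rw [abs_of_nonneg (hf n hn a).1]; exact (hf n hn a).2)
        (SqInt.of_le_mul (hd n (Nat.le_of_succ_le hn))) hq (hmin n hn)
      push_cast
      linarith
  refine (key T le_rfl).trans ?_
  have : 0 ≤ 1 / eta * sqDist ν q (p T) := mul_nonneg (by positivity) (sqDist_nonneg _ _ _)
  linarith

end PMF

/-! ### Low interaction rank and change of product measure. -/

section InteractionRank

variable {ι : Type*} [Fintype ι] {Y : ι → Type*}

/-- `F` is a sum of functions of fewer than `K` coordinates. -/
def RankLT (K : ℕ) (F : (∀ j, Y j) → ℝ) : Prop :=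
  ∃ g : (J : Finset ι) → (∀ j : J, Y j) → ℝ, ∀ y,
    F y = ∑ J : Finset ι with J.card < K, g J (fun j => y j)

theorem HasInteractionRank.rankLT {X : Type*} {K : ℕ} {f : X → (∀ j, Y j) → ℝ}
    (h : HasInteractionRank K f) (x : X) : RankLT K (f x) := by
  obtain ⟨g, hg⟩ := h
  exact ⟨fun J => g J x, hg x⟩

theorem RankLT.sub {K : ℕ} {F G : (∀ j, Y j) → ℝ} (hF : RankLT K F) (hG : RankLT K G) :
    RankLT K fun y => F y - G y := by
  obtain ⟨f, hf⟩ := hF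
  obtain ⟨g, hg⟩ := hG
  exact ⟨fun J y => f J y - g J y, fun y => by
    simp only [hf, hg, Finset.sum_sub_distrib]⟩

theorem RankLT.eq_of_one {F : (∀ j, Y j) → ℝ} (hF : RankLT 1 F) (y z : ∀ j, Y j) : F y = F z := by
  obtain ⟨f, hf⟩ := hF
  rw [hf, hf]
  refine Finset.sum_congr rfl fun J hJ => ?_
  have : J = ∅ := by simpa using hJ
  subst this
  congr 1
  funext j
  exact absurd j.2 (Finset.notMem_empty _)

variable [DecidableEq ι]

/-- Mixed differences of order at least `K` vanish. -/
theorem RankLT.sum_powerset_eq_zero {K : ℕ} {F : (∀ j, Y j) → ℝ} (hF : RankLT K F)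
    {J : Finset ι} (hJ : K ≤ J.card) (y z : ∀ j, Y j) :
    ∑ I ∈ J.powerset, (-1 : ℝ) ^ I.card * F (fun j => if j ∈ I then z j else y j) = 0 := by
  obtain ⟨g, hg⟩ := hF
  simp only [hg, Finset.mul_sum]
  rw [Finset.sum_comm]
  refine Finset.sum_eq_zero fun L hL => ?_
  have hL' : L.card < K := by simpa using hL
  -- The summand indexed by `L` ignores the coordinate `k`, so the terms for `I` and `insert k I`
  -- cancel.
  obtain ⟨k, hkJ, hkL⟩ := Finset.exists_mem_notMem_of_card_lt_card (hL'.trans_le hJ)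
  rw [← Finset.insert_erase hkJ, Finset.sum_powerset_insert (Finset.notMem_erase k J),
    ← Finset.sum_add_distrib]
  refine Finset.sum_eq_zero fun I hI => ?_
  have hk : k ∉ I := fun h => Finset.notMem_erase k J (Finset.mem_powerset.1 hI h)
  have : (fun j : L => if (j : ι) ∈ insert k I then z j else y j) =
      fun j : L => if (j : ι) ∈ I then z j else y j := by
    funext j
    have : (j : ι) ≠ k := fun h => hkL (h ▸ j.2)
    simp [this]
  rw [this, Finset.card_insert_of_notMem hk, pow_succ]
  ring

/-- A set with fewer than `K` elements can be listed in `K - 1` slots, unused slots being filled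
with `none`. -/
theorem card_filter_card_lt_le {K : ℕ} :
    (Finset.univ.filter fun J : Finset ι => J.card < K).card ≤ (Fintype.card ι + 1) ^ (K - 1) := by
  have h := Finset.card_le_card_of_surjOn (s := (Finset.univ : Finset (Fin (K - 1) → Option ι)))
    (t := Finset.univ.filter fun J : Finset ι => J.card < K)
    (fun φ => Finset.eraseNone (Finset.univ.image φ)) ?_
  · simpa using h
  · intro J hJ
    have hJ' : J.card < K := by simpa using hJ
    refine ⟨fun i => if h : (i : ℕ) < J.card then some (J.equivFin.symm ⟨i, h⟩ : ι) else none,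
      by simp, ?_⟩
    ext a
    simp only [Finset.mem_eraseNone, Finset.mem_image, Finset.mem_univ, true_and]
    constructor
    · rintro ⟨i, hi⟩
      split_ifs at hi with h
      · have := (J.equivFin.symm ⟨i, h⟩).2
        rwa [Option.some_inj.1 hi] at this
    · intro ha
      have hlt := (J.equivFin ⟨a, ha⟩).2
      refine ⟨⟨J.equivFin ⟨a, ha⟩, by omega⟩, ?_⟩
      simp

namespace PMF

/-- Freeze the coordinates in `I ⊆ J` of the argument of `F` at a point `z`. If `I` contains some
`k`, the integrand depends on `y k` only through the centered factor `w k`, so its mean is zero. The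
alternating sum over all `I` vanishes because `F` has no interaction of order `K` or more; hence the
remaining term `I = ∅` vanishes as well. -/
theorem expect_prod_mul_eq_zero (m : ∀ j, PMF (Y j)) {w : ∀ j, Y j → ℝ} {B b : ℝ} (hB : 1 ≤ B)
    (hw : ∀ j a, |w j a| ≤ B) (hm : ∀ j, (m j).expect (w j) = 0) {K : ℕ} {F : (∀ j, Y j) → ℝ}
    (hb : ∀ y, |F y| ≤ b) (hF : RankLT K F) {J : Finset ι} (hJ : K ≤ J.card) :
    ((indep m).expect fun y => (∏ j ∈ J, w j (y j)) * F y) = 0 := by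
  obtain ⟨z, -⟩ := (indep m).support_nonempty
  have hP : ∀ (I : Finset ι) (y : ∀ j, Y j), |∏ j ∈ I, w j (y j)| ≤ B ^ I.card := fun I y => by
    rw [Finset.abs_prod, ← Finset.prod_const]
    exact Finset.prod_le_prod (fun j _ => abs_nonneg _) fun j _ => hw j _
  have hPF : ∀ (I : Finset ι) (y y' : ∀ j, Y j), |(∏ j ∈ I, w j (y j)) * F y'| ≤ B ^ I.card * b :=
    fun I y y' => by
      rw [abs_mul]
      exact mul_le_mul (hP I y) (hb y') (abs_nonneg _) (by positivity)
  let T : Finset ι → (∀ j, Y j) → ℝ := fun I y =>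
    (∏ j ∈ J, w j (y j)) * F (fun j => if j ∈ I then z j else y j)
  have hT : ∀ I, I ≠ ∅ → I ⊆ J → (indep m).expect (T I) = 0 := by
    intro I hI hIJ
    obtain ⟨k, hk⟩ := Finset.nonempty_iff_ne_empty.2 hI
    rw [expect_indep_resample m k (f := T I) fun y => hPF J y _]
    rw [← (indep m).expect_const 0]
    refine expect_congr _ fun x _ => ?_
    have : ∀ a, T I (Function.update x k a) =
        w k a * ((∏ j ∈ J.erase k, w j (x j)) * F (fun j => if j ∈ I then z j else x j)) := by
      intro a
      simp only [T]
      rw [← Finset.mul_prod_erase _ _ (hIJ hk), Function.update_self, mul_assoc]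
      congr 2
      · refine Finset.prod_congr rfl fun j hj => ?_
        rw [Function.update_of_ne (Finset.ne_of_mem_erase hj)]
      · congr 1
        funext j
        by_cases hj : j ∈ I
        · simp [hj]
        · have : j ≠ k := fun h => hj (h ▸ hk)
          simp [hj, Function.update_of_ne this]
    simp only [this, expect_mul_const, hm, zero_mul]
  have h1 : ∑ I ∈ J.powerset, (-1 : ℝ) ^ I.card * (indep m).expect (T I) = 0 := by
    simp only [← expect_const_mul]
    rw [← expect_sum (indep m) J.powerset (f := fun I y => (-1 : ℝ) ^ I.card * T I y)
      (B := fun _ => B ^ J.card * b) (fun I _ y _ => by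
        rw [abs_mul, abs_pow, abs_neg, abs_one, one_pow, one_mul]; exact hPF J y _)]
    rw [← (indep m).expect_const 0]
    refine expect_congr _ fun y _ => ?_
    have := hF.sum_powerset_eq_zero hJ y z
    calc _ = (∏ j ∈ J, w j (y j)) * ∑ I ∈ J.powerset,
          (-1 : ℝ) ^ I.card * F (fun j => if j ∈ I then z j else y j) := by
          rw [Finset.mul_sum]
          exact Finset.sum_congr rfl fun I _ => by simp only [T]; ring
      _ = 0 := by rw [this, mul_zero]
  rw [Finset.sum_eq_single ∅ (fun I hI hne => by
    rw [hT I hne (Finset.mem_powerset.1 hI), mul_zero]) (by simp)] at h1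
  simpa [T] using h1

/-- Change of measure, from `∏ m j` to `∏ d j`, for functions of low interaction rank. -/
theorem expect_indep_sq_le_of_rankLT (d m : ∀ j, PMF (Y j)) {B b : ℝ} (hB : 1 ≤ B)
    (hd : ∀ j a, d j a ≤ ENNReal.ofReal B * m j a) {K : ℕ}
    {F : (∀ j, Y j) → ℝ} (hb : ∀ y, |F y| ≤ b) (hF : RankLT K F) :
    ((indep d).expect F) ^ 2 ≤ ((Fintype.card ι + 1 : ℝ) ^ (K - 1)) ^ 2 * B ^ (K - 1) *
      (indep m).expect fun y => F y ^ 2 := by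
  have hB0 : 0 ≤ B := by linarith
  have hdr : ∀ j a, (d j a).toReal ≤ B * (m j a).toReal := fun j a => by
    have := ENNReal.toReal_mono (ENNReal.mul_ne_top ENNReal.ofReal_ne_top ((m j).apply_ne_top a))
      (hd j a)
    rwa [ENNReal.toReal_mul, ENNReal.toReal_ofReal hB0] at this
  -- The centered density, so that `∏ d j = ∏ m j · ∏ (1 + w j)`; expanding gives one term for each
  -- set of agents.
  let w : ∀ j, Y j → ℝ := fun j a => (d j a).toReal / (m j a).toReal - 1
  have hD0 : ∀ j a, 0 ≤ (d j a).toReal / (m j a).toReal := fun j a =>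
    div_nonneg ENNReal.toReal_nonneg ENNReal.toReal_nonneg
  have hDB : ∀ j a, (d j a).toReal / (m j a).toReal ≤ B := fun j a =>
    div_le_of_le_mul₀ ENNReal.toReal_nonneg hB0 (hdr j a)
  have hmD : ∀ j a, (m j a).toReal * ((d j a).toReal / (m j a).toReal) = (d j a).toReal := by
    intro j a
    rcases eq_or_ne (m j a).toReal 0 with h | h
    · have := hdr j a
      rw [h, mul_zero] at this
      rw [h, le_antisymm this ENNReal.toReal_nonneg]; simp
    · exact mul_div_cancel₀ _ h
  have hw : ∀ j a, |w j a| ≤ B := fun j a => by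
    rw [abs_le]
    exact ⟨by simp only [w]; linarith [hD0 j a], by simp only [w]; linarith [hDB j a]⟩
  have hED : ∀ j, ((m j).expect fun a => (d j a).toReal / (m j a).toReal) = 1 := fun j => by
    simp only [expect, hmD, tsum_toReal]
  have hDb : ∀ j a, |(d j a).toReal / (m j a).toReal| ≤ B := fun j a => by
    rw [abs_of_nonneg (hD0 j a)]; exact hDB j a
  have hm0 : ∀ j, (m j).expect (w j) = 0 := fun j => by
    rw [expect_sub (m j) (fun a _ => hDb j a) (C := 1) (fun a _ => by simp), hED, expect_const,
      sub_self]
  -- A density `D ≤ B` satisfies `D² ≤ B D`, and `D` has mean one. Thus each factor costs `B` and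
  -- not `B²`.
  have hw2 : ∀ j, ((m j).expect fun a => w j a ^ 2) ≤ B := fun j => by
    have h1 : ∀ a, |w j a ^ 2| ≤ B ^ 2 := fun a => by
      rw [abs_pow]; exact pow_le_pow_left₀ (abs_nonneg _) (hw j a) 2
    have h2 : ∀ a, |(B - 2) * ((d j a).toReal / (m j a).toReal)| ≤ |B - 2| * B := fun a => by
      rw [abs_mul]; exact mul_le_mul_of_nonneg_left (hDb j a) (abs_nonneg _)
    calc _ ≤ (m j).expect fun a => (B - 2) * ((d j a).toReal / (m j a).toReal) + 1 := by
          refine expect_mono _ (fun a _ => h1 a) (C := |B - 2| * B + 1) (fun a _ =>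
            (abs_add_le _ _).trans (add_le_add (h2 a) (by simp))) fun a _ => ?_
          simp only [w]
          nlinarith [mul_nonneg (hD0 j a) (sub_nonneg.2 (hDB j a))]
      _ = (B - 2) + 1 := by
          rw [expect_add _ (fun a _ => h2 a) (C := 1) (fun a _ => by simp), expect_const_mul, hED,
            expect_const, mul_one]
      _ ≤ B := by linarith
  have hP : ∀ (I : Finset ι) (y : ∀ j, Y j), |∏ j ∈ I, w j (y j)| ≤ B ^ I.card := fun I y => by
    rw [Finset.abs_prod, ← Finset.prod_const]
    exact Finset.prod_le_prod (fun j _ => abs_nonneg _) fun j _ => hw j _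
  have hPF : ∀ (I : Finset ι) (y : ∀ j, Y j), |(∏ j ∈ I, w j (y j)) * F y| ≤ B ^ I.card * b :=
    fun I y => by
      rw [abs_mul]
      exact mul_le_mul (hP I y) (hb y) (abs_nonneg _) (by positivity)
  set S := (indep m).expect fun y => F y ^ 2
  have hS : 0 ≤ S := (indep m).expect_nonneg fun y _ => sq_nonneg _
  let t : Finset ι → ℝ := fun J => (indep m).expect fun y => (∏ j ∈ J, w j (y j)) * F y
  have e1 : (indep d).expect F = ∑ J : Finset ι with J.card < K, t J := by
    have : (indep d).expect F = (indep m).expect fun y => ∑ J, (∏ j ∈ J, w j (y j)) * F y := by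
      refine tsum_congr fun y => ?_
      dsimp only
      rw [← Finset.sum_mul, ← Finset.powerset_univ, ← Finset.prod_one_add, ← mul_assoc]
      congr 1
      rw [indep_apply, indep_apply, ENNReal.toReal_prod, ENNReal.toReal_prod,
        ← Finset.prod_mul_distrib]
      refine Finset.prod_congr rfl fun j _ => ?_
      simp only [w, add_sub_cancel, hmD]
    rw [this, expect_sum _ _ fun J _ y _ => hPF J y, Finset.sum_filter]
    refine Finset.sum_congr rfl fun J _ => ?_
    split_ifs with h
    · rfl
    · exact expect_prod_mul_eq_zero m hB hw hm0 hb hF (not_lt.1 h)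
  -- Cauchy–Schwarz against `F`; the second moment of the product of the `w j` factorizes by
  -- independence.
  have e2 : ∀ J : Finset ι, J.card < K → t J ^ 2 ≤ B ^ (K - 1) * S := by
    intro J hJ
    refine (expect_mul_sq_le (indep m) (fun y _ => hP J y) (fun y _ => hb y)).trans ?_
    refine mul_le_mul_of_nonneg_right ?_ hS
    have h1 := expect_indep_prod m (f := fun j a => if j ∈ J then w j a ^ 2 else 1) (B := B ^ 2)
      (fun j a => by split_ifs <;> positivity) (fun j a => by
        split_ifs
        · rw [abs_pow]; exact pow_le_pow_left₀ (abs_nonneg _) (hw j a) 2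
        · rw [abs_one]; exact one_le_pow₀ hB)
    have h2 : ∀ y : ∀ j, Y j, (∏ j ∈ J, w j (y j)) ^ 2 = ∏ j, if j ∈ J then w j (y j) ^ 2 else 1 := by
      intro y
      rw [Finset.prod_ite_mem, Finset.univ_inter, Finset.prod_pow]
    simp only [h2]
    rw [h1]
    have h3 : ∀ j, ((m j).expect fun a => if j ∈ J then w j a ^ 2 else 1) ≤ if j ∈ J then B else 1 := by
      intro j
      split_ifs
      · exact hw2 j
      · simp
    calc _ ≤ ∏ j, (if j ∈ J then B else 1) := Finset.prod_le_prod (fun j _ =>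
          expect_nonneg _ fun a _ => by split_ifs <;> positivity) fun j _ => h3 j
      _ = B ^ J.card := by rw [Finset.prod_ite_mem, Finset.univ_inter, Finset.prod_const]
      _ ≤ B ^ (K - 1) := pow_le_pow_right₀ hB (by omega)
  rw [e1]
  set A := Finset.univ.filter fun J : Finset ι => J.card < K
  have hA : (A.card : ℝ) ≤ (Fintype.card ι + 1 : ℝ) ^ (K - 1) := by
    exact_mod_cast card_filter_card_lt_le
  calc (∑ J ∈ A, t J) ^ 2 ≤ A.card * ∑ J ∈ A, t J ^ 2 := sq_sum_le_card_mul_sum_sq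
    _ ≤ A.card * ∑ J ∈ A, B ^ (K - 1) * S := by
        gcongr with J hJ
        exact e2 J (by simpa [A] using hJ)
    _ = A.card ^ 2 * (B ^ (K - 1) * S) := by rw [Finset.sum_const, nsmul_eq_mul]; ring
    _ ≤ _ := by
        rw [mul_assoc]
        gcongr

end PMF

end InteractionRank

/-! ### Hellinger distance and exponential moments. -/

namespace PMF

variable {α : Type*}

theorem lintegral_toMeasure [MeasurableSpace α] [DiscreteMeasurableSpace α] (p : PMF α)
    (F : α → ℝ≥0∞) : ∫⁻ a, F a ∂p.toMeasure = ∑' a, p a * F a := by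
  have h : p.toMeasure = Measure.sum fun a => p a • Measure.dirac a := by
    ext s hs
    rw [p.toMeasure_apply hs, Measure.sum_apply _ hs]
    refine tsum_congr fun a => ?_
    rw [Measure.smul_apply, Measure.dirac_apply' _ hs]
    by_cases ha : a ∈ s <;> simp [ha]
  rw [h, lintegral_sum_measure]
  refine tsum_congr fun a => ?_
  rw [lintegral_smul_measure, lintegral_dirac' _ Measurable.of_discrete, smul_eq_mul]

/-- The squared Hellinger distance. -/
noncomputable def hellinger (p q : PMF α) : ℝ :=
  1 / 2 * ∑' a, (√(p a).toReal - √(q a).toReal) ^ 2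

theorem hellinger_nonneg (p q : PMF α) : 0 ≤ hellinger p q :=
  mul_nonneg (by norm_num) (tsum_nonneg fun _ => sq_nonneg _)

@[simp] theorem hellinger_self (p : PMF α) : hellinger p p = 0 := by simp [hellinger]

theorem summable_sqrt_mul_sqrt (p q : PMF α) :
    Summable fun a => √(p a).toReal * √(q a).toReal := by
  refine Summable.of_nonneg_of_le (fun a => by positivity) (fun a => ?_)
    (p.summable_toReal.add q.summable_toReal)
  nlinarith [sq_nonneg (√(p a).toReal - √(q a).toReal), sq_nonneg (√(p a).toReal + √(q a).toReal),
    Real.sq_sqrt (ENNReal.toReal_nonneg (a := p a)), Real.sq_sqrt (ENNReal.toReal_nonneg (a := q a))]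

theorem hasSum_sqrt_sub_sq (p q : PMF α) :
    HasSum (fun a => (√(p a).toReal - √(q a).toReal) ^ 2)
      (2 - 2 * ∑' a, √(p a).toReal * √(q a).toReal) := by
  have h := (p.summable_toReal.hasSum.add q.summable_toReal.hasSum).sub
    ((summable_sqrt_mul_sqrt p q).hasSum.mul_left 2)
  rw [tsum_toReal, tsum_toReal, one_add_one_eq_two] at h
  have e : (fun a => (√(p a).toReal - √(q a).toReal) ^ 2) = fun a =>
      (p a).toReal + (q a).toReal - 2 * (√(p a).toReal * √(q a).toReal) := by
    funext a
    rw [sub_sq, Real.sq_sqrt ENNReal.toReal_nonneg, Real.sq_sqrt ENNReal.toReal_nonneg]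
    ring
  rw [e]
  exact h

theorem tsum_sqrt_mul_sqrt (p q : PMF α) :
    ∑' a, √(p a).toReal * √(q a).toReal = 1 - hellinger p q := by
  rw [hellinger, (hasSum_sqrt_sub_sq p q).tsum_eq]; ring

theorem hellinger_le_one (p q : PMF α) : hellinger p q ≤ 1 := by
  have : 0 ≤ ∑' a, √(p a).toReal * √(q a).toReal := tsum_nonneg fun _ => by positivity
  rw [tsum_sqrt_mul_sqrt] at this
  linarith

/-- Factor `|p - q| = |√p - √q| (√p + √q)` and apply Cauchy–Schwarz, as a discriminant: the squared
sums are `2 h` and `4 - 2 h ≤ 4`, where `h` is the Hellinger distance. -/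
theorem l1_sq_le_hellinger (p q : PMF α) : l1 p q ^ 2 ≤ 8 * hellinger p q := by
  have s1 := hasSum_sqrt_sub_sq p q
  have s3 := (p.summable_toReal.hasSum.add q.summable_toReal.hasSum).add
    ((summable_sqrt_mul_sqrt p q).hasSum.mul_left 2)
  rw [tsum_toReal, tsum_toReal, one_add_one_eq_two, tsum_sqrt_mul_sqrt] at s3
  have h1 : 2 - 2 * ∑' a, √(p a).toReal * √(q a).toReal = 2 * hellinger p q := by
    rw [tsum_sqrt_mul_sqrt]; ring
  rw [h1] at s1
  have key : ∀ x : ℝ, 0 ≤ 2 * hellinger p q * (x * x) + 2 * l1 p q * x +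
      (2 + 2 * (1 - hellinger p q)) := by
    intro x
    have s := ((s1.mul_right (x * x)).add (((summable_l1 p q).hasSum.mul_left 2).mul_right x)).add s3
    refine s.nonneg fun a => ?_
    set u := √(p a).toReal
    set v := √(q a).toReal
    have e1 : (p a).toReal = u ^ 2 := (Real.sq_sqrt ENNReal.toReal_nonneg).symm
    have e2 : (q a).toReal = v ^ 2 := (Real.sq_sqrt ENNReal.toReal_nonneg).symm
    have e3 : |u ^ 2 - v ^ 2| = |u - v| * (u + v) := by
      rw [sq_sub_sq, abs_mul, abs_of_nonneg (by positivity : 0 ≤ u + v), mul_comm]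
    rw [e1, e2, e3]
    have : (u - v) ^ 2 * (x * x) + 2 * (|u - v| * (u + v)) * x + (u ^ 2 + v ^ 2 + 2 * (u * v)) =
        (|u - v| * x + (u + v)) ^ 2 := by
      rw [← sq_abs (u - v)]; ring
    rw [this]
    positivity
  have := discrim_le_zero key
  rw [discrim] at this
  have h0 := hellinger_nonneg p q
  nlinarith

/-- The likelihood ratio has Hellinger affinity as its root mean. -/
theorem tsum_mul_sqrt_div_sqrt (p q : PMF α) :
    ∑' a, p a * ENNReal.ofReal (√(q a).toReal / √(p a).toReal) =
      ENNReal.ofReal (1 - hellinger p q) := by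
  rw [← tsum_sqrt_mul_sqrt, ENNReal.ofReal_tsum_of_nonneg (fun a => by positivity)
    (summable_sqrt_mul_sqrt p q)]
  refine tsum_congr fun a => ?_
  have hp : ENNReal.ofReal (p a).toReal = p a := ENNReal.ofReal_toReal (p.apply_ne_top a)
  calc _ = ENNReal.ofReal (p a).toReal * ENNReal.ofReal (√(q a).toReal / √(p a).toReal) := by
        rw [hp]
    _ = ENNReal.ofReal ((p a).toReal * (√(q a).toReal / √(p a).toReal)) :=
        (ENNReal.ofReal_mul ENNReal.toReal_nonneg).symm
    _ = _ := ?_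
  congr 1
  rcases (ENNReal.toReal_nonneg (a := p a)).eq_or_lt with h | h
  · simp [← h]
  · rw [← mul_div_assoc, div_eq_iff (Real.sqrt_pos.2 h).ne', mul_right_comm,
      Real.mul_self_sqrt h.le]

/-- Conditional moments are bounded in the form `1 - f` because this form averages exactly; only
afterwards is `1 - x ≤ exp (-x)` used. -/
theorem tsum_mul_ofReal_one_sub_le (p : PMF α) {f : α → ℝ} (h0 : ∀ a, 0 ≤ f a)
    (h1 : ∀ a, f a ≤ 1) :
    ∑' a, p a * ENNReal.ofReal (1 - f a) ≤ ENNReal.ofReal (Real.exp (-p.expect f)) := by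
  have hf : ∀ a, |f a| ≤ 1 := fun a => by rw [abs_of_nonneg (h0 a)]; exact h1 a
  rw [← p.ofReal_expect (B := 1) (fun a => sub_nonneg.2 (h1 a)) (fun a _ => by
    rw [abs_of_nonneg (sub_nonneg.2 (h1 a))]; linarith [h0 a]),
    p.expect_sub (B := 1) (fun a _ => by simp) (fun a _ => hf a), expect_const]
  exact ENNReal.ofReal_le_ofReal (by linarith [Real.add_one_le_exp (-p.expect f)])

end PMF

/-- Markov's inequality at level one for the product, whose mean factorizes by independence. -/
theorem chernoff_prod {Ω E : Type*} [MeasurableSpace Ω] [MeasurableSpace E] {μ : Measure Ω} {M : ℕ}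
    {D : Fin M → Ω → E} (hD : ∀ m, Measurable (D m)) (hi : iIndepFun D μ) {φ : E → ℝ≥0∞}
    (hφ : Measurable φ) {a : ℝ} (ha : ∀ m, ∫⁻ ω, φ (D m ω) ∂μ ≤ ENNReal.ofReal (Real.exp a)) :
    μ {ω | 1 ≤ ∏ m, φ (D m ω)} ≤ ENNReal.ofReal (Real.exp (M * a)) := by
  have h1 := lintegral_prod_eq_prod_lintegral_of_indepFun Finset.univ (fun m ω => φ (D m ω))
    (hi.comp (fun _ => φ) fun _ => hφ) fun m => hφ.comp (hD m)
  have h2 := mul_meas_ge_le_lintegral (μ := μ) (f := fun ω => ∏ m, φ (D m ω))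
    (Finset.measurable_prod _ fun m _ => hφ.comp (hD m)) 1
  rw [one_mul, h1] at h2
  refine h2.trans ((Finset.prod_le_prod' fun m _ => ha m).trans ?_)
  rw [Finset.prod_const, Finset.card_univ, Fintype.card_fin, Real.exp_nat_mul,
    ENNReal.ofReal_pow (Real.exp_nonneg _)]

/-- The exponential moment of the excess squared loss. -/
theorem lintegral_exp_neg_excess_le (Q : ProbabilityMeasure ℝ)
    (hQ : ∀ᵐ x ∂(Q : Measure ℝ), x ∈ Set.Icc (0 : ℝ) 1) {u : ℝ} (hu : u ∈ Set.Icc (0 : ℝ) 1) :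
    ∫⁻ y, ENNReal.ofReal (Real.exp (-((u - y) ^ 2 - (∫ x, x ∂(Q : Measure ℝ) - y) ^ 2)))
      ∂(Q : Measure ℝ) ≤ ENNReal.ofReal (1 - (u - ∫ x, x ∂(Q : Measure ℝ)) ^ 2 / 4) := by
  set v := ∫ x, x ∂(Q : Measure ℝ) with hv
  have hint : Integrable (fun x : ℝ => x) (Q : Measure ℝ) :=
    Integrable.of_mem_Icc 0 1 measurable_id.aemeasurable hQ
  have hv01 : v ∈ Set.Icc (0 : ℝ) 1 := by
    constructor
    · exact integral_nonneg_of_ae (hQ.mono fun x hx => hx.1)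
    · have := integral_mono_ae hint (integrable_const (1 : ℝ)) (hQ.mono fun x hx => hx.2)
      simpa using this
  have hsub := hasSubgaussianMGF_of_mem_Icc (μ := (Q : Measure ℝ)) (X := fun x => x)
    measurable_id.aemeasurable hQ
  -- With `d = u - v` the excess loss is `d² - 2 d (y - v)`. Hoeffding's lemma, with variance proxy
  -- `1/4` on `[0, 1]`, bounds the mean of `exp (2 d (y - v))` by `exp (d² / 2)`, leaving `exp (-d²
  -- / 2)` in total.
  have h1 := hsub.mgf_le (2 * (u - v))
  have h2 := hsub.integrable_exp_mul (2 * (u - v))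
  rw [mgf] at h1
  set d := u - v with hd
  have hd2 : d ^ 2 ≤ 1 := by
    rw [sq_le_one_iff_abs_le_one, abs_le]
    exact ⟨by linarith [hu.1, hv01.2], by linarith [hu.2, hv01.1]⟩
  have e : ∀ y, Real.exp (-((u - y) ^ 2 - (v - y) ^ 2)) =
      Real.exp (-d ^ 2) * Real.exp (2 * d * (y - v)) := fun y => by
    rw [← Real.exp_add]; congr 1; rw [hd]; ring
  simp only [e]
  rw [← ofReal_integral_eq_lintegral_ofReal (h2.const_mul _)
    (Filter.Eventually.of_forall fun y => by positivity), integral_const_mul]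
  refine ENNReal.ofReal_le_ofReal ?_
  have h3 : Real.exp (-d ^ 2) * ∫ y, Real.exp (2 * d * (y - v)) ∂(Q : Measure ℝ) ≤
      Real.exp (-d ^ 2) * Real.exp (d ^ 2 / 2) := by
    refine mul_le_mul_of_nonneg_left (h1.trans (le_of_eq ?_)) (Real.exp_nonneg _)
    congr 1
    simp
    ring
  refine h3.trans ?_
  rw [← Real.exp_add, show -d ^ 2 + d ^ 2 / 2 = -(d ^ 2 / 2) by ring, Real.exp_neg]
  have h4 := Real.add_one_le_exp (d ^ 2 / 2)
  calc (Real.exp (d ^ 2 / 2))⁻¹ ≤ (d ^ 2 / 2 + 1)⁻¹ := by gcongr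
    _ ≤ 1 - d ^ 2 / 4 := by
      rw [inv_le_iff_one_le_mul₀ (by positivity)]
      nlinarith [sq_nonneg d]

/-! ### Concentration for least squares and maximum likelihood. -/

section Data

variable {N : ℕ} {𝒞 : Type*} {S A : Fin N → Type*}

instance : DiscreteMeasurableSpace (Obs 𝒞 S A) := ⟨fun _ => trivial⟩

/-- The law of a local state-action pair in the data, given the context. -/
noncomputable def dataAct {𝒞 Si Ai : Type*} (σ : ℕ → 𝒞 → PMF Si) (ν : LocalPolicy 𝒞 Si Ai) (c : 𝒞)
    (h : ℕ) : PMF (Si × Ai) := PMF.joint (σ h c) (ν h c)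

theorem PMF.tsum_indep_eval_mul {ι : Type*} [Fintype ι] [DecidableEq ι] {X : ι → Type*}
    (p : ∀ i, PMF (X i)) (i : ι) (F : X i → ℝ≥0∞) :
    ∑' x, PMF.indep p x * F (x i) = ∑' a, p i a * F a := by
  conv_rhs => rw [← PMF.indep_map_eval p i, PMF.tsum_map_mul]

variable (G : DecoupledGame N 𝒞 S A) (σ : ∀ i, ℕ → 𝒞 → PMF (S i))
  (ν : ∀ i, LocalPolicy 𝒞 (S i) (A i))

/-- Given the context, the samples of different agents are independent, so the coordinates of the
others sum out. -/
theorem DecoupledGame.tsum_obsLaw_local (h : ℕ) (i : Fin N)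
    (F : 𝒞 → S i × A i → S i → ℝ≥0∞) :
    ∑' z, G.obsLaw σ ν h z * F z.ctx (z.state i, z.act i) (z.next i) =
      ∑' c, G.ρ c * ∑' x, dataAct (σ i) (ν i) c h x * ∑' s', G.P i h c x.1 x.2 s' * F c x s' := by
  rw [obsLaw, PMF.tsum_bind_mul]
  refine tsum_congr fun c => ?_
  rw [PMF.tsum_bind_mul, dataAct, PMF.tsum_joint_mul]
  congr 1
  simp only [PMF.tsum_bind_mul, PMF.tsum_map_mul]
  rw [← PMF.tsum_indep_eval_mul (fun i => σ i h c) i]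
  refine tsum_congr fun s => ?_
  rw [← PMF.tsum_indep_eval_mul (fun i => ν i h c (s i)) i]
  congr 1
  refine tsum_congr fun a => ?_
  rw [← PMF.tsum_indep_eval_mul (fun i => G.P i h c (s i) (a i)) i]

theorem DecoupledGame.tsum_obsLaw_joint (h : ℕ) (F : 𝒞 → (∀ j, S j) → (∀ j, A j) → ℝ≥0∞) :
    ∑' z, G.obsLaw σ ν h z * F z.ctx z.state z.act =
      ∑' c, G.ρ c * ∑' x, (PMF.indep fun j => dataAct (σ j) (ν j) c h) x *
        F c (fun j => (x j).1) (fun j => (x j).2) := by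
  rw [obsLaw, PMF.tsum_bind_mul]
  refine tsum_congr fun c => ?_
  simp only [dataAct, ← PMF.indep_joint]
  simp only [PMF.tsum_bind_mul, PMF.tsum_map_mul, ENNReal.tsum_mul_right, PMF.tsum_coe, one_mul]

/-- The mean squared error of the reward function `r` for agent `i` under the data distribution. -/
noncomputable def DecoupledGame.rewardErr (h : ℕ) (i : Fin N) (r : RewardFn 𝒞 S A) : ℝ :=
  G.ρ.expect fun c => (PMF.indep fun j => dataAct (σ j) (ν j) c h).expect fun x =>
    (r c (fun j => (x j).1) (fun j => (x j).2) -
      G.meanReward i h c (fun j => (x j).1) (fun j => (x j).2)) ^ 2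

/-- The mean squared Hellinger error of the model `P` for agent `i` under the data distribution. -/
noncomputable def DecoupledGame.hellingerErr (h : ℕ) (i : Fin N) (P : 𝒞 → S i → A i → PMF (S i)) :
    ℝ :=
  G.ρ.expect fun c => (dataAct (σ i) (ν i) c h).expect fun x =>
    PMF.hellinger (G.P i h c x.1 x.2) (P c x.1 x.2)

theorem DecoupledGame.meanReward_mem_Icc (i : Fin N) (h : ℕ) (c : 𝒞) (s : ∀ j, S j)
    (a : ∀ j, A j) : G.meanReward i h c s a ∈ Set.Icc (0 : ℝ) 1 := by
  have hQ := G.R_mem i h c s a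
  have hint : Integrable (fun x : ℝ => x) (G.R i h c s a : Measure ℝ) :=
    Integrable.of_mem_Icc 0 1 measurable_id.aemeasurable hQ
  constructor
  · exact integral_nonneg_of_ae (hQ.mono fun x hx => hx.1)
  · have := integral_mono_ae hint (integrable_const (1 : ℝ)) (hQ.mono fun x hx => hx.2)
    simpa [DecoupledGame.meanReward] using this

theorem sq_sub_le_one {u v : ℝ} (hu : u ∈ Set.Icc (0 : ℝ) 1) (hv : v ∈ Set.Icc (0 : ℝ) 1) :
    (u - v) ^ 2 ≤ 1 := by
  rw [sq_le_one_iff_abs_le_one, abs_le]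
  exact ⟨by linarith [hu.1, hv.2], by linarith [hu.2, hv.1]⟩

variable {G σ ν} {H M : ℕ} {Ω : Type*} [MeasurableSpace Ω] {μ : Measure Ω}
  {D : ℕ → Fin M → Ω → Sample 𝒞 S A}

/-- Chernoff's method for the excess loss over the true mean, with exponent parameter one; the
factor `1/4` comes from `lintegral_exp_neg_excess_le`. -/
theorem DecoupledGame.IsDataset.measure_sqLoss_le (hD : G.IsDataset H M σ ν μ D) {h : ℕ}
    (hh : h < H) (i : Fin N) (r : RewardFn 𝒞 S A)
    (hr : ∀ c s a, r c s a ∈ Set.Icc (0 : ℝ) 1) :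
    μ {ω | sqLoss (fun m => D h m ω) i r ≤ sqLoss (fun m => D h m ω) i (G.meanReward i h)} ≤
      ENNReal.ofReal (Real.exp (-(M * (G.rewardErr σ ν h i r / 4)))) := by
  let ψ : Obs 𝒞 S A × ℝ → ℝ≥0∞ := fun p => ENNReal.ofReal (Real.exp
    (-((r p.1.ctx p.1.state p.1.act - p.2) ^ 2 -
      (G.meanReward i h p.1.ctx p.1.state p.1.act - p.2) ^ 2)))
  have hψ : Measurable ψ := by
    have m1 : Measurable fun p : Obs 𝒞 S A × ℝ => r p.1.ctx p.1.state p.1.act :=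
      (Measurable.of_discrete (f := fun z : Obs 𝒞 S A => r z.ctx z.state z.act)).comp measurable_fst
    have m2 : Measurable fun p : Obs 𝒞 S A × ℝ => G.meanReward i h p.1.ctx p.1.state p.1.act :=
      (Measurable.of_discrete (f := fun z : Obs 𝒞 S A =>
        G.meanReward i h z.ctx z.state z.act)).comp measurable_fst
    exact ENNReal.measurable_ofReal.comp (Real.measurable_exp.comp
      (((m1.sub measurable_snd).pow_const 2).sub ((m2.sub measurable_snd).pow_const 2)).neg)
  let g : Sample 𝒞 S A → Obs 𝒞 S A × ℝ := fun x => (x.1, x.2 i)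
  have hg : Measurable g := measurable_fst.prodMk ((measurable_pi_apply i).comp measurable_snd)
  have key : ∀ m, ∫⁻ ω, (ψ ∘ g) (D h m ω) ∂μ ≤
      ENNReal.ofReal (Real.exp (-(G.rewardErr σ ν h i r / 4))) := by
    intro m
    have e1 : ∫⁻ ω, (ψ ∘ g) (D h m ω) ∂μ =
        ∫⁻ p, ψ p ∂((G.obsLaw σ ν h).toMeasure ⊗ₘ G.rewardKernel i h) := by
      rw [← hD.law h hh m i, lintegral_map hψ (show Measurable fun ω =>
        ((D h m ω).1, (D h m ω).2 i) from hg.comp (hD.measurable h hh m))]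
      rfl
    rw [e1, Measure.lintegral_compProd hψ, PMF.lintegral_toMeasure]
    have h1 : ∀ z : Obs 𝒞 S A, ∫⁻ y, ψ (z, y) ∂(G.rewardKernel i h z) ≤ ENNReal.ofReal
        (1 - (r z.ctx z.state z.act - G.meanReward i h z.ctx z.state z.act) ^ 2 / 4) := fun z =>
      lintegral_exp_neg_excess_le (G.R i h z.ctx z.state z.act) (G.R_mem _ _ _ _ _) (hr _ _ _)
    refine (ENNReal.tsum_le_tsum fun z => mul_le_mul_right (h1 z) _).trans ?_
    let f : Obs 𝒞 S A → ℝ := fun z =>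
      (r z.ctx z.state z.act - G.meanReward i h z.ctx z.state z.act) ^ 2
    have hf1 : ∀ z, f z ≤ 1 := fun z => sq_sub_le_one (hr _ _ _) (G.meanReward_mem_Icc _ _ _ _ _)
    have hf0 : ∀ z, 0 ≤ f z := fun z => sq_nonneg _
    have h2 := PMF.tsum_mul_ofReal_one_sub_le (G.obsLaw σ ν h) (f := fun z => 1 / 4 * f z)
      (fun z => by have := hf0 z; positivity) (fun z => by linarith [hf1 z])
    have h3 : (G.obsLaw σ ν h).expect f = G.rewardErr σ ν h i r := by
      have a1 : ∀ z, (G.obsLaw σ ν h) z ≠ 0 → |f z| ≤ 1 := fun z _ => by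
        rw [abs_of_nonneg (hf0 z)]; exact hf1 z
      have b0 : ∀ (c : 𝒞) (x : ∀ j, S j × A j), 0 ≤ (r c (fun j => (x j).1) (fun j => (x j).2) -
          G.meanReward i h c (fun j => (x j).1) (fun j => (x j).2)) ^ 2 := fun c x => sq_nonneg _
      have b1 : ∀ (c : 𝒞) (x : ∀ j, S j × A j), |(r c (fun j => (x j).1) (fun j => (x j).2) -
          G.meanReward i h c (fun j => (x j).1) (fun j => (x j).2)) ^ 2| ≤ 1 := fun c x => by
        rw [abs_of_nonneg (b0 c x)]
        exact sq_sub_le_one (hr _ _ _) (G.meanReward_mem_Icc _ _ _ _ _)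
      rw [rewardErr, ← ENNReal.ofReal_eq_ofReal_iff (PMF.expect_nonneg _ fun z _ => hf0 z)
        (PMF.expect_nonneg _ fun c _ => PMF.expect_nonneg _ fun x _ => b0 c x),
        PMF.ofReal_expect _ hf0 a1, PMF.ofReal_expect _ (fun c => PMF.expect_nonneg _
          fun x _ => b0 c x) (fun c _ => PMF.abs_expect_le _ fun x _ => b1 c x),
        G.tsum_obsLaw_joint σ ν h fun c s a =>
          ENNReal.ofReal ((r c s a - G.meanReward i h c s a) ^ 2)]
      refine tsum_congr fun c => ?_
      rw [PMF.ofReal_expect _ (b0 c) fun x _ => b1 c x]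
    rw [PMF.expect_const_mul, h3, one_div_mul_eq_div] at h2
    simp only [one_div_mul_eq_div] at h2
    exact h2
  have h4 := chernoff_prod (fun m => hD.measurable h hh m) (hD.indep h hh) (hψ.comp hg) key
  rw [mul_neg] at h4
  refine (measure_mono fun ω hω => ?_).trans h4
  simp only [Set.mem_ofPred_eq, sqLoss] at hω ⊢
  simp only [ψ, g, Function.comp_apply]
  rw [← ENNReal.ofReal_prod_of_nonneg fun m _ => Real.exp_nonneg _, ← Real.exp_sum,
    ENNReal.one_le_ofReal, Real.one_le_exp_iff, Finset.sum_neg_distrib, Finset.sum_sub_distrib]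
  linarith

theorem log_prod_eq_sum_log {ι : Type*} (s : Finset ι) (f : ι → ℝ≥0∞) :
    ENNReal.log (∏ m ∈ s, f m) = ∑ m ∈ s, ENNReal.log (f m) := by
  classical
  induction s using Finset.induction_on with
  | empty => simp
  | insert a s ha ih => rw [Finset.prod_insert ha, Finset.sum_insert ha, ENNReal.log_mul_add, ih]

/-- Chernoff's method for the square root of the likelihood ratio, whose mean under the true model
is the Hellinger affinity. No lower bound on the model probabilities is needed. -/
theorem DecoupledGame.IsDataset.measure_logLik_le (hD : G.IsDataset H M σ ν μ D) {h : ℕ}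
    (hh : h < H) (i : Fin N) (P : 𝒞 → S i → A i → PMF (S i)) :
    μ {ω | logLik (fun m => D h m ω) i (G.P i h) ≤ logLik (fun m => D h m ω) i P} ≤
      ENNReal.ofReal (Real.exp (-(M * G.hellingerErr σ ν h i P))) := by
  have hlaw : ∀ m (F : Obs 𝒞 S A → ℝ≥0∞), ∫⁻ ω, F (D h m ω).1 ∂μ =
      ∑' z, G.obsLaw σ ν h z * F z := by
    intro m F
    have hF : Measurable F := Measurable.of_discrete
    have hm : Measurable fun ω => ((D h m ω).1, (D h m ω).2 i) :=
      (measurable_fst.prodMk ((measurable_pi_apply i).comp measurable_snd)).comp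
        (hD.measurable h hh m)
    have e := lintegral_map (μ := μ) (hF.comp measurable_fst) hm
    rw [hD.law h hh m i, Measure.lintegral_compProd (hF.comp measurable_fst)] at e
    simp only [Function.comp_apply, lintegral_const, measure_univ, mul_one] at e
    rw [← e, PMF.lintegral_toMeasure]
  let q : Obs 𝒞 S A → ℝ≥0∞ := fun z => P z.ctx (z.state i) (z.act i) (z.next i)
  let p : Obs 𝒞 S A → ℝ≥0∞ := fun z => G.P i h z.ctx (z.state i) (z.act i) (z.next i)
  let φ : Obs 𝒞 S A → ℝ≥0∞ := fun z => ENNReal.ofReal (√(q z).toReal / √(p z).toReal)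
  -- Where the true likelihood vanishes, `φ` is zero by the division convention and says nothing
  -- about the likelihood comparison. Almost surely no such sample occurs.
  have hnull : ∀ m, μ {ω | p (D h m ω).1 = 0} = 0 := by
    intro m
    have h1 := hlaw m (Set.indicator {z | p z = 0} 1)
    have hset : MeasurableSet {ω | p (D h m ω).1 = 0} :=
      (hD.measurable h hh m).fst (MeasurableSet.of_discrete (s := {z | p z = 0}))
    have h2 : ∫⁻ ω, Set.indicator {z | p z = 0} 1 (D h m ω).1 ∂μ = μ {ω | p (D h m ω).1 = 0} := by
      rw [← lintegral_indicator_one hset]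
      rfl
    rw [← h2, h1]
    classical
    have h3 := G.tsum_obsLaw_local σ ν h i fun c x s' => if G.P i h c x.1 x.2 s' = 0 then 1 else 0
    have h4 : ∀ z : Obs 𝒞 S A, Set.indicator {z | p z = 0} (1 : Obs 𝒞 S A → ℝ≥0∞) z =
        if G.P i h z.ctx (z.state i) (z.act i) (z.next i) = 0 then 1 else 0 := fun z => by
      rw [Set.indicator_apply]; rfl
    simp only [h4]
    rw [h3]
    simp
  have key : ∀ m, ∫⁻ ω, (φ ∘ Prod.fst) (D h m ω) ∂μ ≤
      ENNReal.ofReal (Real.exp (-(G.hellingerErr σ ν h i P))) := by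
    intro m
    have hb := fun c (x : S i × A i) => abs_le_of_mem_Icc_zero
      ⟨PMF.hellinger_nonneg (G.P i h c x.1 x.2) (P c x.1 x.2),
        PMF.hellinger_le_one (G.P i h c x.1 x.2) (P c x.1 x.2)⟩
    have h1 := hlaw m φ
    have h2 := G.tsum_obsLaw_local σ ν h i fun c x s' =>
      ENNReal.ofReal (√(P c x.1 x.2 s').toReal / √(G.P i h c x.1 x.2 s').toReal)
    simp only [PMF.tsum_mul_sqrt_div_sqrt] at h2
    refine (h1.trans h2).le.trans ?_
    have h3 : ∀ c, ∑' x, dataAct (σ i) (ν i) c h x *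
        ENNReal.ofReal (1 - PMF.hellinger (G.P i h c x.1 x.2) (P c x.1 x.2)) =
        ENNReal.ofReal (1 - (dataAct (σ i) (ν i) c h).expect fun x =>
          PMF.hellinger (G.P i h c x.1 x.2) (P c x.1 x.2)) := by
      intro c
      rw [← PMF.ofReal_expect _ (B := 1) (fun x => sub_nonneg.2 (PMF.hellinger_le_one _ _))
        (fun x _ => by
          rw [abs_of_nonneg (sub_nonneg.2 (PMF.hellinger_le_one _ _))]
          linarith [PMF.hellinger_nonneg (G.P i h c x.1 x.2) (P c x.1 x.2)]),
        PMF.expect_sub _ (B := 1) (fun x _ => by simp) (fun x _ => hb c x), PMF.expect_const]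
    simp only [h3]
    exact PMF.tsum_mul_ofReal_one_sub_le _
      (fun c => PMF.expect_nonneg _ fun x _ => PMF.hellinger_nonneg _ _)
      fun c => (le_abs_self _).trans (PMF.abs_expect_le _ fun x _ => hb c x)
  have hφ : Measurable (φ ∘ Prod.fst : Sample 𝒞 S A → ℝ≥0∞) :=
    Measurable.of_discrete.comp measurable_fst
  have h4 := chernoff_prod (fun m => hD.measurable h hh m) (hD.indep h hh) hφ key
  rw [mul_neg] at h4
  have hsub : {ω | logLik (fun m => D h m ω) i (G.P i h) ≤ logLik (fun m => D h m ω) i P} ⊆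
      {ω | 1 ≤ ∏ m, (φ ∘ Prod.fst) (D h m ω)} ∪ ⋃ m, {ω | p (D h m ω).1 = 0} := by
    intro ω hω
    by_cases hz : ∃ m, p (D h m ω).1 = 0
    · exact Or.inr (Set.mem_iUnion.2 hz)
    push Not at hz
    left
    simp only [Set.mem_ofPred_eq, logLik] at hω ⊢
    rw [← log_prod_eq_sum_log, ← log_prod_eq_sum_log, ENNReal.log_le_log_iff] at hω
    have hω' : ∏ m, p (D h m ω).1 ≤ ∏ m, q (D h m ω).1 := hω
    have hqt : ∀ m, q (D h m ω).1 ≠ ⊤ := fun m => PMF.apply_ne_top _ _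
    have hpt : ∀ m, p (D h m ω).1 ≠ ⊤ := fun m => PMF.apply_ne_top _ _
    have h5 := ENNReal.toReal_mono (ENNReal.prod_ne_top fun m _ => hqt m) hω'
    rw [ENNReal.toReal_prod, ENNReal.toReal_prod] at h5
    have hpos : ∀ m, 0 < (p (D h m ω).1).toReal := fun m => ENNReal.toReal_pos (hz m) (hpt m)
    simp only [φ, Function.comp_apply]
    rw [← ENNReal.ofReal_prod_of_nonneg fun m _ => by positivity, ENNReal.one_le_ofReal,
      Finset.prod_div_distrib, one_le_div (Finset.prod_pos fun m _ => Real.sqrt_pos.2 (hpos m)),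
      ← Real.sqrt_prod _ fun m _ => ENNReal.toReal_nonneg,
      ← Real.sqrt_prod _ fun m _ => ENNReal.toReal_nonneg]
    exact Real.sqrt_le_sqrt h5
  refine (measure_mono hsub).trans ((measure_union_le _ _).trans ?_)
  rw [measure_iUnion_null hnull, add_zero]
  exact h4

end Data

section Data

variable {N : ℕ} {𝒞 : Type*} {S A : Fin N → Type*}
variable {G : DecoupledGame N 𝒞 S A} {σ : ∀ i, ℕ → 𝒞 → PMF (S i)}
  {ν : ∀ i, LocalPolicy 𝒞 (S i) (A i)} {H M : ℕ} {Ω : Type*} [MeasurableSpace Ω] {μ : Measure Ω}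
  {D : ℕ → Fin M → Ω → Sample 𝒞 S A}

theorem Finset.card_filter_le_pred {α : Type*} (s : Finset α) (p : α → Prop) [DecidablePred p]
    {a : α} (ha : a ∈ s) (hp : ¬ p a) : (s.filter p).card + 1 ≤ s.card := by
  refine Finset.card_lt_card ⟨Finset.filter_subset _ _, fun h => hp ?_⟩
  exact (Finset.mem_filter.1 (h ha)).2

/-- With probability at least `1 - δ`, every empirically good model is good. -/
theorem DecoupledGame.IsDataset.exists_event [IsProbabilityMeasure μ]
    (hD : G.IsDataset H M σ ν μ D) {Rc : Fin N → Finset (RewardFn 𝒞 S A)}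
    {Pc : ∀ i, Finset (𝒞 → S i → A i → PMF (S i))}
    (hRc : ∀ i, ∀ r ∈ Rc i, ∀ c s a, r c s a ∈ Set.Icc (0 : ℝ) 1)
    (hreal : ∀ i, ∀ h < H, G.meanReward i h ∈ Rc i ∧ G.P i h ∈ Pc i) (hM : 1 ≤ M)
    {δ ε L : ℝ} (hδ : 0 < δ) (hL : 0 ≤ L) (hε : ε = L / M) {nR nP : ℕ}
    (hR : ∀ i, (Rc i).card ≤ nR) (hP : ∀ i, (Pc i).card ≤ nP)
    (hLδ : N * H * nR * nP * Real.exp (-L) ≤ δ) :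
    ∃ E : Set Ω, MeasurableSet E ∧ ENNReal.ofReal (1 - δ) ≤ μ E ∧ ∀ ω ∈ E, ∀ i, ∀ h < H,
      (∀ r ∈ Rc i, sqLoss (fun m => D h m ω) i r ≤ sqLoss (fun m => D h m ω) i (G.meanReward i h) →
        G.rewardErr σ ν h i r ≤ 4 * ε) ∧
      (∀ P ∈ Pc i, logLik (fun m => D h m ω) i (G.P i h) ≤ logLik (fun m => D h m ω) i P →
        G.hellingerErr σ ν h i P ≤ ε) := by
  classical
  have hM0 : (0 : ℝ) < M := by exact_mod_cast hM
  have hε0 : 0 ≤ ε := by rw [hε]; positivity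
  have hMε : M * ε = L := by rw [hε]; field_simp
  set FR : Fin N → ℕ → Finset (RewardFn 𝒞 S A) := fun i h =>
    (Rc i).filter fun r => 4 * ε < G.rewardErr σ ν h i r
  set FP : ∀ i : Fin N, ℕ → Finset (𝒞 → S i → A i → PMF (S i)) := fun i h =>
    (Pc i).filter fun P => ε < G.hellingerErr σ ν h i P
  set BR : Fin N → ℕ → Set Ω := fun i h => ⋃ r ∈ FR i h,
    {ω | sqLoss (fun m => D h m ω) i r ≤ sqLoss (fun m => D h m ω) i (G.meanReward i h)}
  set BP : Fin N → ℕ → Set Ω := fun i h => ⋃ P ∈ FP i h,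
    {ω | logLik (fun m => D h m ω) i (G.P i h) ≤ logLik (fun m => D h m ω) i P}
  set x := ENNReal.ofReal (Real.exp (-L))
  have h1 : ∀ i, ∀ h < H, μ (BR i h ∪ BP i h) ≤ (nR * nP : ℕ) * x := by
    intro i h hh
    have e1 : μ (BR i h) ≤ ((FR i h).card : ℝ≥0∞) * x := by
      refine (measure_biUnion_finset_le _ _).trans ?_
      rw [← nsmul_eq_mul, ← Finset.sum_const]
      refine Finset.sum_le_sum fun r hr => ?_
      obtain ⟨hr1, hr2⟩ := Finset.mem_filter.1 hr
      refine (hD.measure_sqLoss_le hh i r (hRc i r hr1)).trans (ENNReal.ofReal_le_ofReal ?_)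
      rw [Real.exp_le_exp, neg_le_neg_iff, ← hMε]
      exact mul_le_mul_of_nonneg_left (by linarith) hM0.le
    have e2 : μ (BP i h) ≤ ((FP i h).card : ℝ≥0∞) * x := by
      refine (measure_biUnion_finset_le _ _).trans ?_
      rw [← nsmul_eq_mul, ← Finset.sum_const]
      refine Finset.sum_le_sum fun P hP => ?_
      obtain ⟨hP1, hP2⟩ := Finset.mem_filter.1 hP
      refine (hD.measure_logLik_le hh i P).trans (ENNReal.ofReal_le_ofReal ?_)
      rw [Real.exp_le_exp, neg_le_neg_iff, ← hMε]
      exact mul_le_mul_of_nonneg_left hP2.le hM0.le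
    have c1 : (FR i h).card + 1 ≤ (Rc i).card := by
      refine Finset.card_filter_le_pred _ _ (hreal i h hh).1 ?_
      simp [DecoupledGame.rewardErr, hε0]
    have c2 : (FP i h).card + 1 ≤ (Pc i).card := by
      refine Finset.card_filter_le_pred _ _ (hreal i h hh).2 ?_
      simp [DecoupledGame.hellingerErr, hε0]
    -- The true models are never bad, so the bad ones number at most `(nR - 1) + (nP - 1) ≤ nR nP`.
    -- This is why the logarithm needs no extra constant for the two classes.
    have c3 : (FR i h).card + (FP i h).card ≤ nR * nP := by
      have := Nat.mul_le_mul (c1.trans (hR i)) (c2.trans (hP i))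
      nlinarith
    calc μ (BR i h ∪ BP i h) ≤ μ (BR i h) + μ (BP i h) := measure_union_le _ _
      _ ≤ (((FR i h).card + (FP i h).card : ℕ) : ℝ≥0∞) * x := by
          push_cast; rw [add_mul]; exact add_le_add e1 e2
      _ ≤ _ := by gcongr
  set B : Set Ω := ⋃ i ∈ (Finset.univ : Finset (Fin N)), ⋃ h ∈ Finset.range H, (BR i h ∪ BP i h)
  have h2 : μ B ≤ ENNReal.ofReal δ := by
    calc μ B ≤ ∑ i ∈ (Finset.univ : Finset (Fin N)), ∑ h ∈ Finset.range H, μ (BR i h ∪ BP i h) :=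
          (measure_biUnion_finset_le _ _).trans
            (Finset.sum_le_sum fun i _ => measure_biUnion_finset_le _ _)
      _ ≤ ∑ i ∈ (Finset.univ : Finset (Fin N)), ∑ h ∈ Finset.range H, (nR * nP : ℕ) * x :=
          Finset.sum_le_sum fun i _ => Finset.sum_le_sum fun h hh => h1 i h (Finset.mem_range.1 hh)
      _ = ENNReal.ofReal (N * H * nR * nP * Real.exp (-L)) := by
          simp only [Finset.sum_const, Finset.card_univ, Fintype.card_fin, Finset.card_range,
            nsmul_eq_mul, x]
          rw [ENNReal.ofReal_mul (by positivity)]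
          rw [← Nat.cast_mul, ← Nat.cast_mul, ← Nat.cast_mul, ENNReal.ofReal_natCast]
          push_cast
          ring
      _ ≤ ENNReal.ofReal δ := ENNReal.ofReal_le_ofReal hLδ
  -- Passing to a measurable hull of the bad event makes it unnecessary to show that the bad event
  -- is measurable.
  refine ⟨(toMeasurable μ B)ᶜ, (measurableSet_toMeasurable μ B).compl, ?_, ?_⟩
  · rw [prob_compl_eq_one_sub (measurableSet_toMeasurable μ B), measure_toMeasurable,
      ENNReal.ofReal_sub _ hδ.le, ENNReal.ofReal_one]
    exact tsub_le_tsub_left h2 1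
  · intro ω hω i h hh
    have hω' : ω ∉ B := fun hB => hω (subset_toMeasurable μ B hB)
    have hi : ω ∉ BR i h ∪ BP i h := fun hB => hω' (Set.mem_biUnion (Finset.mem_univ i)
      (Set.mem_biUnion (Finset.mem_coe.2 (Finset.mem_range.2 hh)) hB))
    constructor
    · intro r hr hle
      by_contra! hlt
      exact hi (Or.inl (Set.mem_biUnion (Finset.mem_coe.2 (Finset.mem_filter.2 ⟨hr, hlt⟩)) hle))
    · intro P hP hle
      by_contra! hlt
      exact hi (Or.inr (Set.mem_biUnion (Finset.mem_coe.2 (Finset.mem_filter.2 ⟨hP, hlt⟩)) hle))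

end Data

/-! ### Change of measure -/

/-- Expectations under `d` are controlled by second moments under `m`, with constant `Γ`. -/
def ShiftBound {α : Type*} (d m : PMF α) (Γ : ℝ) : Prop :=
  -- Optimizing over `τ` would give `√(Γ E_m f²)`. With `τ` free, the bound is linear in the second
  -- moment and can be averaged over contexts and states.
  ∀ (f : α → ℝ) (b : ℝ), (∀ x, f x ∈ Set.Icc 0 b) → ∀ τ : ℝ, 0 < τ →
    d.expect f ≤ τ + Γ / (4 * τ) * m.expect fun x => f x ^ 2

section Shift

variable {α : Type*} {d m : PMF α} {Γ : ℝ}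

theorem sq_mem_Icc {x b : ℝ} (h : x ∈ Set.Icc 0 b) : x ^ 2 ∈ Set.Icc 0 (b ^ 2) :=
  ⟨sq_nonneg x, pow_le_pow_left₀ h.1 h.2 2⟩

theorem ShiftBound.mono (h : ShiftBound d m Γ) {Γ' : ℝ} (hΓ : Γ ≤ Γ') : ShiftBound d m Γ' := by
  intro f b hf τ hτ
  refine (h f b hf τ hτ).trans ?_
  have : 0 ≤ m.expect fun x => f x ^ 2 := m.expect_nonneg fun x _ => sq_nonneg _
  gcongr

theorem ShiftBound.expect_le (h : ShiftBound d m Γ) (hΓ : 0 ≤ Γ) {f : α → ℝ} {b : ℝ}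
    (hf : ∀ x, f x ∈ Set.Icc 0 b) {v x : ℝ} (hv : (m.expect fun x => f x ^ 2) ≤ v)
    (hx : 0 < x) (hΓv : Γ * v ≤ x ^ 2) : d.expect f ≤ x := by
  have h1 := h f b hf (x / 2) (by positivity)
  have h2 : Γ / (4 * (x / 2)) * (m.expect fun x => f x ^ 2) ≤ x / 2 := by
    calc _ ≤ Γ / (4 * (x / 2)) * v := by gcongr
      _ = Γ * v / (2 * x) := by ring
      _ ≤ x ^ 2 / (2 * x) := by gcongr
      _ = x / 2 := by field_simp
  linarith

/-- Combine `f ≤ τ + f² / (4 τ)` with the density bound applied to `f²`. -/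
theorem ShiftBound.of_le_mul {B : ℝ} (hB : 0 ≤ B) (h : ∀ a, d a ≤ ENNReal.ofReal B * m a) :
    ShiftBound d m B := by
  intro f b hf τ hτ
  have hf2 := fun x => abs_le_of_mem_Icc_zero (sq_mem_Icc (hf x))
  have h1 := PMF.expect_le_of_le_mul d m hB h (f := fun x => f x ^ 2) (fun x => sq_nonneg _) hf2
  have h2 : d.expect f ≤ d.expect fun x => τ + 1 / (4 * τ) * f x ^ 2 := by
    refine d.expect_mono (B := b) (C := τ + 1 / (4 * τ) * b ^ 2)
      (fun x _ => abs_le_of_mem_Icc_zero (hf x)) (fun x _ => ?_) fun x _ => ?_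
    · have := sq_mem_Icc (hf x)
      rw [abs_of_nonneg (by have := this.1; positivity)]
      have h5 := mul_le_mul_of_nonneg_left this.2 (by positivity : 0 ≤ 1 / (4 * τ))
      linarith
    · have e : τ + 1 / (4 * τ) * f x ^ 2 - f x = (f x - 2 * τ) ^ 2 / (4 * τ) := by field_simp; ring
      have : 0 ≤ (f x - 2 * τ) ^ 2 / (4 * τ) := by positivity
      linarith
  rw [d.expect_add (B := τ) (C := |1 / (4 * τ)| * b ^ 2)
    (fun _ _ => by rw [abs_of_pos hτ]) (fun x _ => by
      rw [abs_mul]; exact mul_le_mul_of_nonneg_left (hf2 x) (abs_nonneg _)),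
    PMF.expect_const, PMF.expect_const_mul] at h2
  have h3 : 1 / (4 * τ) * d.expect (fun x => f x ^ 2) ≤
      1 / (4 * τ) * (B * m.expect fun x => f x ^ 2) := by gcongr
  calc _ ≤ _ := h2
    _ ≤ τ + 1 / (4 * τ) * (B * m.expect fun x => f x ^ 2) := by linarith
    _ = _ := by ring

end Shift

section Coverage

variable {𝒞 Si Ai : Type*}

/-- Averaging a bound that is affine in an extended nonnegative quantity of bounded mean. -/
theorem expect_le_of_mean_le (ρ : PMF 𝒞) (d : 𝒞 → PMF Si) (X : 𝒞 → Si → ℝ≥0∞) {C a b b₀ : ℝ}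
    (hC : 0 ≤ C) (ha : 0 < a) (hb : 0 ≤ b)
    (hX : ∑' c, ρ c * ∑' s, d c s * X c s ≤ ENNReal.ofReal C) {g : 𝒞 → Si → ℝ}
    (hg : ∀ c s, |g c s| ≤ b₀) (h : ∀ c s, X c s ≠ ⊤ → g c s ≤ a * (X c s).toReal + b) :
    (ρ.expect fun c => (d c).expect (g c)) ≤ a * C + b := by
  have hg' : ∀ c s, |max (g c s) 0| ≤ b₀ := fun c s => by
    have := hg c s
    rw [abs_of_nonneg (le_max_right _ _)]
    exact max_le ((le_abs_self _).trans this) ((abs_nonneg _).trans this)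
  have h1 : (ρ.expect fun c => (d c).expect (g c)) ≤
      ρ.expect fun c => (d c).expect fun s => max (g c s) 0 :=
    ρ.expect_mono (fun c _ => PMF.abs_expect_le _ fun s _ => hg c s)
      (fun c _ => PMF.abs_expect_le _ fun s _ => hg' c s) fun c _ =>
        PMF.expect_mono _ (fun s _ => hg c s) (fun s _ => hg' c s) fun s _ => le_max_left _ _
  refine h1.trans ?_
  rw [← ENNReal.ofReal_le_ofReal_iff (by positivity), PMF.ofReal_expect _
    (fun c => PMF.expect_nonneg _ fun s _ => le_max_right _ _)
    (fun c _ => PMF.abs_expect_le _ fun s _ => hg' c s)]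
  have h2 : ∀ c, ENNReal.ofReal ((d c).expect fun s => max (g c s) 0) ≤
      ENNReal.ofReal a * (∑' s, d c s * X c s) + ENNReal.ofReal b := by
    intro c
    rw [PMF.ofReal_expect _ (fun s => le_max_right _ _) (fun s _ => hg' c s)]
    have : ENNReal.ofReal b = ∑' s, d c s * ENNReal.ofReal b := by
      rw [ENNReal.tsum_mul_right, PMF.tsum_coe, one_mul]
    rw [this, ← ENNReal.tsum_mul_left, ← ENNReal.tsum_add]
    refine ENNReal.tsum_le_tsum fun s => ?_
    -- No affine bound is available here; either the state has zero weight or the right side is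
    -- infinite.
    by_cases hx : X c s = ⊤
    · by_cases h0 : d c s = 0
      · simp [h0]
      · rw [hx, ENNReal.mul_top h0, ENNReal.mul_top (by simpa using ha), top_add]
        exact le_top
    · have h3 : ENNReal.ofReal (max (g c s) 0) ≤ ENNReal.ofReal a * X c s + ENNReal.ofReal b := by
        rw [← ENNReal.ofReal_toReal hx, ← ENNReal.ofReal_mul ha.le,
          ← ENNReal.ofReal_add (mul_nonneg ha.le ENNReal.toReal_nonneg) hb]
        refine ENNReal.ofReal_le_ofReal (max_le (h c s hx) ?_)
        have := ENNReal.toReal_nonneg (a := X c s)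
        positivity
      calc _ ≤ d c s * (ENNReal.ofReal a * X c s + ENNReal.ofReal b) := by gcongr
        _ = _ := by ring
  calc _ ≤ ∑' c, ρ c * (ENNReal.ofReal a * (∑' s, d c s * X c s) + ENNReal.ofReal b) :=
        ENNReal.tsum_le_tsum fun c => mul_le_mul_right (h2 c) _
    _ = ENNReal.ofReal a * (∑' c, ρ c * ∑' s, d c s * X c s) + ENNReal.ofReal b := by
        simp only [mul_add]
        rw [ENNReal.tsum_add, ENNReal.tsum_mul_right, PMF.tsum_coe, one_mul,
          ← ENNReal.tsum_mul_left]
        congr 1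
        exact tsum_congr fun c => by ring
    _ ≤ ENNReal.ofReal a * ENNReal.ofReal C + ENNReal.ofReal b := by gcongr
    _ = _ := by
        rw [← ENNReal.ofReal_mul ha.le, ← ENNReal.ofReal_add (by positivity) hb]

/-- Termwise, `p f ≤ k p² / ν + ν f² / (4 k)` and `p² / ν ≤ 2 (p - ν)² / ν + 2 ν`. -/
theorem expect_le_chiSq {ν p : PMF Ai} (hp : PMF.SqInt ν p) {f : Ai → ℝ} {b : ℝ}
    (hf : ∀ a, f a ∈ Set.Icc 0 b) {k : ℝ} (hk : 0 < k) :
    p.expect f ≤ k * (2 * (chiSq p ν).toReal + 2) + 1 / (4 * k) * ν.expect fun a => f a ^ 2 := by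
  have hf2 := fun x => abs_le_of_mem_Icc_zero (sq_mem_Icc (hf x))
  rw [hp.chiSq_toReal]
  have s1 := (((hp.summable (PMF.SqInt.self ν)).hasSum.mul_left 2).add
    (ν.summable_toReal.hasSum.mul_left 2)).mul_left k
  have s2 := (ν.summable_mul_of_bdd fun a _ => hf2 a).hasSum.mul_left (1 / (4 * k))
  have s := s1.add s2
  rw [PMF.tsum_toReal, mul_one] at s
  refine hasSum_le (fun a => ?_)
    (p.summable_mul_of_bdd fun a _ => abs_le_of_mem_Icc_zero (hf a)).hasSum s
  rcases (ENNReal.toReal_nonneg (a := ν a)).eq_or_lt with h0 | h0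
  · have h0' : ν a = 0 :=
      ((ENNReal.toReal_eq_zero_iff _).1 h0.symm).resolve_right (ν.apply_ne_top a)
    rw [hp.1 a h0', h0']; simp
  · set u := (p a).toReal
    set v := (ν a).toReal
    have e : k * (2 * ((u - v) ^ 2 / v) + 2 * v) + 1 / (4 * k) * (v * f a ^ 2) - u * f a =
        k * ((u - 2 * v) ^ 2 / v) + (2 * k * u - v * f a) ^ 2 / (4 * k * v) := by
      field_simp; ring
    have : 0 ≤ k * ((u - 2 * v) ^ 2 / v) + (2 * k * u - v * f a) ^ 2 / (4 * k * v) := by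
      positivity
    linarith

/-- Actions are changed by the `χ²` bound and states by the density bound. The average of `χ²` is
taken under the visitation `d`, as in the covered class, so the action change must come first. -/
theorem ShiftBound.of_coverage {ρ : PMF 𝒞} {d σ : 𝒞 → PMF Si} {p ν : 𝒞 → Si → PMF Ai} {CS C : ℝ}
    (hCS : 0 ≤ CS) (hC : 0 ≤ C) (hd : ∀ c s, d c s ≤ ENNReal.ofReal CS * σ c s)
    (hX : ∑' c, ρ c * ∑' s, d c s * chiSq (p c s) (ν c s) ≤ ENNReal.ofReal C) :
    ShiftBound (PMF.joint ρ fun c => PMF.joint (d c) (p c))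
      (PMF.joint ρ fun c => PMF.joint (σ c) (ν c)) (CS * (2 * C + 2)) := by
  intro f b hf τ hτ
  have hf1 := fun x => abs_le_of_mem_Icc_zero (hf x)
  have hf2 := fun x => abs_le_of_mem_Icc_zero (sq_mem_Icc (hf x))
  -- The mean of `k (2 χ² + 2)` is then at most `τ`.
  set k := τ / (2 * C + 2) with hk
  have hk0 : 0 < k := by positivity
  have hE2 : ∀ c s, |(ν c s).expect fun a => f (c, s, a) ^ 2| ≤ b ^ 2 := fun c s =>
    PMF.abs_expect_le _ fun a _ => hf2 _
  have hE1 : ∀ c s, |(p c s).expect fun a => f (c, s, a)| ≤ b := fun c s =>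
    PMF.abs_expect_le _ fun a _ => hf1 _
  have hE3 : ∀ c s, |1 / (4 * k) * (ν c s).expect fun a => f (c, s, a) ^ 2| ≤
      1 / (4 * k) * b ^ 2 := fun c s => by
    rw [abs_mul, abs_of_pos (by positivity : 0 < 1 / (4 * k))]
    exact mul_le_mul_of_nonneg_left (hE2 c s) (by positivity)
  have h1 := expect_le_of_mean_le ρ d (fun c s => chiSq (p c s) (ν c s)) (a := 2 * k) (b := 2 * k)
    hC (by positivity) (by positivity) hX
    (g := fun c s => ((p c s).expect fun a => f (c, s, a)) -
      1 / (4 * k) * (ν c s).expect fun a => f (c, s, a) ^ 2)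
    (fun c s => (abs_sub _ _).trans (add_le_add (hE1 c s) (hE3 c s))) (fun c s hx => by
      have := expect_le_chiSq (PMF.SqInt.of_chiSq_ne_top hx) (fun a => hf (c, s, a)) hk0
      linarith)
  have e1 : (ρ.expect fun c => (d c).expect fun s => ((p c s).expect fun a => f (c, s, a)) -
      1 / (4 * k) * (ν c s).expect fun a => f (c, s, a) ^ 2) =
      (PMF.joint ρ fun c => PMF.joint (d c) (p c)).expect f -
      1 / (4 * k) * ρ.expect fun c => (d c).expect fun s => (ν c s).expect fun a =>
        f (c, s, a) ^ 2 := by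
    rw [PMF.expect_joint _ _ hf1, ← PMF.expect_const_mul, ← PMF.expect_sub _
      (fun c _ => PMF.abs_expect_le _ fun x _ => hf1 _) (fun c _ => by
        rw [← PMF.expect_const_mul]; exact PMF.abs_expect_le _ fun s _ => hE3 c s)]
    refine PMF.expect_congr _ fun c _ => ?_
    rw [PMF.expect_joint _ _ fun x => hf1 _, ← PMF.expect_const_mul, ← PMF.expect_sub _
      (fun s _ => hE1 c s) (fun s _ => hE3 c s)]
  rw [e1] at h1
  have e2 : (ρ.expect fun c => (d c).expect fun s => (ν c s).expect fun a => f (c, s, a) ^ 2) ≤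
      CS * (PMF.joint ρ fun c => PMF.joint (σ c) (ν c)).expect fun x => f x ^ 2 := by
    rw [PMF.expect_joint _ _ hf2, ← PMF.expect_const_mul]
    refine PMF.expect_mono _ (B := b ^ 2) (C := CS * b ^ 2)
      (fun c _ => PMF.abs_expect_le _ fun s _ => hE2 c s) (fun c _ => ?_) fun c _ => ?_
    · rw [abs_mul, abs_of_nonneg hCS]
      exact mul_le_mul_of_nonneg_left (PMF.abs_expect_le _ fun x _ => hf2 _) hCS
    · rw [PMF.expect_joint _ _ fun x => hf2 _]
      exact PMF.expect_le_of_le_mul _ _ hCS (hd c)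
        (fun s => PMF.expect_nonneg _ fun a _ => sq_nonneg _) (hE2 c)
  have e3 : 2 * k * C + 2 * k = τ := by rw [hk]; field_simp
  have e4 : 1 / (4 * k) * (ρ.expect fun c => (d c).expect fun s => (ν c s).expect fun a =>
      f (c, s, a) ^ 2) ≤ 1 / (4 * k) *
      (CS * (PMF.joint ρ fun c => PMF.joint (σ c) (ν c)).expect fun x => f x ^ 2) := by gcongr
  have e5 : CS * (2 * C + 2) / (4 * τ) = 1 / (4 * k) * CS := by rw [hk]; field_simp
  rw [e5, mul_assoc]
  linarith

end Coverage

/-! ### Errors of the estimated model under the visited distributions. -/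

section ModelError

variable {N : ℕ} {𝒞 : Type*} {S A : Fin N → Type*} (G : DecoupledGame N 𝒞 S A)
  (σ : ∀ i, ℕ → 𝒞 → PMF (S i)) (ν : ∀ i, LocalPolicy 𝒞 (S i) (A i))

/-- The law of the context and the local state-action pair at step `h` under the local policy
`ξ`. -/
noncomputable def DecoupledGame.ctxAct (i : Fin N) (ξ : LocalPolicy 𝒞 (S i) (A i)) (h : ℕ) :
    PMF (𝒞 × (S i × A i)) :=
  PMF.joint G.ρ fun c => visitAct (G.P i) (G.init i) ξ c h

/-- The law of the context and the local state-action pair at step `h` in the data. -/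
noncomputable def DecoupledGame.ctxData (i : Fin N) (h : ℕ) : PMF (𝒞 × (S i × A i)) :=
  PMF.joint G.ρ fun c => dataAct (σ i) (ν i) c h

theorem PMF.joint_le_mul {α β : Type*} (p : PMF α) {q q' : α → PMF β} {B : ℝ≥0∞}
    (h : ∀ a b, q a b ≤ B * q' a b) (x : α × β) : joint p q x ≤ B * joint p q' x := by
  rw [← Prod.mk.eta (p := x), joint_apply, joint_apply, mul_left_comm]
  gcongr
  exact h _ _

variable {G σ ν} {H K : ℕ} {i : Fin N}

theorem RewardHasIR.rankLT {r : RewardFn 𝒞 S A} (hr : RewardHasIR K i r) (c : 𝒞)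
    (z : S i × A i) : RankLT K fun y : ∀ j : {j // j ≠ i}, S j × A j =>
      r c (fun j => (PMF.glue (X := fun j => S j × A j) i z y j).1)
        (fun j => (PMF.glue (X := fun j => S j × A j) i z y j).2) := by
  have h := HasInteractionRank.rankLT hr (c, z.1, z.2)
  have e1 : ∀ y : ∀ j : {j // j ≠ i}, S j × A j,
      (fun j => (PMF.glue (X := fun j => S j × A j) i z y j).1) =
        (Equiv.piSplitAt i S).symm (z.1, fun j => (y j).1) := fun y =>
    PMF.comp_glue (X := fun j => S j × A j) i (fun _ => Prod.fst) z y
  have e2 : ∀ y : ∀ j : {j // j ≠ i}, S j × A j,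
      (fun j => (PMF.glue (X := fun j => S j × A j) i z y j).2) =
        (Equiv.piSplitAt i A).symm (z.2, fun j => (y j).2) := fun y =>
    PMF.comp_glue (X := fun j => S j × A j) i (fun _ => Prod.snd) z y
  simp only [e1, e2]
  exact h

theorem DecoupledGame.hellingerErr_eq (h : ℕ) (P : 𝒞 → S i → A i → PMF (S i)) :
    G.hellingerErr σ ν h i P = (G.ctxData σ ν i h).expect fun x =>
      PMF.hellinger (G.P i h x.1 x.2.1 x.2.2) (P x.1 x.2.1 x.2.2) := by
  rw [ctxData, PMF.expect_joint _ _ (B := 1) fun x =>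
    abs_le_of_mem_Icc_zero ⟨PMF.hellinger_nonneg _ _, PMF.hellinger_le_one _ _⟩]
  rfl

theorem DecoupledGame.expect_l1_sq_le (h : ℕ) (P : 𝒞 → S i → A i → PMF (S i)) :
    ((G.ctxData σ ν i h).expect fun x =>
      PMF.l1 (G.P i h x.1 x.2.1 x.2.2) (P x.1 x.2.1 x.2.2) ^ 2) ≤
      8 * G.hellingerErr σ ν h i P := by
  rw [hellingerErr_eq, ← PMF.expect_const_mul]
  refine PMF.expect_mono _ (B := 2 ^ 2) (C := 8 * 1) (fun x _ => ?_) (fun x _ => ?_)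
    fun x _ => PMF.l1_sq_le_hellinger _ _
  · exact abs_le_of_mem_Icc_zero (sq_mem_Icc ⟨PMF.l1_nonneg _ _, PMF.l1_le_two _ _⟩)
  · exact abs_le_of_mem_Icc_zero ⟨mul_nonneg (by norm_num) (PMF.hellinger_nonneg _ _),
      mul_le_mul_of_nonneg_left (PMF.hellinger_le_one _ _) (by norm_num)⟩

theorem ShiftBound.expect_l1_le {Γ ε x : ℝ} {ξ : LocalPolicy 𝒞 (S i) (A i)} {h : ℕ}
    (hξ : ShiftBound (G.ctxAct i ξ h) (G.ctxData σ ν i h) Γ) (hΓ : 0 ≤ Γ)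
    {P : 𝒞 → S i → A i → PMF (S i)} (hP : G.hellingerErr σ ν h i P ≤ ε) (hx : 0 < x)
    (hx2 : Γ * (8 * ε) ≤ x ^ 2) :
    ((G.ctxAct i ξ h).expect fun x =>
      PMF.l1 (G.P i h x.1 x.2.1 x.2.2) (P x.1 x.2.1 x.2.2)) ≤ x :=
  hξ.expect_le hΓ (fun x => ⟨PMF.l1_nonneg _ _, PMF.l1_le_two _ _⟩)
    ((G.expect_l1_sq_le h P).trans (by linarith)) hx hx2

/-- The reward error of the model, averaged over the other agents under the true dynamics. -/
noncomputable def DecoupledGame.rewardDiff (G : DecoupledGame N 𝒞 S A) (i : Fin N)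
    (π : ∀ i, LocalPolicy 𝒞 (S i) (A i)) (r : ℕ → RewardFn 𝒞 S A) (h : ℕ)
    (x : 𝒞 × (S i × A i)) : ℝ :=
  (PMF.indep fun j : {j // j ≠ i} => visitAct (G.P j) (G.init j) (π j) x.1 h).expect fun y =>
    rewardAt (G.meanReward i) h x.1 (PMF.glue i x.2 y) - rewardAt r h x.1 (PMF.glue i x.2 y)

theorem abs_sub_le_one_of_mem {u v : ℝ} (hu : u ∈ Set.Icc (0 : ℝ) 1) (hv : v ∈ Set.Icc (0 : ℝ) 1) :
    |u - v| ≤ 1 := by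
  rw [abs_le]
  exact ⟨by linarith [hu.1, hv.2], by linarith [hu.2, hv.1]⟩

theorem DecoupledGame.abs_rewardDiff_le {π : ∀ i, LocalPolicy 𝒞 (S i) (A i)}
    {r : ℕ → RewardFn 𝒞 S A} {h : ℕ} (hr : ∀ c s a, r h c s a ∈ Set.Icc (0 : ℝ) 1)
    (x : 𝒞 × (S i × A i)) : |G.rewardDiff i π r h x| ≤ 1 :=
  PMF.abs_expect_le _ fun _ _ =>
    abs_sub_le_one_of_mem (G.meanReward_mem_Icc i h _ _ _) (hr _ _ _)

/-- The averaged reward error under the data distribution. -/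
theorem DecoupledGame.expect_rewardDiff_sq_le {B : ℝ} (hB : 1 ≤ B)
    {π : ∀ i, LocalPolicy 𝒞 (S i) (A i)} {r : ℕ → RewardFn 𝒞 S A} {h : ℕ}
    (hr : ∀ c s a, r h c s a ∈ Set.Icc (0 : ℝ) 1) (hrK : RewardHasIR K i (r h))
    (hmK : RewardHasIR K i (G.meanReward i h))
    (hdens : ∀ j c z, visitAct (G.P j) (G.init j) (π j) c h z ≤
      ENNReal.ofReal B * dataAct (σ j) (ν j) c h z) :
    ((G.ctxData σ ν i h).expect fun x => |G.rewardDiff i π r h x| ^ 2) ≤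
      ((N : ℝ) ^ (K - 1)) ^ 2 * B ^ (K - 1) * G.rewardErr σ ν h i (r h) := by
  have hN : ((Fintype.card {j : Fin N // j ≠ i} : ℕ) : ℝ) + 1 = N := by
    have h0 : Fintype.card {j : Fin N // j ≠ i} + 1 = N := by
      rw [Fintype.card_subtype_compl, Fintype.card_fin, Fintype.card_subtype_eq]
      have := i.pos
      omega
    exact_mod_cast h0
  -- Both rewards have rank at most `K`, hence so does their difference, and the low-rank change of
  -- measure applies to the other agents with the context and agent `i` held fixed.
  let e : 𝒞 × (S i × A i) → (∀ j : {j // j ≠ i}, S j × A j) → ℝ := fun x y =>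
    rewardAt (G.meanReward i) h x.1 (PMF.glue i x.2 y) - rewardAt r h x.1 (PMF.glue i x.2 y)
  have he : ∀ x y, |e x y| ≤ 1 := fun x y =>
    abs_sub_le_one_of_mem (G.meanReward_mem_Icc i h _ _ _) (hr _ _ _)
  have he2 : ∀ x y, |e x y ^ 2| ≤ 1 := fun x y => by
    rw [abs_pow]; exact pow_le_one₀ (abs_nonneg _) (he x y)
  have hrank : ∀ x, RankLT K (e x) := fun x =>
    RankLT.sub (hmK.rankLT x.1 x.2) (hrK.rankLT x.1 x.2)
  let g : 𝒞 × (S i × A i) → ℝ := fun x =>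
    (PMF.indep fun j : {j // j ≠ i} => dataAct (σ j) (ν j) x.1 h).expect fun y => e x y ^ 2
  have hg : ∀ x, |g x| ≤ 1 := fun x => PMF.abs_expect_le _ fun y _ => he2 x y
  have h1 : ∀ x, |G.rewardDiff i π r h x| ^ 2 ≤ ((N : ℝ) ^ (K - 1)) ^ 2 * B ^ (K - 1) * g x := by
    intro x
    rw [sq_abs, ← hN]
    exact PMF.expect_indep_sq_le_of_rankLT
      (fun j : {j // j ≠ i} => visitAct (G.P j) (G.init j) (π j) x.1 h)
      (fun j : {j // j ≠ i} => dataAct (σ j) (ν j) x.1 h) hB (fun j z => hdens j x.1 z) (he x)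
      (hrank x)
  have h2 : G.rewardErr σ ν h i (r h) = (G.ctxData σ ν i h).expect g := by
    rw [ctxData, PMF.expect_joint _ _ hg, rewardErr]
    refine PMF.expect_congr _ fun c _ => ?_
    rw [PMF.expect_indep_eq _ i (B := 1) fun x => by
      rw [abs_pow]
      exact pow_le_one₀ (abs_nonneg _)
        (abs_sub_le_one_of_mem (hr _ _ _) (G.meanReward_mem_Icc i h _ _ _))]
    refine PMF.expect_congr _ fun z _ => PMF.expect_congr _ fun y _ => ?_
    simp only [e, rewardAt]
    ring
  rw [h2, ← PMF.expect_const_mul]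
  refine PMF.expect_mono _ (B := 1) (C := ((N : ℝ) ^ (K - 1)) ^ 2 * B ^ (K - 1) * 1)
    (fun x _ => ?_) (fun x _ => ?_) fun x _ => h1 x
  · rw [abs_pow, abs_abs]
    exact pow_le_one₀ (abs_nonneg _) (abs_rewardDiff_le hr x)
  · rw [abs_mul, abs_of_nonneg (by positivity : 0 ≤ ((N : ℝ) ^ (K - 1)) ^ 2 * B ^ (K - 1))]
    exact mul_le_mul_of_nonneg_left (hg x) (by positivity)

/-- The drift of the visitation measures of all agents up to step `h`. -/
noncomputable def DecoupledGame.drift (G : DecoupledGame N 𝒞 S A)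
    (P : ∀ i, LocalKernel 𝒞 (S i) (A i)) (π : ∀ i, LocalPolicy 𝒞 (S i) (A i)) (h : ℕ) (c : 𝒞) : ℝ :=
  ∑ j, ∑ k ∈ Finset.range h, (visitAct (G.P j) (G.init j) (π j) c k).expect fun z =>
    PMF.l1 (G.P j k c z.1 z.2) (P j k c z.1 z.2)

/-- First change the reward under the true visitations, then the visitations under the estimated
reward. For `K = 1` the reward ignores the other agents, so the second change is free; this case
must be separated because `λ` then carries no power of `N`. -/
theorem DecoupledGame.abs_rewardBar_sub_le {P : ∀ i, LocalKernel 𝒞 (S i) (A i)}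
    {π : ∀ i, LocalPolicy 𝒞 (S i) (A i)} {r : ℕ → RewardFn 𝒞 S A} {h : ℕ}
    (hr : ∀ c s a, r h c s a ∈ Set.Icc (0 : ℝ) 1) (hK : 1 ≤ K) (hrK : RewardHasIR K i (r h))
    (x : 𝒞 × (S i × A i)) :
    |rewardBar G.init G.P π i (G.meanReward i) x.1 h x.2 - rewardBar G.init P π i r x.1 h x.2| ≤
      |G.rewardDiff i π r h x| + if K = 1 then 0 else G.drift P π h x.1 := by
  have hm : ∀ z, |rewardAt (G.meanReward i) h x.1 z| ≤ 1 := fun z =>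
    abs_le_of_mem_Icc_zero (G.meanReward_mem_Icc i h _ _ _)
  have hr' : ∀ z, |rewardAt r h x.1 z| ≤ 1 := fun z => abs_le_of_mem_Icc_zero (hr _ _ _)
  have e1 : G.rewardDiff i π r h x = rewardBar G.init G.P π i (G.meanReward i) x.1 h x.2 -
      rewardBar G.init G.P π i r x.1 h x.2 :=
    PMF.expect_sub _ (fun y _ => hm _) (fun y _ => hr' _)
  have e2 : |rewardBar G.init G.P π i r x.1 h x.2 - rewardBar G.init P π i r x.1 h x.2| ≤
      if K = 1 then 0 else G.drift P π h x.1 := by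
    split_ifs with h1
    · subst h1
      have hc := (hrK.rankLT x.1 x.2).eq_of_one
      obtain ⟨y₀, -⟩ := (PMF.indep fun j : {j // j ≠ i} =>
        visitAct (G.P j) (G.init j) (π j) x.1 h).support_nonempty
      have h2 : ∀ y, rewardAt r h x.1 (PMF.glue i x.2 y) = rewardAt r h x.1 (PMF.glue i x.2 y₀) :=
        fun y => hc y y₀
      simp only [rewardBar, h2, PMF.expect_const, sub_self, abs_zero, le_refl]
    · refine (PMF.abs_expect_indep_sub_le _ _ (fun j : {j // j ≠ i} => ∑ k ∈ Finset.range h,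
        (visitAct (G.P j) (G.init j) (π j) x.1 k).expect fun z =>
          PMF.l1 (G.P j k x.1 z.1 z.2) (P j k x.1 z.1 z.2))
        (fun j f hf => abs_expect_visitAct_sub_le _ _ _ _ _ _ hf) fun y => hr' _).trans ?_
      rw [DecoupledGame.drift]
      have h3 := Finset.sum_subtype_of_mem (s := Finset.univ.filter fun j : Fin N => j ≠ i)
        (p := fun j => j ≠ i) (fun j => ∑ k ∈ Finset.range h,
        (visitAct (G.P j) (G.init j) (π j) x.1 k).expect fun z =>
          PMF.l1 (G.P j k x.1 z.1 z.2) (P j k x.1 z.1 z.2)) (by simp)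
      have h4 : (Finset.univ.filter fun j : Fin N => j ≠ i).subtype (fun j => j ≠ i) =
          Finset.univ := by ext j; simp [j.2]
      rw [h4] at h3
      rw [h3]
      exact Finset.sum_le_sum_of_subset_of_nonneg (Finset.filter_subset _ _) fun j _ _ =>
        Finset.sum_nonneg fun k _ => PMF.expect_nonneg _ fun z _ => PMF.l1_nonneg _ _
  have e3 := abs_add_le (rewardBar G.init G.P π i (G.meanReward i) x.1 h x.2 -
      rewardBar G.init G.P π i r x.1 h x.2)
    (rewardBar G.init G.P π i r x.1 h x.2 - rewardBar G.init P π i r x.1 h x.2)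
  rw [sub_add_sub_cancel, ← e1] at e3
  linarith

theorem DecoupledGame.drift_mem_Icc (P : ∀ i, LocalKernel 𝒞 (S i) (A i))
    (π : ∀ i, LocalPolicy 𝒞 (S i) (A i)) (h : ℕ) (c : 𝒞) :
    G.drift P π h c ∈ Set.Icc (0 : ℝ) (N * (h * 2)) := by
  constructor
  · exact Finset.sum_nonneg fun j _ => Finset.sum_nonneg fun k _ =>
      PMF.expect_nonneg _ fun z _ => PMF.l1_nonneg _ _
  · calc G.drift P π h c ≤ ∑ j : Fin N, ∑ k ∈ Finset.range h, (2 : ℝ) :=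
          Finset.sum_le_sum fun j _ => Finset.sum_le_sum fun k _ =>
            (le_abs_self _).trans (PMF.abs_expect_le _ fun z _ => PMF.abs_l1_le_two _ _)
      _ = _ := by simp

/-- The drift is measured along the true visitations of the iterates, whose density with respect to
the data is at most `B`; each of the at most `N H` terms is an `ℓ¹` error under the data. -/
theorem DecoupledGame.expect_drift_le {B ε x : ℝ} (hB : 0 ≤ B)
    {P : ∀ i, LocalKernel 𝒞 (S i) (A i)} {π : ∀ i, LocalPolicy 𝒞 (S i) (A i)} {h : ℕ} (hh : h < H)
    (hdens : ∀ j, ∀ k < H, ∀ c z, visitAct (G.P j) (G.init j) (π j) c k z ≤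
      ENNReal.ofReal B * dataAct (σ j) (ν j) c k z)
    (hP : ∀ j, ∀ k < H, G.hellingerErr σ ν k j (P j k) ≤ ε) (hx : 0 < x)
    (hx2 : B * (8 * ε) ≤ x ^ 2) : G.ρ.expect (G.drift P π h) ≤ N * H * x := by
  have hb : ∀ j k c, |(visitAct (G.P j) (G.init j) (π j) c k).expect fun z =>
      PMF.l1 (G.P j k c z.1 z.2) (P j k c z.1 z.2)| ≤ 2 := fun j k c =>
    PMF.abs_expect_le _ fun z _ => PMF.abs_l1_le_two _ _
  have e1 : G.ρ.expect (G.drift P π h) = ∑ j, ∑ k ∈ Finset.range h, (G.ctxAct j (π j) k).expect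
      fun x => PMF.l1 (G.P j k x.1 x.2.1 x.2.2) (P j k x.1 x.2.1 x.2.2) := by
    have := G.ρ.expect_sum Finset.univ (f := fun j c => ∑ k ∈ Finset.range h,
      (visitAct (G.P j) (G.init j) (π j) c k).expect fun z =>
        PMF.l1 (G.P j k c z.1 z.2) (P j k c z.1 z.2)) (B := fun _ => ∑ k ∈ Finset.range h, 2)
      fun j _ c _ => (Finset.abs_sum_le_sum_abs _ _).trans (Finset.sum_le_sum fun k _ => hb j k c)
    refine this.trans (Finset.sum_congr rfl fun j _ => ?_)
    rw [G.ρ.expect_sum _ (B := fun _ => 2) fun k _ c _ => hb j k c]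
    refine Finset.sum_congr rfl fun k _ => ?_
    rw [ctxAct, PMF.expect_joint _ _ (B := 2) fun x => PMF.abs_l1_le_two _ _]
  rw [e1]
  calc _ ≤ ∑ j : Fin N, ∑ k ∈ Finset.range h, x := Finset.sum_le_sum fun j _ =>
        Finset.sum_le_sum fun k hk => by
          have hk' : k < H := (Finset.mem_range.1 hk).trans hh
          exact (ShiftBound.of_le_mul hB (PMF.joint_le_mul _ (hdens j k hk'))).expect_l1_le hB
            (hP j k hk') hx hx2
    _ = N * h * x := by simp; ring
    _ ≤ N * H * x := by
        have : (h : ℝ) ≤ H := by exact_mod_cast hh.le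
        gcongr

/-- The total model error seen by agent `i` at step `h` when it plays `ξ`. -/
theorem DecoupledGame.expect_modelErr_le {B Γ ε xa xb xc : ℝ} (hB : 1 ≤ B) (hΓ : 0 ≤ Γ)
    {P : ∀ i, LocalKernel 𝒞 (S i) (A i)} {π : ∀ i, LocalPolicy 𝒞 (S i) (A i)}
    {r : ℕ → RewardFn 𝒞 S A} {h : ℕ} (hh : h < H)
    (hr : ∀ c s a, r h c s a ∈ Set.Icc (0 : ℝ) 1) (hK : 1 ≤ K) (hrK : RewardHasIR K i (r h))
    (hmK : RewardHasIR K i (G.meanReward i h))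
    (hdens : ∀ j, ∀ k < H, ∀ c z, visitAct (G.P j) (G.init j) (π j) c k z ≤
      ENNReal.ofReal B * dataAct (σ j) (ν j) c k z)
    (hR : G.rewardErr σ ν h i (r h) ≤ 4 * ε)
    (hP : ∀ j, ∀ k < H, G.hellingerErr σ ν k j (P j k) ≤ ε)
    {ξ : LocalPolicy 𝒞 (S i) (A i)} (hξ : ShiftBound (G.ctxAct i ξ h) (G.ctxData σ ν i h) Γ)
    (ha : 0 < xa) (ha2 : Γ * (((N : ℝ) ^ (K - 1)) ^ 2 * B ^ (K - 1) * (4 * ε)) ≤ xa ^ 2)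
    (hb : 0 < xb) (hb2 : K ≠ 1 → B * (8 * ε) ≤ xb ^ 2)
    (hc : 0 < xc) (hc2 : Γ * (8 * ε) ≤ xc ^ 2) :
    ((G.ctxAct i ξ h).expect fun x =>
      |rewardBar G.init G.P π i (G.meanReward i) x.1 h x.2 - rewardBar G.init P π i r x.1 h x.2| +
        H * PMF.l1 (G.P i h x.1 x.2.1 x.2.2) (P i h x.1 x.2.1 x.2.2)) ≤
      xa + N * H * xb + H * xc := by
  set D : 𝒞 → ℝ := fun c => if K = 1 then 0 else G.drift P π h c
  have hDb : ∀ c, D c ∈ Set.Icc (0 : ℝ) (N * (h * 2)) := by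
    intro c
    simp only [D]
    split_ifs
    · exact ⟨le_rfl, by positivity⟩
    · exact G.drift_mem_Icc P π h c
  have hD : G.ρ.expect D ≤ N * H * xb := by
    by_cases h1 : K = 1
    · simp only [D, h1, if_true, PMF.expect_const]; positivity
    · have : D = G.drift P π h := by funext c; simp only [D, if_neg h1]
      rw [this]
      exact G.expect_drift_le (by linarith) hh hdens hP hb (hb2 h1)
  have hD' : ((G.ctxAct i ξ h).expect fun x => D x.1) = G.ρ.expect D := by
    rw [ctxAct, PMF.expect_joint _ _ fun x => abs_le_of_mem_Icc_zero (hDb x.1)]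
    simp only [PMF.expect_const]
  have hA : ((G.ctxAct i ξ h).expect fun x => |G.rewardDiff i π r h x|) ≤ xa := by
    refine hξ.expect_le hΓ (b := 1) (fun x => ⟨abs_nonneg _, abs_rewardDiff_le hr x⟩)
      ((G.expect_rewardDiff_sq_le hB hr hrK hmK fun j c z => hdens j h hh c z).trans
        (mul_le_mul_of_nonneg_left hR (by positivity))) ha ha2
  have hC := hξ.expect_l1_le hΓ (hP i h hh) hc hc2
  have b1 : ∀ x, |(|G.rewardDiff i π r h x|)| ≤ 1 := fun x => by
    rw [abs_abs]; exact abs_rewardDiff_le hr x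
  have b2 : ∀ x : 𝒞 × (S i × A i), |H * PMF.l1 (G.P i h x.1 x.2.1 x.2.2)
      (P i h x.1 x.2.1 x.2.2)| ≤ H * 2 := fun x => by
    rw [abs_mul, Nat.abs_cast]
    exact mul_le_mul_of_nonneg_left (PMF.abs_l1_le_two _ _) (Nat.cast_nonneg _)
  have b3 := fun x : 𝒞 × (S i × A i) => abs_le_of_mem_Icc_zero (hDb x.1)
  have b4 := fun x : 𝒞 × (S i × A i) => (abs_add_le _ _).trans (add_le_add (b1 x) (b3 x))
  have h1 : ∀ x : 𝒞 × (S i × A i),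
      |rewardBar G.init G.P π i (G.meanReward i) x.1 h x.2 - rewardBar G.init P π i r x.1 h x.2| +
        H * PMF.l1 (G.P i h x.1 x.2.1 x.2.2) (P i h x.1 x.2.1 x.2.2) ≤
      (|G.rewardDiff i π r h x| + D x.1) +
        H * PMF.l1 (G.P i h x.1 x.2.1 x.2.2) (P i h x.1 x.2.1 x.2.2) := fun x =>
    add_le_add (G.abs_rewardBar_sub_le hr hK hrK x) le_rfl
  have b5 := fun x : 𝒞 × (S i × A i) => (abs_add_le _ _).trans (add_le_add (b4 x) (b2 x))
  refine (PMF.expect_mono _ (B := 1 + N * (h * 2) + H * 2) (fun x _ => ?_) (fun x _ => b5 x)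
    fun x _ => h1 x).trans ?_
  · rw [abs_of_nonneg (add_nonneg (abs_nonneg _)
      (mul_nonneg (Nat.cast_nonneg _) (PMF.l1_nonneg _ _)))]
    exact (h1 x).trans ((le_abs_self _).trans (b5 x))
  · rw [PMF.expect_add _ (fun x _ => b4 x) (fun x _ => b2 x),
      PMF.expect_add _ (fun x _ => b1 x) (fun x _ => b3 x), PMF.expect_const_mul, hD']
    have : H * ((G.ctxAct i ξ h).expect fun x =>
        PMF.l1 (G.P i h x.1 x.2.1 x.2.2) (P i h x.1 x.2.1 x.2.2)) ≤ H * xc := by gcongr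
    linarith

end ModelError

/-! ### Regret and gap of the iterates -/

section Gap

variable {N : ℕ} {𝒞 : Type*} {S A : Fin N → Type*} {G : DecoupledGame N 𝒞 S A}
  {σ : ∀ i, ℕ → 𝒞 → PMF (S i)} {ν : ∀ i, LocalPolicy 𝒞 (S i) (A i)} {H K : ℕ} {i : Fin N}

/-- The error of the model `(P, r)` at step `h`, averaged over the other agents. -/
noncomputable def DecoupledGame.modelErr (G : DecoupledGame N 𝒞 S A) (H : ℕ)
    (P : ∀ i, LocalKernel 𝒞 (S i) (A i)) (π : ∀ i, LocalPolicy 𝒞 (S i) (A i)) (i : Fin N)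
    (r : ℕ → RewardFn 𝒞 S A) (h : ℕ) (x : 𝒞 × (S i × A i)) : ℝ :=
  |rewardBar G.init G.P π i (G.meanReward i) x.1 h x.2 - rewardBar G.init P π i r x.1 h x.2| +
    H * PMF.l1 (G.P i h x.1 x.2.1 x.2.2) (P i h x.1 x.2.1 x.2.2)

/-- The advantage, in the estimated game, of the local policy `μ` over the iterate `π i`. -/
noncomputable def DecoupledGame.advantage (G : DecoupledGame N 𝒞 S A) (H : ℕ)
    (P : ∀ i, LocalKernel 𝒞 (S i) (A i)) (π : ∀ i, LocalPolicy 𝒞 (S i) (A i)) (i : Fin N)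
    (r : ℕ → RewardFn 𝒞 S A) (μ : LocalPolicy 𝒞 (S i) (A i)) (h : ℕ) (c : 𝒞) (s : S i) : ℝ :=
  (μ h c s).expect (singleQ H G.init P π i r h c s) -
    (π i h c s).expect (singleQ H G.init P π i r h c s)

theorem DecoupledGame.abs_advantage_le {P : ∀ i, LocalKernel 𝒞 (S i) (A i)}
    {π : ∀ i, LocalPolicy 𝒞 (S i) (A i)} {r : ℕ → RewardFn 𝒞 S A}
    (hr : ∀ h < H, ∀ c s a, r h c s a ∈ Set.Icc (0 : ℝ) 1) (μ : LocalPolicy 𝒞 (S i) (A i)) {h : ℕ}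
    (hh : h < H) (c : 𝒞) (s : S i) : |G.advantage H P π i r μ h c s| ≤ H + H := by
  have hq := fun a => abs_le_of_mem_Icc_zero
    (singleQ_mem_Icc (P := P) (π := π) G.init i (fun h hh => hr h hh c) hh s a)
  exact (abs_sub _ _).trans (add_le_add (PMF.abs_expect_le _ fun a _ => hq a)
    (PMF.abs_expect_le _ fun a _ => hq a))

theorem DecoupledGame.abs_modelErr_le {P : ∀ i, LocalKernel 𝒞 (S i) (A i)}
    {π : ∀ i, LocalPolicy 𝒞 (S i) (A i)} {r : ℕ → RewardFn 𝒞 S A}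
    (hr : ∀ h < H, ∀ c s a, r h c s a ∈ Set.Icc (0 : ℝ) 1) {h : ℕ} (hh : h < H)
    (x : 𝒞 × (S i × A i)) : |G.modelErr H P π i r h x| ≤ 1 + H * 2 := by
  refine (abs_add_le _ _).trans (add_le_add ?_ ?_)
  · rw [abs_abs]
    exact abs_sub_le_one_of_mem
      (rewardBar_mem_Icc (H := H) G.init i (fun h _ => G.meanReward_mem_Icc i h x.1) hh x.2)
      (rewardBar_mem_Icc G.init i (fun h hh => hr h hh x.1) hh x.2)
  · rw [abs_mul, Nat.abs_cast]
    exact mul_le_mul_of_nonneg_left (PMF.abs_l1_le_two _ _) (Nat.cast_nonneg _)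

theorem DecoupledGame.payoff_mem_Icc (hH : 1 ≤ H) (i : Fin N)
    (π : ∀ i, LocalPolicy 𝒞 (S i) (A i)) : G.payoff H i π ∈ Set.Icc (0 : ℝ) H :=
  PMF.expect_mem_Icc _ fun c _ =>
    valueFn_mem_Icc G.init (fun h _ => G.meanReward_mem_Icc i h c) hH i

/-- The bound `valueFn_update_sub_le` averaged over contexts. -/
theorem DecoupledGame.payoff_update_sub_le (hH : 1 ≤ H) {P : ∀ i, LocalKernel 𝒞 (S i) (A i)}
    {π : ∀ i, LocalPolicy 𝒞 (S i) (A i)} {r : ℕ → RewardFn 𝒞 S A}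
    (hr : ∀ h < H, ∀ c s a, r h c s a ∈ Set.Icc (0 : ℝ) 1) (μ : LocalPolicy 𝒞 (S i) (A i)) :
    G.payoff H i (Function.update π i μ) - G.payoff H i π ≤
      ∑ h ∈ Finset.range H, ((G.ρ.expect fun c => (visit (G.P i) (G.init i) μ c h).expect
          (G.advantage H P π i r μ h c)) +
        ((G.ctxAct i μ h).expect (G.modelErr H P π i r h) +
          (G.ctxAct i (π i) h).expect (G.modelErr H P π i r h))) := by
  have hv := fun (π : ∀ i, LocalPolicy 𝒞 (S i) (A i)) c => abs_le_of_mem_Icc_zero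
    (valueFn_mem_Icc (P := G.P) (π := π) G.init
      (fun h (_ : h < H) => G.meanReward_mem_Icc i h c) hH i)
  have b1 : ∀ h < H, ∀ c, |(visit (G.P i) (G.init i) μ c h).expect
      (G.advantage H P π i r μ h c)| ≤ H + H := fun h hh c =>
    PMF.abs_expect_le _ fun s _ => abs_advantage_le hr μ hh c s
  have b2 : ∀ h < H, ∀ (ξ : LocalPolicy 𝒞 (S i) (A i)) (c : 𝒞),
      |(visitAct (G.P i) (G.init i) ξ c h).expect fun z => G.modelErr H P π i r h (c, z)| ≤
        1 + H * 2 := fun h hh ξ c => PMF.abs_expect_le _ fun z _ => abs_modelErr_le hr hh (c, z)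
  have b3 := fun h hh c => (abs_add_le _ _).trans (add_le_add (b2 h hh μ c) (b2 h hh (π i) c))
  have b4 := fun h hh c => (abs_add_le _ _).trans (add_le_add (b1 h hh c) (b3 h hh c))
  rw [payoff, payoff, ← PMF.expect_sub _ (fun c _ => hv _ c) (fun c _ => hv _ c)]
  refine (PMF.expect_mono _ (fun c _ => (abs_sub _ _).trans (add_le_add (hv _ c) (hv _ c)))
    (fun c _ => (Finset.abs_sum_le_sum_abs _ _).trans (Finset.sum_le_sum fun h hh =>
      b4 h (Finset.mem_range.1 hh) c)) fun c _ => valueFn_update_sub_le G.init i hH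
      (fun h _ => G.meanReward_mem_Icc i h c) (fun h hh => hr h hh c) μ).trans ?_
  rw [PMF.expect_sum _ _ fun h hh c _ => b4 h (Finset.mem_range.1 hh) c]
  refine le_of_eq (Finset.sum_congr rfl fun h hh => ?_)
  have hh := Finset.mem_range.1 hh
  rw [PMF.expect_add _ (fun c _ => b1 h hh c) (fun c _ => b3 h hh c),
    PMF.expect_add _ (fun c _ => b2 h hh μ c) (fun c _ => b2 h hh (π i) c), ctxAct, ctxAct,
    PMF.expect_joint _ _ fun x => abs_modelErr_le hr hh x,
    PMF.expect_joint _ _ fun x => abs_modelErr_le hr hh x]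

/-- The density of the iterates with respect to the behavior policies. -/
theorem DecoupledGame.visitAct_le {CS W : ℝ} (hCS : 0 ≤ CS)
    (hS : ∀ i, ∀ μ : LocalPolicy 𝒞 (S i) (A i), ∀ h < H, ∀ c s,
      visit (G.P i) (G.init i) μ c h s ≤ ENNReal.ofReal CS * σ i h c s)
    {ξ : LocalPolicy 𝒞 (S i) (A i)} {h : ℕ} (hh : h < H)
    (hξ : ∀ c s a, (ξ h c s a).toReal ≤ W * (ν i h c s a).toReal) (c : 𝒞) (z : S i × A i) :
    visitAct (G.P i) (G.init i) ξ c h z ≤ ENNReal.ofReal (CS * W) * dataAct (σ i) (ν i) c h z := by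
  have h1 : ξ h c z.1 z.2 ≤ ENNReal.ofReal W * ν i h c z.1 z.2 := by
    rw [← ENNReal.ofReal_toReal ((ξ h c z.1).apply_ne_top z.2),
      ← ENNReal.ofReal_toReal ((ν i h c z.1).apply_ne_top z.2),
      ← ENNReal.ofReal_mul' ENNReal.toReal_nonneg]
    exact ENNReal.ofReal_le_ofReal (hξ c z.1 z.2)
  rw [← Prod.mk.eta (p := z), visitAct_eq_joint, dataAct, PMF.joint_apply, PMF.joint_apply,
    ENNReal.ofReal_mul hCS, mul_mul_mul_comm]
  exact mul_le_mul' (hS i ξ h hh c z.1) h1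

/-- The regret of the actor, against a covered policy. -/
theorem DecoupledGame.sum_advantage_le {lam eta C : ℝ} (hl : 0 < lam) (he : 0 < eta) (hC : 0 ≤ C)
    {T : ℕ} {P : ∀ i, LocalKernel 𝒞 (S i) (A i)} {π : ℕ → ∀ i, LocalPolicy 𝒞 (S i) (A i)}
    {r : ℕ → RewardFn 𝒞 S A} (hr : ∀ h < H, ∀ c s a, r h c s a ∈ Set.Icc (0 : ℝ) 1)
    (h0 : π 0 = ν) {μ : LocalPolicy 𝒞 (S i) (A i)} (hμ : μ ∈ G.covered H i (ν i) C)
    {h : ℕ} (hh : h < H)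
    (hmin : ∀ t < T, ∀ c s, ∀ p : PMF (A i),
      actorObjective lam eta (singleQ H G.init P (π t) i r h c s) (ν i h c s) (π t i h c s)
          (π (t + 1) i h c s) ≤
        actorObjective lam eta (singleQ H G.init P (π t) i r h c s) (ν i h c s) (π t i h c s) p) :
    ∑ t ∈ Finset.range T, (G.ρ.expect fun c => (visit (G.P i) (G.init i) μ c h).expect
      (G.advantage H P (π t) i r μ h c)) ≤ (T * lam + 1 / eta) * C + T * (eta * H ^ 2 / 4) := by
  have b1 : ∀ t c s, |G.advantage H P (π t) i r μ h c s| ≤ H + H := fun t c s =>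
    abs_advantage_le hr μ hh c s
  have b2 : ∀ c s, |∑ t ∈ Finset.range T, G.advantage H P (π t) i r μ h c s| ≤
      ∑ t ∈ Finset.range T, ((H : ℝ) + H) := fun c s =>
    (Finset.abs_sum_le_sum_abs _ _).trans (Finset.sum_le_sum fun t _ => b1 t c s)
  -- The visitation is that of `μ` under the true kernel, the same in every iteration. The sum over
  -- `t` therefore moves inside, where the regret bound holds at each state with a multiple of `χ²`
  -- whose mean is at most `C`.
  have h1 := expect_le_of_mean_le G.ρ (fun c => visit (G.P i) (G.init i) μ c h)
    (fun c s => chiSq (μ h c s) (ν i h c s)) (a := T * lam + 1 / eta) (b := T * (eta * H ^ 2 / 4))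
    hC (by positivity) (by positivity) (hμ h hh)
    (g := fun c s => ∑ t ∈ Finset.range T, G.advantage H P (π t) i r μ h c s) b2
    fun c s hx => by
      have hq := PMF.SqInt.of_chiSq_ne_top hx
      have := (PMF.actor_regret hl he (Nat.cast_nonneg H) (ν := ν i h c s) (q := μ h c s)
        (f := fun t => singleQ H G.init P (π t) i r h c s) (p := fun t => π t i h c s) (T := T)
        (fun t _ a => singleQ_mem_Icc G.init i (fun h hh => hr h hh c) hh s a) (by simp only [h0])
        hq fun t ht => hmin t ht c s).2
      rw [hq.chiSq_toReal]
      refine this.trans (le_of_eq ?_)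
      ring
  refine le_trans (le_of_eq ?_) h1
  rw [← PMF.expect_sum _ _ (B := fun _ => (H : ℝ) + H)
    fun t _ c _ => PMF.abs_expect_le _ fun s _ => b1 t c s]
  exact PMF.expect_congr _ fun c _ => (PMF.expect_sum _ _ (B := fun _ => (H : ℝ) + H)
    fun t _ s _ => b1 t c s).symm

end Gap

/-! ### Consequences of the choice of `λ`. -/

section Rates

variable {CS H N ε lam : ℝ} {K : ℕ}

/-- The balance between regularization and reward error: `B ^ K` puts `λ ^ K` in the denominator, so
`λ ^ (K + 2)` has to dominate; for `λ ≤ 1` the equation for `λ ^ (3K + 2)` suffices. -/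
theorem rate_reward (hCS : 1 ≤ CS) (hH : 1 ≤ H) (hε : 0 ≤ ε) (hl : 0 < lam)
    (hl1 : lam ≤ 1)
    (h : lam ^ (3 * K + 2) = CS ^ K * H ^ (3 * K) * (2 * N ^ 2) ^ (K - 1) * ε) :
    (N ^ (K - 1)) ^ 2 * (CS * H / lam) ^ K * ε ≤ lam ^ 2 := by
  have h1 : (N ^ (K - 1)) ^ 2 * (CS * H) ^ K * ε ≤ lam ^ (K + 2) :=
    calc _ = CS ^ K * H ^ K * (N ^ 2) ^ (K - 1) * ε := by
          rw [mul_pow, pow_right_comm]; ring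
      _ ≤ CS ^ K * H ^ (3 * K) * (2 * N ^ 2) ^ (K - 1) * ε := by
          gcongr
          · omega
          · nlinarith [sq_nonneg N]
      _ = lam ^ (3 * K + 2) := h.symm
      _ ≤ lam ^ (K + 2) := pow_le_pow_of_le_one hl.le hl1 (by omega)
  have h2 : (N ^ (K - 1)) ^ 2 * (CS * H / lam) ^ K * ε =
      (N ^ (K - 1)) ^ 2 * (CS * H) ^ K * ε / lam ^ K := by rw [div_pow]; ring
  rw [h2, div_le_iff₀ (by positivity)]
  exact h1.trans (le_of_eq (by ring))

/-- The exponent `min 1 (K - 1)` yields a factor `2 N²` exactly when `K ≥ 2`, the only case in which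
the drift of the other agents enters. -/
theorem rate_transition (hK : 1 ≤ K) (hCS : 1 ≤ CS) (hH : 1 ≤ H) (hN : 1 ≤ N) (hε : 0 ≤ ε)
    (hl : 0 < lam) (hl1 : lam ≤ 1)
    (h : lam ^ (3 * K + 2) = CS ^ K * H ^ (3 * K) * (2 * N ^ 2) ^ (K - 1) * ε) :
    (2 * N ^ 2) ^ (min 1 (K - 1)) * (H ^ 2 * (CS * H / lam * ε)) ≤ lam ^ 2 := by
  have hN2 : 1 ≤ 2 * N ^ 2 := by nlinarith
  have h1 : CS * H ^ 3 * (2 * N ^ 2) ^ (min 1 (K - 1)) * ε ≤ lam ^ 3 :=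
    calc CS * H ^ 3 * (2 * N ^ 2) ^ (min 1 (K - 1)) * ε ≤
          CS ^ K * H ^ (3 * K) * (2 * N ^ 2) ^ (K - 1) * ε := by
          gcongr
          · exact le_self_pow₀ hCS (by omega)
          · omega
          · exact min_le_right _ _
      _ = lam ^ (3 * K + 2) := h.symm
      _ ≤ lam ^ 3 := pow_le_pow_of_le_one hl.le hl1 (by omega)
  have h2 : (2 * N ^ 2) ^ (min 1 (K - 1)) * (H ^ 2 * (CS * H / lam * ε)) =
      CS * H ^ 3 * (2 * N ^ 2) ^ (min 1 (K - 1)) * ε / lam := by ring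
  rw [h2, div_le_iff₀ hl]
  exact h1.trans (le_of_eq (by ring))

end Rates

/-! ### The gain of a covered deviation. -/

section MainGap

variable {N : ℕ} {𝒞 : Type*} {S A : Fin N → Type*} {G : DecoupledGame N 𝒞 S A}
  {σ : ∀ i, ℕ → 𝒞 → PMF (S i)} {ν : ∀ i, LocalPolicy 𝒞 (S i) (A i)} {H K T : ℕ}
  {r : Fin N → ℕ → RewardFn 𝒞 S A} {P : ∀ i, LocalKernel 𝒞 (S i) (A i)}
  {π : ℕ → ∀ i, LocalPolicy 𝒞 (S i) (A i)} {CS C ε lam eta : ℝ}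

/-- The stable density bound `1 + H / (2 λ)`, with the `1` absorbed by means of `2 λ ≤ 1 ≤ H`. -/
theorem DecoupledGame.iterate_le (hH : 1 ≤ H) (hl : 0 < lam) (hl2 : lam ≤ 1 / 2) (he : 0 < eta)
    (hr : ∀ i, ∀ h < H, ∀ c s a, r i h c s a ∈ Set.Icc (0 : ℝ) 1) (h0 : π 0 = ν)
    (hmin : ∀ t < T, ∀ i, ∀ h < H, ∀ c s, ∀ p : PMF (A i),
      actorObjective lam eta (singleQ H G.init P (π t) i (r i) h c s) (ν i h c s) (π t i h c s)
          (π (t + 1) i h c s) ≤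
        actorObjective lam eta (singleQ H G.init P (π t) i (r i) h c s) (ν i h c s)
          (π t i h c s) p)
    {t : ℕ} (ht : t < T) (i : Fin N) {h : ℕ} (hh : h < H) (c : 𝒞) (s : S i) (a : A i) :
    (π t i h c s a).toReal ≤ H / lam * (ν i h c s a).toReal := by
  have := (PMF.actor_regret hl he (Nat.cast_nonneg H) (ν := ν i h c s) (q := ν i h c s)
    (f := fun t => singleQ H G.init P (π t) i (r i) h c s) (p := fun t => π t i h c s) (T := T)
    (fun t _ a => singleQ_mem_Icc G.init i (fun h hh => hr i h hh c) hh s a) (by simp only [h0])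
    (PMF.SqInt.self _) fun t ht => hmin t ht i h hh c s).1 t ht.le a
  refine this.trans (mul_le_mul_of_nonneg_right ?_ ENNReal.toReal_nonneg)
  have h1 : (1 : ℝ) ≤ H := by exact_mod_cast hH
  have e : (H : ℝ) / lam - (1 + H / (2 * lam)) = (H - 2 * lam) / (2 * lam) := by field_simp; ring
  have : 0 ≤ ((H : ℝ) - 2 * lam) / (2 * lam) := div_nonneg (by linarith) (by linarith)
  linarith

/-- The benefit of a deviation to a covered policy. -/
theorem DecoupledGame.devPayoff_sub_le (hH : 1 ≤ H) (hK : 1 ≤ K) (hCS : 1 ≤ CS) (hC : 1 ≤ C)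
    (hε : 0 ≤ ε) (hl : 0 < lam) (hl2 : lam ≤ 1 / 2)
    (hlam : lam ^ (3 * K + 2) =
      CS ^ K * (H : ℝ) ^ (3 * K) * (2 * (N : ℝ) ^ 2) ^ (K - 1) * ε)
    (heta : eta = lam / (H : ℝ) ^ 2) (hT : (H : ℝ) ^ 2 / lam ^ 2 ≤ T)
    (hS : ∀ i, ∀ μ : LocalPolicy 𝒞 (S i) (A i), ∀ h < H, ∀ c s,
      visit (G.P i) (G.init i) μ c h s ≤ ENNReal.ofReal CS * σ i h c s)
    (hr : ∀ i, ∀ h < H, ∀ c s a, r i h c s a ∈ Set.Icc (0 : ℝ) 1)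
    (hrK : ∀ i, ∀ h < H, RewardHasIR K i (r i h))
    (hmK : ∀ i, ∀ h < H, RewardHasIR K i (G.meanReward i h))
    (hR : ∀ i, ∀ h < H, G.rewardErr σ ν h i (r i h) ≤ 4 * ε)
    (hP : ∀ i, ∀ h < H, G.hellingerErr σ ν h i (P i h) ≤ ε) (h0 : π 0 = ν)
    (hmin : ∀ t < T, ∀ i, ∀ h < H, ∀ c s, ∀ p : PMF (A i),
      actorObjective lam eta (singleQ H G.init P (π t) i (r i) h c s) (ν i h c s) (π t i h c s)
          (π (t + 1) i h c s) ≤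
        actorObjective lam eta (singleQ H G.init P (π t) i (r i) h c s) (ν i h c s)
          (π t i h c s) p)
    (i : Fin N) {μ : LocalPolicy 𝒞 (S i) (A i)} (hμ : μ ∈ G.covered H i (ν i) C) :
    G.devPayoff H i T π μ - G.mixPayoff H i T π ≤ 29 * (C * (H * lam)) := by
  have hH' : (1 : ℝ) ≤ H := by exact_mod_cast hH
  have hN' : (1 : ℝ) ≤ N := by exact_mod_cast i.pos
  have hT0 : (0 : ℝ) < T := lt_of_lt_of_le (by positivity) hT
  have he : 0 < eta := by rw [heta]; positivity
  -- The density of the iterates' visitations with respect to the data: `CS` from states, `H / lam`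
  -- from actions.
  set B : ℝ := CS * H / lam with hB
  have hBCS : CS ≤ B := by
    rw [hB, le_div_iff₀ hl]
    exact mul_le_mul_of_nonneg_left (by linarith) (by linarith)
  have hB1 : 1 ≤ B := hCS.trans hBCS
  have hC2 : 1 ≤ C ^ 2 := one_le_pow₀ hC
  have hCC : C ≤ C ^ 2 := le_self_pow₀ hC two_ne_zero
  have rR := rate_reward (N := N) (K := K) hCS hH' hε hl (by linarith) hlam
  have rT := rate_transition hK hCS hH' hN' hε hl (by linarith) hlam
  rw [← hB] at rR rT
  have hdens : ∀ t < T, ∀ j, ∀ k < H, ∀ c z, visitAct (G.P j) (G.init j) (π t j) c k z ≤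
      ENNReal.ofReal B * dataAct (σ j) (ν j) c k z := fun t ht j k hk c z => by
    rw [hB, mul_div_assoc]
    exact visitAct_le (by linarith) hS hk
      (fun c s a => iterate_le hH hl hl2 he hr h0 hmin ht j hk c s a) c z
  have rT' : (H : ℝ) ^ 2 * (B * ε) ≤ lam ^ 2 := by
    refine le_trans (le_mul_of_one_le_left (by positivity) ?_) rT
    exact one_le_pow₀ (by nlinarith)
  have hmodel : ∀ t < T, ∀ h < H, ∀ ξ : LocalPolicy 𝒞 (S i) (A i),
      ShiftBound (G.ctxAct i ξ h) (G.ctxData σ ν i h) (4 * C ^ 2 * B) →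
      (G.ctxAct i ξ h).expect (G.modelErr H P (π t) i (r i) h) ≤ 13 * (C * lam) := by
    intro t ht h hh ξ hξ
    -- The side conditions reduce to `16 ≤ 4²` for the reward, `8 N² H² B ε ≤ 4 λ² ≤ (3 λ)²` for the
    -- drift and `32 ≤ 6²` for the agent's own transitions. The errors add up to `4 + 3 + 6 = 13`
    -- units of `C λ`.
    have h1 := G.expect_modelErr_le (xa := 4 * C * lam) (xb := 3 * lam / (N * H))
      (xc := 6 * C * lam / H) hB1 (by positivity) hh (hr i h hh) hK (hrK i h hh) (hmK i h hh)
      (hdens t ht) (hR i h hh) hP hξ (by positivity) ?_ (by positivity) ?_ (by positivity) ?_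
    · refine h1.trans ?_
      have e : 4 * C * lam + N * H * (3 * lam / (N * H)) + H * (6 * C * lam / H) =
        10 * (C * lam) + 3 * lam := by field_simp; ring
      have : lam ≤ C * lam := le_mul_of_one_le_left hl.le hC
      linarith
    · have e : B ^ K = B * B ^ (K - 1) := by rw [← pow_succ', Nat.sub_add_cancel hK]
      calc _ = 16 * C ^ 2 * (((N : ℝ) ^ (K - 1)) ^ 2 * B ^ K * ε) := by rw [e]; ring
        _ ≤ 16 * C ^ 2 * lam ^ 2 := by gcongr
        _ = _ := by ring
    · intro h1
      have hm : min 1 (K - 1) = 1 := by omega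
      rw [hm, pow_one] at rT
      have : 0 ≤ (N : ℝ) ^ 2 * (H ^ 2 * (B * ε)) := by positivity
      rw [div_pow, le_div_iff₀ (by positivity), mul_pow]
      nlinarith
    · rw [div_pow, le_div_iff₀ (by positivity)]
      calc _ = 32 * C ^ 2 * ((H : ℝ) ^ 2 * (B * ε)) := by ring
        _ ≤ 32 * C ^ 2 * lam ^ 2 := by gcongr
        _ ≤ (6 * C * lam) ^ 2 := by nlinarith [sq_nonneg (C * lam)]
  -- One constant serves `μ` and the iterates: `CS (2 C + 2) ≤ 4 C² B`, since `C ≥ 1` and `CS ≤ B`.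
  -- The square turns into a linear factor `C` after the root.
  have hΓμ : ∀ h < H, ShiftBound (G.ctxAct i μ h) (G.ctxData σ ν i h) (4 * C ^ 2 * B) :=
    fun h hh => (ShiftBound.of_coverage (by linarith) (by linarith)
      (fun c s => hS i μ h hh c s) (hμ h hh)).mono (by nlinarith)
  have hΓπ : ∀ t < T, ∀ h < H,
      ShiftBound (G.ctxAct i (π t i) h) (G.ctxData σ ν i h) (4 * C ^ 2 * B) :=
    fun t ht h hh => (ShiftBound.of_le_mul (by linarith)
      (PMF.joint_le_mul _ (hdens t ht i h hh))).mono (by nlinarith)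
  have hadv : ∀ h < H, ∑ t ∈ Finset.range T, (G.ρ.expect fun c =>
      (visit (G.P i) (G.init i) μ c h).expect (G.advantage H P (π t) i (r i) μ h c)) ≤
      T * (3 * (C * lam)) := by
    intro h hh
    refine (sum_advantage_le hl he (by linarith) (hr i) h0 hμ hh
      fun t ht => hmin t ht i h hh).trans ?_
    -- The number of iterations is chosen so that the initial distance `C / (η T)` is at most `C λ`.
    have e1 : 1 / eta ≤ T * lam := by
      rw [div_le_iff₀ (by positivity)] at hT
      rw [heta, one_div_div, div_le_iff₀ hl]
      linarith
    have e2 : eta * (H : ℝ) ^ 2 / 4 = lam / 4 := by rw [heta]; field_simp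
    rw [e2]
    have e3 : (T : ℝ) * lam ≤ T * lam * C := le_mul_of_one_le_right (by positivity) hC
    have e4 : 1 / eta * C ≤ T * lam * C := mul_le_mul_of_nonneg_right e1 (by linarith)
    have e5 : 0 < (T : ℝ) * lam := by positivity
    linarith
  -- The constant is `29 = 3 + 2 · 13`: the regret, and the model error under `μ` and under the
  -- iterate.
  have hsum : ∑ t ∈ Finset.range T,
      (G.payoff H i (Function.update (π t) i μ) - G.payoff H i (π t)) ≤
      T * (29 * (C * (H * lam))) := by
    calc _ ≤ ∑ t ∈ Finset.range T, ∑ h ∈ Finset.range H, ((G.ρ.expect fun c =>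
          (visit (G.P i) (G.init i) μ c h).expect (G.advantage H P (π t) i (r i) μ h c)) +
          26 * (C * lam)) := Finset.sum_le_sum fun t ht =>
            (G.payoff_update_sub_le hH (hr i) μ).trans (Finset.sum_le_sum fun h hh => by
              have ht := Finset.mem_range.1 ht
              have hh := Finset.mem_range.1 hh
              have h1 := hmodel t ht h hh _ (hΓμ h hh)
              have h2 := hmodel t ht h hh _ (hΓπ t ht h hh)
              linarith)
      _ = ∑ h ∈ Finset.range H, ((∑ t ∈ Finset.range T, G.ρ.expect fun c =>
          (visit (G.P i) (G.init i) μ c h).expect (G.advantage H P (π t) i (r i) μ h c)) +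
          T * (26 * (C * lam))) := by
            rw [Finset.sum_comm]
            simp [Finset.sum_add_distrib]
      _ ≤ ∑ h ∈ Finset.range H, (T * (29 * (C * lam))) := Finset.sum_le_sum fun h hh => by
            have := hadv h (Finset.mem_range.1 hh)
            linarith
      _ = _ := by simp; ring
  rw [devPayoff, mixPayoff, mixPayoff, ← sub_div, ← Finset.sum_sub_distrib, div_le_iff₀ hT0]
  linarith

end MainGap

/-! ### Suprema over deviations and the sample size. -/

section Final

theorem PMF.one_le_of_le_mul {α : Type*} {p q : PMF α} {C : ℝ}
    (h : ∀ a, p a ≤ ENNReal.ofReal C * q a) : 1 ≤ C := by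
  rw [← ENNReal.one_le_ofReal]
  calc (1 : ℝ≥0∞) = ∑' a, p a := p.tsum_coe.symm
    _ ≤ ∑' a, ENNReal.ofReal C * q a := ENNReal.tsum_le_tsum h
    _ = ENNReal.ofReal C := by rw [ENNReal.tsum_mul_left, q.tsum_coe, mul_one]

theorem PMF.le_mul_of_div_le {α : Type*} {p q : PMF α} {C : ℝ} {a : α}
    (h : p a / q a ≤ ENNReal.ofReal C) : p a ≤ ENNReal.ofReal C * q a :=
  (ENNReal.div_le_iff_le_mul (Or.inr ENNReal.ofReal_ne_top) (Or.inl (q.apply_ne_top a))).1 h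

/-- Termwise `(p - q)² / q ≤ C p + q`, so the divergence is at most `C + 1 ≤ 2 C`. -/
theorem chiSq_le_of_le_mul {α : Type*} {p q : PMF α} {C : ℝ}
    (h : ∀ a, p a ≤ ENNReal.ofReal C * q a) : chiSq p q ≤ ENNReal.ofReal (2 * C) := by
  have hC := PMF.one_le_of_le_mul h
  have h1 : chiSq p q ≤ ∑' a, (ENNReal.ofReal C * p a + q a) := by
    refine ENNReal.tsum_le_tsum fun a => ENNReal.div_le_of_le_mul ?_
    have h2 := h a
    rw [← ENNReal.ofReal_toReal (p.apply_ne_top a), ← ENNReal.ofReal_toReal (q.apply_ne_top a),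
      ← ENNReal.ofReal_mul (by linarith)] at h2 ⊢
    have hp := ENNReal.toReal_nonneg (a := p a)
    have hq := ENNReal.toReal_nonneg (a := q a)
    rw [ENNReal.ofReal_le_ofReal_iff (by positivity)] at h2
    rw [← ENNReal.ofReal_add (by positivity) hq, ← ENNReal.ofReal_mul (by positivity),
      ENNReal.toReal_ofReal hp, ENNReal.toReal_ofReal hq]
    refine ENNReal.ofReal_le_ofReal ?_
    nlinarith [mul_nonneg hp hq]
  refine h1.trans ?_
  rw [ENNReal.tsum_add, ENNReal.tsum_mul_left, p.tsum_coe, q.tsum_coe, mul_one,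
    ← ENNReal.ofReal_one, ← ENNReal.ofReal_add (by linarith) zero_le_one]
  exact ENNReal.ofReal_le_ofReal (by linarith)

theorem chiSq_self {α : Type*} (p : PMF α) : chiSq p p = 0 := by
  simp [chiSq, bregman]

variable {N : ℕ} {𝒞 : Type*} {S A : Fin N → Type*} {G : DecoupledGame N 𝒞 S A} {H T : ℕ}
  {π : ℕ → ∀ i, LocalPolicy 𝒞 (S i) (A i)} {i : Fin N} {ν μ : LocalPolicy 𝒞 (S i) (A i)} {C : ℝ}

theorem DecoupledGame.mem_covered (h : ∀ h < H, ∀ c s, chiSq (μ h c s) (ν h c s) ≤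
    ENNReal.ofReal C) : μ ∈ G.covered H i ν C := by
  intro k hk
  have h1 : ∀ c, ∑' s, visit (G.P i) (G.init i) μ c k s * chiSq (μ k c s) (ν k c s) ≤
      ENNReal.ofReal C := fun c => by
    refine (ENNReal.tsum_le_tsum fun s => mul_le_mul_right (h k hk c s) _).trans ?_
    rw [ENNReal.tsum_mul_right, PMF.tsum_coe, one_mul]
  refine (ENNReal.tsum_le_tsum fun c => mul_le_mul_right (h1 c) _).trans ?_
  rw [ENNReal.tsum_mul_right, PMF.tsum_coe, one_mul]

theorem DecoupledGame.mixPayoff_mem_Icc (hH : 1 ≤ H) (i : Fin N) (T : ℕ)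
    (π : ℕ → ∀ i, LocalPolicy 𝒞 (S i) (A i)) : G.mixPayoff H i T π ∈ Set.Icc (0 : ℝ) H := by
  have h : ∑ t ∈ Finset.range T, G.payoff H i (π t) ≤ ∑ t ∈ Finset.range T, (H : ℝ) :=
    Finset.sum_le_sum fun t _ => (G.payoff_mem_Icc hH i (π t)).2
  rw [Finset.sum_const, Finset.card_range, nsmul_eq_mul] at h
  exact ⟨div_nonneg (Finset.sum_nonneg fun t _ => (G.payoff_mem_Icc hH i (π t)).1)
    (Nat.cast_nonneg _), div_le_of_le_mul₀ (Nat.cast_nonneg _) (Nat.cast_nonneg _) (by linarith)⟩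

theorem DecoupledGame.bddAbove_devPayoff (hH : 1 ≤ H) :
    BddAbove (Set.range (G.devPayoff H i T π)) :=
  ⟨H, by rintro _ ⟨μ, rfl⟩; exact (G.mixPayoff_mem_Icc hH i T _).2⟩

theorem DecoupledGame.nonempty_covered (ν : LocalPolicy 𝒞 (S i) (A i)) (C : ℝ) :
    Nonempty (G.covered H i ν C) :=
  ⟨⟨ν, mem_covered fun h _ c s => by rw [chiSq_self]; exact zero_le⟩⟩

theorem DecoupledGame.subopt_nonneg (hH : 1 ≤ H) (ν : LocalPolicy 𝒞 (S i) (A i)) (C : ℝ) :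
    0 ≤ G.subopt H i ν C T π := by
  have := G.nonempty_covered (H := H) ν C
  exact sub_nonneg.2 (ciSup_le fun μ => le_ciSup (bddAbove_devPayoff hH) μ.1)

theorem DecoupledGame.gap_le {x : ℝ}
    (h : ∀ μ ∈ G.covered H i ν C, G.devPayoff H i T π μ - G.mixPayoff H i T π ≤ x) :
    G.gap H i T π ≤ x + G.subopt H i ν C T π := by
  have := G.nonempty_covered (H := H) ν C
  have h1 : ⨆ μ : G.covered H i ν C, G.devPayoff H i T π μ ≤ x + G.mixPayoff H i T π :=
    ciSup_le fun μ => by linarith [h μ.1 μ.2]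
  rw [gap, subopt]
  linarith

end Final

/-- Clearing the fractional exponents once allows the rest of the argument to use natural powers
only. -/
theorem rpow_rate_pow {CS H N ε lam : ℝ} {K : ℕ} (hK : 1 ≤ K) (hCS : 0 ≤ CS) (hH : 0 ≤ H)
    (hε : 0 ≤ ε)
    (h : lam = CS ^ ((K : ℝ) / (3 * K + 2)) * H ^ ((3 * K : ℝ) / (3 * K + 2)) *
      (2 * N ^ 2) ^ ((K - 1 : ℝ) / (3 * K + 2)) * ε ^ ((1 : ℝ) / (3 * K + 2))) :
    lam ^ (3 * K + 2) = CS ^ K * H ^ (3 * K) * (2 * N ^ 2) ^ (K - 1) * ε := by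
  have key : ∀ {x : ℝ} {e : ℝ} (n : ℕ), 0 ≤ x → e = n →
      (x ^ (e / (3 * K + 2))) ^ (3 * K + 2) = x ^ n := by
    intro x e n hx he
    rw [← Real.rpow_natCast, ← Real.rpow_mul hx, ← Real.rpow_natCast, he]
    congr 1
    push_cast
    field_simp
  rw [h, mul_pow, mul_pow, mul_pow, key K hCS rfl, key (3 * K) hH (by push_cast; ring),
    key (K - 1) (by positivity) (by push_cast [Nat.cast_sub hK]; ring),
    key 1 hε (by push_cast; ring), pow_one]

theorem mul_rpow_rate {CS H N ε : ℝ} {K : ℕ} (hH : 0 < H) :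
    CS ^ ((K : ℝ) / (3 * K + 2)) * H ^ ((6 * K + 2 : ℝ) / (3 * K + 2)) *
      (2 * N ^ 2) ^ ((K - 1 : ℝ) / (3 * K + 2)) * ε ^ ((1 : ℝ) / (3 * K + 2)) =
    H * (CS ^ ((K : ℝ) / (3 * K + 2)) * H ^ ((3 * K : ℝ) / (3 * K + 2)) *
      (2 * N ^ 2) ^ ((K - 1 : ℝ) / (3 * K + 2)) * ε ^ ((1 : ℝ) / (3 * K + 2))) := by
  have : H ^ ((6 * K + 2 : ℝ) / (3 * K + 2)) = H * H ^ ((3 * K : ℝ) / (3 * K + 2)) := by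
    rw [← Real.rpow_one_add' hH.le (by positivity)]
    congr 1
    field_simp
    ring
  rw [this]
  ring

theorem accuracy_of_sample_size {CS Csin H N L M ε' lam : ℝ} {K : ℕ} (hε' : 0 < ε') (hM : 0 < M)
    (hlam : lam ^ (3 * K + 2) = CS ^ K * H ^ (3 * K) * (2 * N ^ 2) ^ (K - 1) * (L / M))
    (h : 58 ^ (3 * K + 2) * (Csin ^ (3 * K + 2) * CS ^ K * H ^ (6 * K + 2) *
      (2 * N ^ 2) ^ (K - 1) * L / ε' ^ (3 * K + 2)) ≤ M) :
    29 * (2 * Csin * (H * lam)) ≤ ε' := by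
  refine le_of_pow_le_pow_left₀ (n := 3 * K + 2) (by omega) hε'.le ?_
  rw [← mul_div_assoc, div_le_iff₀ (by positivity)] at h
  calc (29 * (2 * Csin * (H * lam))) ^ (3 * K + 2) =
        58 ^ (3 * K + 2) * Csin ^ (3 * K + 2) * H ^ (3 * K + 2) * lam ^ (3 * K + 2) := by
        rw [← mul_pow, ← mul_pow, ← mul_pow]; ring_nf
    _ = 58 ^ (3 * K + 2) * (Csin ^ (3 * K + 2) * CS ^ K * H ^ (6 * K + 2) *
          (2 * N ^ 2) ^ (K - 1) * L) / M := by
        rw [hlam, show 6 * K + 2 = 3 * K + 2 + 3 * K by ring, pow_add H (3 * K + 2)]; ring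
    _ ≤ ε' ^ (3 * K + 2) := by rwa [div_le_iff₀ hM, mul_comm (ε' ^ _)]

theorem mainTheorem3 :
    ∃ κ : ℝ, 0 < κ ∧ ∃ κ' : ℕ → ℝ, (∀ K, 0 < κ' K) ∧
    ∀ (N H K M : ℕ), 1 ≤ N → 1 ≤ H → 1 ≤ K → 1 ≤ M →
    ∀ (𝒞 : Type*) (S : Fin N → Type*) (A : Fin N → Type*) (G : DecoupledGame N 𝒞 S A)
      (σ : ∀ i, ℕ → 𝒞 → PMF (S i)) (ν : ∀ i, LocalPolicy 𝒞 (S i) (A i))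
      (Rc : Fin N → Finset (RewardFn 𝒞 S A)) (Pc : ∀ i, Finset (𝒞 → S i → A i → PMF (S i)))
      (CS δ : ℝ),
    -- the reward classes consist of functions with values in `[0, 1]`
    (∀ i, ∀ r ∈ Rc i, ∀ c s a, r c s a ∈ Set.Icc (0 : ℝ) 1) →
    -- realizability
    (∀ i, ∀ h < H, G.meanReward i h ∈ Rc i ∧ G.P i h ∈ Pc i) →
    -- interaction rank
    (∀ i, ∀ r ∈ Rc i, RewardHasIR K i r) →
    -- single-agent all-policy concentrability of local states
    (∀ i, ∀ μ : LocalPolicy 𝒞 (S i) (A i), ∀ h < H, ∀ c s,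
      visit (G.P i) (G.init i) μ c h s / σ i h c s ≤ ENNReal.ofReal CS) →
    0 < δ → δ ≤ 1 →
    ∀ (L ε lam eta : ℝ) (T : ℕ),
    L = Real.log (N * H * (Finset.univ.sup fun i => (Rc i).card : ℕ) *
      (Finset.univ.sup fun i => (Pc i).card : ℕ) / δ) →
    ε = L / M →
    lam = CS ^ ((K : ℝ) / (3 * K + 2)) * (H : ℝ) ^ ((3 * K : ℝ) / (3 * K + 2)) *
      (2 * (N : ℝ) ^ 2) ^ ((K - 1 : ℝ) / (3 * K + 2)) * ε ^ ((1 : ℝ) / (3 * K + 2)) →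
    eta = lam / (H : ℝ) ^ 2 →
    T = ⌈(H : ℝ) ^ 2 / lam ^ 2⌉₊ →
    ∀ (Ω : Type*) (_ : MeasurableSpace Ω) (μ : Measure Ω) (_ : IsProbabilityMeasure μ)
      (D : ℕ → Fin M → Ω → Sample 𝒞 S A), G.IsDataset H M σ ν μ D →
    ∃ E : Set Ω, MeasurableSet E ∧ ENNReal.ofReal (1 - δ) ≤ μ E ∧
      ∀ ω ∈ E, ∀ π : ℕ → ∀ i, LocalPolicy 𝒞 (S i) (A i),
        G.IsDRAC H ν Rc Pc (fun h m => D h m ω) lam eta T π →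
        (⨆ i, G.gap H i T π) ≤ κ * ⨆ i, ⨅ C : Set.Ici (1 : ℝ),
            ((C : ℝ) * (CS ^ ((K : ℝ) / (3 * K + 2)) *
              (H : ℝ) ^ ((6 * K + 2 : ℝ) / (3 * K + 2)) *
              (2 * (N : ℝ) ^ 2) ^ ((K - 1 : ℝ) / (3 * K + 2)) *
              ε ^ ((1 : ℝ) / (3 * K + 2))) + G.subopt H i (ν i) C T π) ∧
        -- sample complexity under single-agent all-policy concentrability of actions
        ∀ Csin : ℝ, (∀ i, ∀ μ' : LocalPolicy 𝒞 (S i) (A i), ∀ h < H, ∀ c s a,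
            μ' h c s a / ν i h c s a ≤ ENNReal.ofReal Csin) →
          ∀ ε' : ℝ, 0 < ε' →
            κ' K * (Csin ^ (3 * K + 2) * CS ^ K * (H : ℝ) ^ (6 * K + 2) *
              (2 * (N : ℝ) ^ 2) ^ (K - 1) * L / ε' ^ (3 * K + 2)) ≤ M →
            G.IsApproxCCE H T π ε' := by
  -- Here `58 = 29 · 2`, the `2` coming from the coverage constant `C = 2 Csin`.
  refine ⟨29, by norm_num, fun K => 58 ^ (3 * K + 2), fun K => by positivity, ?_⟩
  intro N H K M hN hH hK hM 𝒞 S A G σ ν Rc Pc CS δ hRc hreal hIR hCS hδ hδ1 L ε lam eta T hL hε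
    hlam heta hT Ω _ P _ D hD
  set nR := Finset.univ.sup fun i => (Rc i).card with hnR
  set nP := Finset.univ.sup fun i => (Pc i).card with hnP
  have hcR : ∀ i, (Rc i).card ≤ nR := fun i =>
    Finset.le_sup (f := fun i => (Rc i).card) (Finset.mem_univ i)
  have hcP : ∀ i, (Pc i).card ≤ nP := fun i =>
    Finset.le_sup (f := fun i => (Pc i).card) (Finset.mem_univ i)
  have i₀ : Fin N := ⟨0, hN⟩
  have hnR1 : 1 ≤ nR := (Finset.card_pos.2 ⟨_, (hreal i₀ 0 hH).1⟩).trans_le (hcR i₀)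
  have hnP1 : 1 ≤ nP := (Finset.card_pos.2 ⟨_, (hreal i₀ 0 hH).2⟩).trans_le (hcP i₀)
  have hn : (1 : ℝ) ≤ N * H * nR * nP := by
    exact_mod_cast Nat.succ_le_of_lt (by positivity)
  have hS : ∀ i, ∀ μ : LocalPolicy 𝒞 (S i) (A i), ∀ h < H, ∀ c s,
      visit (G.P i) (G.init i) μ c h s ≤ ENNReal.ofReal CS * σ i h c s :=
    fun i μ h hh c s => PMF.le_mul_of_div_le (hCS i μ h hh c s)
  obtain ⟨c₀, -⟩ := G.ρ.support_nonempty
  have hCS1 : 1 ≤ CS := PMF.one_le_of_le_mul (hS i₀ (ν i₀) 0 hH c₀)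
  have hL0 : 0 ≤ L := hL ▸ Real.log_nonneg ((one_le_div hδ).2 (hδ1.trans hn))
  -- If `L = 0`, then `δ = N H nR nP ≥ 1`, so the required probability is zero and the empty event
  -- suffices.
  rcases hL0.eq_or_lt with hL0' | hLpos
  · refine ⟨∅, MeasurableSet.empty, ?_, fun ω hω => hω.elim⟩
    have h1 : (N * H * nR * nP : ℝ) / δ = 1 :=
      Real.eq_one_of_pos_of_log_eq_zero (by positivity) (by rw [← hL, ← hL0'])
    rw [div_eq_one_iff_eq hδ.ne'] at h1
    rw [ENNReal.ofReal_of_nonpos (by linarith)]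
    exact zero_le
  have hLδ : N * H * nR * nP * Real.exp (-L) ≤ δ := by
    rw [hL, Real.exp_neg, Real.exp_log (by positivity), inv_div, mul_div_cancel₀ _ (by positivity)]
  obtain ⟨E, hE, hPE, hgood⟩ := hD.exists_event hRc hreal hM hδ hL0 hε hcR hcP hLδ
  refine ⟨E, hE, hPE, fun ω hω π ⟨r, P', hr, hP', h0, hmin⟩ => ?_⟩
  have hM0 : (0 : ℝ) < M := by exact_mod_cast hM
  have hH0 : (0 : ℝ) < H := by exact_mod_cast hH
  have hN0 : (0 : ℝ) < N := by exact_mod_cast hN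
  have hεpos : 0 < ε := by rw [hε]; positivity
  have hl : 0 < lam := by rw [hlam]; positivity
  have hpow := rpow_rate_pow hK (by linarith) hH0.le hεpos.le hlam
  have hdev : ∀ i, ∀ C : ℝ, 1 ≤ C → ∀ μ ∈ G.covered H i (ν i) C,
      G.devPayoff H i T π μ - G.mixPayoff H i T π ≤ 29 * (C * (H * lam)) := by
    intro i C hC μ hμ
    rcases le_total lam (1 / 2) with hl2 | hl2
    · exact G.devPayoff_sub_le hH hK hCS1 hC hεpos.le hl hl2 hpow heta (hT ▸ Nat.le_ceil _) hS
        (fun i h hh => hRc i _ (hr i h hh).1) (fun i h hh => hIR i _ (hr i h hh).1)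
        (fun i h hh => hIR i _ (hreal i h hh).1)
        (fun i h hh => (hgood ω hω i h hh).1 _ (hr i h hh).1 ((hr i h hh).2 _ (hreal i h hh).1))
        (fun i h hh => (hgood ω hω i h hh).2 _ (hP' i h hh).1
          ((hP' i h hh).2 _ (hreal i h hh).2)) h0 hmin i hμ
    -- For `λ ≥ 1/2` the gain is at most `H ≤ 2 H λ`.
    · have h1 := (G.mixPayoff_mem_Icc hH i T π).1
      have h2 : G.devPayoff H i T π μ ≤ H := (G.mixPayoff_mem_Icc hH i T _).2
      have h3 : (H : ℝ) * (1 / 2) ≤ H * lam := by gcongr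
      have h4 : (H : ℝ) * lam ≤ C * (H * lam) := le_mul_of_one_le_left (by positivity) hC
      linarith
  constructor
  · rw [mul_rpow_rate hH0, ← hlam]
    have : Nonempty (Fin N) := ⟨i₀⟩
    refine ciSup_le fun i => ?_
    have h1 : G.gap H i T π / 29 ≤ ⨅ C : Set.Ici (1 : ℝ),
        ((C : ℝ) * (H * lam) + G.subopt H i (ν i) C T π) := by
      have : Nonempty (Set.Ici (1 : ℝ)) := ⟨⟨1, Set.self_mem_Ici⟩⟩
      refine le_ciInf fun C => ?_
      have h2 := DecoupledGame.gap_le (hdev i C C.2)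
      -- Nonnegativity allows the factor `29` to be put in front of the bias term as well.
      have h3 := G.subopt_nonneg (T := T) (π := π) hH (ν i) C
      rw [div_le_iff₀ (by norm_num)]
      linarith
    have h2 := h1.trans (le_ciSup (f := fun i => ⨅ C : Set.Ici (1 : ℝ),
      ((C : ℝ) * (H * lam) + G.subopt H i (ν i) C T π)) (Set.finite_range _).bddAbove i)
    rwa [div_le_iff₀' (by norm_num)] at h2
  · intro Csin hsin ε' hε' hsize i
    have hA : ∀ μ : LocalPolicy 𝒞 (S i) (A i), ∀ h < H, ∀ c s a,
        μ h c s a ≤ ENNReal.ofReal Csin * ν i h c s a :=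
      fun μ h hh c s a => PMF.le_mul_of_div_le (hsin i μ h hh c s a)
    have hCsin : 1 ≤ Csin := PMF.one_le_of_le_mul (hA (ν i) 0 hH c₀ (G.init i))
    rw [hε] at hpow
    have hacc := accuracy_of_sample_size hε' hM0 hpow hsize
    have : Nonempty (LocalPolicy 𝒞 (S i) (A i)) := ⟨ν i⟩
    have h1 : ⨆ μ, G.devPayoff H i T π μ ≤ ε' + G.mixPayoff H i T π := ciSup_le fun μ => by
      -- Bounded action densities place every local policy in the covered class at `C = 2 Csin`, so
      -- there is no off-support bias.
      have := hdev i (2 * Csin) (by linarith) μ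
        (DecoupledGame.mem_covered fun h hh c s => chiSq_le_of_le_mul (hA μ h hh c s))
      linarith
    rw [DecoupledGame.gap]
    linarith
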